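/- Let $G$ be a finite simple graph with more than $6$ vertices that is triconnected (it has at least four vertices and remains connected after deletion of any two vertices). **Cutsets and parts.** A set $S\subset V(G)$ is a *cutset* if $G-S$ is disconnected; $\mathfrak R_3(G)$ is the set of cutsets with exactly three vertices (*3-cutsets*). A set $R\subset V(G)$ *splits* $X\subset V(G)$ if the vertices of $X\setminus R$ do not all lie in one connected component of $G-R$. It *separates* a vertex $x\notin R$ from a set $W\not\subset R$ if no vertex of $W\setminus R$ lies in the component of $G-R$ containing $x$. For $\mathfrak S\subset\mathfrak R_3(G)$, $\mathrm{Part}(\mathfrak S)$ is the set of inclusion-maximal vertex sets split by no member of $\mathfrak S$; for a part $A$, its boundary $\mathrm{Bound}(A)$ consists of the vertices of $A$ that lie in some member of $\mathfrak S$, and its interior is $\mathrm{Int}(A)=A\setminus\mathrm{Bound}(A)$; $A$ is *empty* if $\mathrm{Int}(A)=\varnothing$. We say that $S\in\mathfrak R_3(G)$ splits $G$ into $|\mathrm{Part}(\{S\})|$ parts. **Flowers.** Let $p,q_1,\dots,q_m$ be distinct vertices, $m\ge 4$, with the indices of the $q_i$ taken modulo $m$. Put $Q_{i,j}=\{p,q_i,q_j\}$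 and let $\mathfrak R(F)$ be the set of all $Q_{i,j}$ with $i\neq j$ not neighbouring in the cyclic order. The tuple $F=(p;q_1,\dots,q_m)$ is a *flower* with center $p$ and petals $q_i$ if there is a set $\mathfrak S\subset\mathfrak R(F)\cap\mathfrak R_3(G)$ such that $\mathrm{Part}(\mathfrak S)$ consists of exactly $m$ parts $G_{1,2},G_{2,3},\dots,G_{m,1}$ with $\mathrm{Bound}(G_{i,i+1})=Q_{i,i+1}$; these parts are fixed below. Put $V(F)=\{p,q_1,\dots,q_m\}$. The flower is *maximal* if there is no flower with the same center whose vertex set properly contains $V(F)$. It is *nondegenerate* if there is no set of three edges of $G$ whose deletion disconnects $G$ and whose set of ends contains $V(F)$. It is *singular* if $p$ has degree $3$; then $T(p)$ denotes the set of neighbours of $p$. **The neighborhood.** Let $F$ be maximal and nondegenerate. If $F$ is singular and $G_{i,i+1}$ is nonempty, let $u_{i,i+1}$ be the only neighbour of $p$ in $G_{i,i+1}$. If $F$ is not singular, $G_{i-1,i}$ and $G_{i+1,i+2}$ are empty, and $G_{i,i+1}$ contains exactly one neighbour of $p$, let $u_{i,i+1}$ be that neighbour. In all other cases put $u_{i,i+1}=p$.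 Put $\mathrm{Nb}(F)=V(F)\cup\{u_{1,2},u_{2,3},\dots,u_{m,1}\}$ and $Q'_{i,i+1}=\{q_i,u_{i,i+1},q_{i+1}\}$. Let $M_{i,i+1}$ be the three-element set of vertices and edges consisting of - the vertex $p$; - the edge $q_{i-1}q_i$ if $G_{i-1,i}$ is empty, and the vertex $q_i$ otherwise; - the edge $q_{i+1}q_{i+2}$ if $G_{i+1,i+2}$ is empty, and the vertex $q_{i+1}$ otherwise. If $u_{i,i+1}\ne p$, let $M'_{i,i+1}$ be obtained from $M_{i,i+1}$ by replacing $p$ with the edge $pu_{i,i+1}$; otherwise let $M'_{i,i+1}=M_{i,i+1}$. A three-vertex set $T$ is *contained* in $M'_{i,i+1}$ if it contains every vertex of $M'_{i,i+1}$ and at least one end of every edge of $M'_{i,i+1}$. Let $G'_{i,i+1}=G_{i,i+1}\setminus\{p\}$ if either $u_{i,i+1}\ne p$, or $G_{i,i+1}$ is empty and at least one of $u_{i-1,i}$, $u_{i+1,i+2}$ differs from $p$; otherwise let $G'_{i,i+1}=G_{i,i+1}$. Let $\mathrm{Int}(G'_{i,i+1})$ be the set of vertices of $G'_{i,i+1}$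 that are neither vertices of $M'_{i,i+1}$ nor ends of edges of $M'_{i,i+1}$. **Lemma.** Let $F=(p;q_1,\dots,q_m)$ be a maximal nondegenerate flower in $G$. Then the following statements hold. 1. If $T\in\mathfrak R_3(G)$ and $T\subset \mathrm{Nb}(F)$, then either $T\in\mathfrak R(F)$, or $T$ is contained in $M'_{i,i+1}$ for some $i$, or $F$ is singular and $T=T(p)$. Conversely, every set of $\mathfrak R(F)$, every three-vertex set contained in some $M'_{i,i+1}$ and, if $F$ is singular, the set $T(p)$ is, unless it equals some $Q'_{j,j+1}$, a 3-cutset that splits $G$ into exactly two parts and splits $\mathrm{Nb}(F)$. No set $Q'_{i,i+1}$ splits $\mathrm{Nb}(F)$, and $Q'_{i,i+1}$ is a cutset if and only if $\mathrm{Int}(G'_{i,i+1})\neq\varnothing$. 2. If $S\in\mathfrak R_3(G)$ splits $\mathrm{Nb}(F)$ and $S\not\subset \mathrm{Nb}(F)$, then $S$ splits $G$ into exactly two parts, there is exactly one vertex of $\mathrm{Nb}(F)$ that $S$ separates from the other vertices of $\mathrm{Nb}(F)$, and this vertex is not the center $p$. -/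

import Mathlib

namespace ThreeCut

variable {V : Type*}

/-- `x` and `y` are vertices of `G - R` lying in the same connected component of `G - R`. -/
def SameComponent (G : SimpleGraph V) (R : Set V) (x y : V) : Prop :=
  ∃ (hx : x ∈ Rᶜ) (hy : y ∈ Rᶜ), (G.induce Rᶜ).Reachable ⟨x, hx⟩ ⟨y, hy⟩

/-- `S` is a cutset: the graph `G - S` is disconnected. -/
def IsCutset (G : SimpleGraph V) (S : Set V) : Prop :=
  ¬ (G.induce Sᶜ).Preconnected

/-- The set of all cutsets with exactly three vertices. -/
def threeCutsets (G : SimpleGraph V) : Set (Set V) :=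
  {S | S.ncard = 3 ∧ IsCutset G S}

/-- `G` has at least four vertices and stays connected after deleting any two of them. -/
def IsTriconnected (G : SimpleGraph V) : Prop :=
  4 ≤ Nat.card V ∧ ∀ S : Set V, S.ncard = 2 → (G.induce Sᶜ).Connected

/-- `R` splits `X`: not all vertices of `X \ R` are in the same component of `G - R`. -/
def Splits (G : SimpleGraph V) (R X : Set V) : Prop :=
  ∃ x ∈ X \ R, ∃ y ∈ X \ R, ¬ SameComponent G R x y

/-- `R` separates the set `U` from the set `W`. -/
def Separates (G : SimpleGraph V) (R U W : Set V) : Prop :=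
  ¬ U ⊆ R ∧ ¬ W ⊆ R ∧ ∀ u ∈ U \ R, ∀ w ∈ W \ R, ¬ SameComponent G R u w

/-- The parts of the decomposition of `G` by a family `𝔖`: the inclusion-maximal vertex sets
that are split by no member of `𝔖`. -/
def parts (G : SimpleGraph V) (𝔖 : Set (Set V)) : Set (Set V) :=
  {A | Maximal (fun B : Set V => ∀ S ∈ 𝔖, ¬ Splits G S B) A}

/-- The interior of a part: its vertices that belong to no member of `𝔖`. -/
def partInterior (𝔖 : Set (Set V)) (A : Set V) : Set V := A \ ⋃₀ 𝔖

/-- The boundary of a part: its vertices that belong to some member of `𝔖`. -/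
def partBoundary (𝔖 : Set (Set V)) (A : Set V) : Set V := A ∩ ⋃₀ 𝔖

/-- A set consisting of vertices and (potential) edges. -/
structure VertexEdgeSet (V : Type*) where
  verts : Set V
  edges : Set (Sym2 V)

/-- A plain vertex set, seen as a vertex-edge set without edges. -/
def VertexEdgeSet.ofVerts (S : Set V) : VertexEdgeSet V := ⟨S, ∅⟩

/-- The vertices of `M` together with all ends of the edges of `M`. -/
def VertexEdgeSet.vertexSet (M : VertexEdgeSet V) : Set V :=
  M.verts ∪ {v | ∃ e ∈ M.edges, v ∈ e}

/-- `M` contains `N`: `N` has all vertices of `M` and, for each edge of `M`, that edge or one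
of its ends. -/
def VertexEdgeSet.Contains (M N : VertexEdgeSet V) : Prop :=
  M.verts ⊆ N.verts ∧ ∀ e ∈ M.edges, e ∈ N.edges ∨ ∃ v ∈ N.verts, v ∈ e

/-- `M` is a cutting set of `G`: deleting its vertices and edges disconnects `G`. -/
def IsCuttingSet (G : SimpleGraph V) (M : VertexEdgeSet V) : Prop :=
  M.edges ⊆ G.edgeSet ∧ ¬ ((G.deleteEdges M.edges).induce M.vertsᶜ).Preconnected

/-- The cutting sets of `G` with three elements, `k` of which are edges. -/
def mixedCuts (G : SimpleGraph V) (k : ℕ) : Set (VertexEdgeSet V) :=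
  {M | IsCuttingSet G M ∧ M.edges.ncard = k ∧ M.verts.ncard + k = 3}

/-- The set `{p, q i, q j}`. -/
def petalTriple {m : ℕ} (p : V) (q : ZMod m → V) (i j : ZMod m) : Set V := {p, q i, q j}

/-- The triples `{p, q i, q j}` with `i`, `j` different and not neighbouring in cyclic order. -/
def innerTriples {m : ℕ} (p : V) (q : ZMod m → V) : Set (Set V) :=
  {T | ∃ i j : ZMod m, i ≠ j ∧ j ≠ i + 1 ∧ i ≠ j + 1 ∧ T = petalTriple p q i j}

/-- A flower `(p; q 1, …, q m)`, `m ≥ 4`, with petals indexed by residues modulo `m`.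
The flower is the tuple `(center; petal)`; it comes with a set `gen` of `3`-cutsets generating
it and with the enumeration `part i = G_{i,i+1}` of the parts of the decomposition by `gen`. -/
structure Flower (G : SimpleGraph V) where
  m : ℕ
  four_le : 4 ≤ m
  center : V
  petal : ZMod m → V
  petal_injective : Function.Injective petal
  petal_ne_center : ∀ i, petal i ≠ center
  gen : Set (Set V)
  gen_inner : gen ⊆ innerTriples center petal
  gen_cutsets : gen ⊆ threeCutsets G
  part : ZMod m → Set V
  part_injective : Function.Injective part
  range_part : Set.range part = parts G gen
  boundary_part : ∀ i, partBoundary gen (part i) = petalTriple center petal i (i + 1)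

namespace Flower

variable {G : SimpleGraph V} (F : Flower G)

/-- `V(F)`, the center and the petals. -/
def vertexSet : Set V := insert F.center (Set.range F.petal)

/-- `Q_{i,j}`. -/
def Q (i j : ZMod F.m) : Set V := petalTriple F.center F.petal i j

/-- The set of all inner sets of the flower. -/
def innerSets : Set (Set V) := innerTriples F.center F.petal

/-- The interior of the part `G_{i,i+1}`. -/
def inter (i : ZMod F.m) : Set V := partInterior F.gen (F.part i)

/-- No flower with the same center has a strictly larger vertex set. -/
def IsMaximal : Prop :=
  ∀ F' : Flower G, F'.center = F.center → F.vertexSet ⊆ F'.vertexSet →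
    F'.vertexSet = F.vertexSet

/-- The flower is not contained in a cut consisting of three edges. -/
def IsNondegenerate : Prop :=
  ¬ ∃ M ∈ mixedCuts G 3, F.vertexSet ⊆ M.vertexSet

/-- The set of neighbours of the center. -/
def centerNbhd : Set V := G.neighborSet F.center

/-- The center has degree three. -/
def IsSingular : Prop := F.centerNbhd.ncard = 3

open Classical in
/-- The vertex `u_{i,i+1}`: the only neighbour of the center in `G_{i,i+1}`, if either the flower
is singular and `G_{i,i+1}` is nonempty, or the flower is nonsingular, there is exactly one such
neighbour, and both parts next to `G_{i,i+1}` are empty; the center in all other cases. -/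
noncomputable def u (i : ZMod F.m) : V :=
  if h : (∃! x, x ∈ F.part i ∧ G.Adj F.center x) ∧
      ((F.IsSingular ∧ (F.inter i).Nonempty) ∨
        (¬ F.IsSingular ∧ F.inter (i - 1) = ∅ ∧ F.inter (i + 1) = ∅))
  then h.1.choose else F.center

/-- The neighbourhood `Nb(F)`. -/
def nbhd : Set V := F.vertexSet ∪ Set.range F.u

/-- The set `M_{i,i+1}`: the center; the edge `q_{i-1} q_i` if `G_{i-1,i}` is empty and the vertex
`q_i` otherwise; the edge `q_{i+1} q_{i+2}` if `G_{i+1,i+2}` is empty and the vertex `q_{i+1}`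
otherwise. -/
def M (i : ZMod F.m) : VertexEdgeSet V where
  verts := {v | v = F.center ∨ (v = F.petal i ∧ F.inter (i - 1) ≠ ∅) ∨
    (v = F.petal (i + 1) ∧ F.inter (i + 1) ≠ ∅)}
  edges := {e | (e = s(F.petal (i - 1), F.petal i) ∧ F.inter (i - 1) = ∅) ∨
    (e = s(F.petal (i + 1), F.petal (i + 2)) ∧ F.inter (i + 1) = ∅)}

open Classical in
/-- The set `M'_{i,i+1}`: if `u_{i,i+1}` differs from the center `p`, it is `M_{i,i+1}` with `p`
replaced by the edge `p u_{i,i+1}`; otherwise it is `M_{i,i+1}`. -/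
noncomputable def M' (i : ZMod F.m) : VertexEdgeSet V :=
  if F.u i = F.center then F.M i
  else ⟨(F.M i).verts \ {F.center}, insert s(F.center, F.u i) (F.M i).edges⟩

/-- `Q'_{i,i+1}`; it equals `Q_{i,i+1}` when `u_{i,i+1}` is the center. -/
def Q' (i : ZMod F.m) : Set V := {F.petal i, F.u i, F.petal (i + 1)}

open Classical in
/-- `G'_{i,i+1}`. -/
noncomputable def part' (i : ZMod F.m) : Set V :=
  if F.u i ≠ F.center ∨
      (F.inter i = ∅ ∧ (F.u (i - 1) ≠ F.center ∨ F.u (i + 1) ≠ F.center))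
  then F.part i \ {F.center} else F.part i

/-- The interior of `G'_{i,i+1}` as a part of the decomposition by `M'_{i,i+1}`: the vertices of
`G'_{i,i+1}` outside the vertex set of `M'_{i,i+1}`. -/
def inter' (i : ZMod F.m) : Set V := F.part' i \ (F.M' i).vertexSet

/-- The sets listed in the description of the `3`-cutsets inside `Nb(F)`: the inner sets of the
flower, the three-vertex sets contained in some `M'_{i,i+1}`, and, if the flower is singular,
the neighbourhood of the center. -/
def IsListed (T : Set V) : Prop :=
  T ∈ F.innerSets ∨
  (∃ i, T.ncard = 3 ∧ (F.M' i).Contains (VertexEdgeSet.ofVerts T)) ∨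
  (F.IsSingular ∧ T = F.centerNbhd)

end Flower

end ThreeCut

open ThreeCut

/-! Only the wheel shape of a flower matters: a center $p$, petals $q_i$ and interiors $J_i$, every
edge lying inside one sector $J_i\cup\{p,q_i,q_{i+1}\}$ (`Flower.isWheel`). Conversely, every wheel
is a flower generated by the sets $Q_{i,i+2}$ (`IsWheel.toFlower`), so maximality can be tested on
wheels: an interior vertex that together with $p$ separates $q_i$ from $q_{i+1}$ inside their sector
could be inserted as a petal (`IsWheel.exists_insert`). Hence consecutive petals outside a set $S$
stay together in $G-S$ unless $S$ has at least two vertices in the interior between them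
(`IsTightWheel.sameComponent_petal_succ`).

Let $|S|=3$ and $p\notin S$, and let $C$ be a union of components of $G-S$ missing $p$. By
triconnectivity every petal in $C$ requires a vertex of $S$ in an adjacent interior
(`interior_meets`). Distributing three vertices over the cycle leaves three outcomes (`cuts`): $C$
contains one petal; or two consecutive petals; or all petals outside $S$, and then $S$ is the
neighbourhood of $p$. The remaining configuration has $m=4$ and yields three edges whose deletion
disconnects $G$ and whose ends cover $V(F)$, against nondegeneracy (`false_of_unique_neighbor`).
Applying `cuts` to the union of two such sets shows that those containing petals share one
(`exists_petal_mem_both`), whence exactly two parts. A component with neither petals nor $p$ lies in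
one interior, and $S$ lies in that sector.

If $p\in S$ and $S$ is not inner, all petals outside $S$ stay together (`sameComponent_petals`), so
every other component lies in one interior.

For the lemma itself, a vertex $u_{i,i+1}\ne p$ lies in $J_i$ and is the only neighbour of $p$ in
its sector (`u_eq_center_or`), so $\mathrm{Nb}(F)$ has at most one vertex in each interior. Inside
$\mathrm{Nb}(F)$ the outcomes above are the listed sets. Outside it, only two kinds of splitting cut
remain: those cutting off a single petal, and those through $p$ cutting off a single $u_{i,i+1}$. -/

namespace ThreeCut

/-! ### Components, unions of components, and triconnectivity -/

section Basic

variable {V : Type*} {G : SimpleGraph V} {R S C : Set V} {x y z : V}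

theorem SameComponent.notMem_right (h : SameComponent G R x y) : y ∉ R := h.2.1

theorem SameComponent.refl (hx : x ∉ R) : SameComponent G R x x := ⟨hx, hx, .refl _⟩

theorem SameComponent.symm (h : SameComponent G R x y) : SameComponent G R y x :=
  ⟨h.2.1, h.1, h.2.2.symm⟩

theorem SameComponent.trans (h : SameComponent G R x y) (h' : SameComponent G R y z) :
    SameComponent G R x z :=
  ⟨h.1, h'.2.1, h.2.2.trans h'.2.2⟩

theorem SameComponent.of_adj (hx : x ∉ R) (hy : y ∉ R) (h : G.Adj x y) :
    SameComponent G R x y := by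
  refine ⟨hx, hy, SimpleGraph.Adj.reachable ?_⟩
  simpa using h

theorem SameComponent.mem_of_closed {U : Set V} (h : SameComponent G R x y) (hx : x ∈ U)
    (hU : ∀ a ∈ U, ∀ b, b ∉ R → G.Adj a b → b ∈ U) : y ∈ U := by
  obtain ⟨hx', hy', ⟨w⟩⟩ := h
  have aux : ∀ a b : (Rᶜ : Set V), (G.induce Rᶜ).Walk a b → a.1 ∈ U → b.1 ∈ U := by
    intro a b w
    induction w with
    | nil => exact id
    | @cons a b c hab _ ih =>
      intro ha
      exact ih (hU a.1 ha b.1 b.2 (by simpa using hab))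
  exact aux _ _ w hx

theorem SameComponent.mono (hRS : R ⊆ S) (h : SameComponent G S x y) : SameComponent G R x y :=
  h.mem_of_closed (U := {z | SameComponent G R x z}) (SameComponent.refl fun hx => h.1 (hRS hx))
    fun _ ha _ hb hab => ha.trans (.of_adj ha.notMem_right (fun h => hb (hRS h)) hab)

theorem isCutset_iff : IsCutset G S ↔ ∃ x, x ∉ S ∧ ∃ y, y ∉ S ∧ ¬ SameComponent G S x y := by
  constructor
  · intro h
    simp only [IsCutset, SimpleGraph.Preconnected, not_forall] at h
    obtain ⟨a, b, h⟩ := h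
    exact ⟨a.1, a.2, b.1, b.2, fun h' => h h'.2.2⟩
  · rintro ⟨x, hx, y, hy, h⟩ h'
    exact h ⟨hx, hy, h' _ _⟩

/-- A union of components of `G - S`. -/
structure IsClosedOff (G : SimpleGraph V) (S C : Set V) : Prop where
  notMem : ∀ x ∈ C, x ∉ S
  mem_of_adj : ∀ x ∈ C, ∀ y, y ∉ S → G.Adj x y → y ∈ C

theorem isClosedOff_component : IsClosedOff G S {y | SameComponent G S x y} :=
  ⟨fun _ h => h.notMem_right, fun _ h _ hy hadj => h.trans (.of_adj h.notMem_right hy hadj)⟩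

theorem IsClosedOff.mem_of_sameComponent (hC : IsClosedOff G S C) (hx : x ∈ C)
    (h : SameComponent G S x y) : y ∈ C :=
  h.mem_of_closed hx hC.mem_of_adj

theorem IsClosedOff.union {D : Set V} (hC : IsClosedOff G S C) (hD : IsClosedOff G S D) :
    IsClosedOff G S (C ∪ D) where
  notMem x hx := hx.elim (hC.notMem x) (hD.notMem x)
  mem_of_adj x hx y hy h :=
    hx.imp (fun hx => hC.mem_of_adj x hx y hy h) (fun hx => hD.mem_of_adj x hx y hy h)

/-- Since there are at least four vertices, $N$ can be enlarged to exactly two vertices avoiding $z$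
and a chosen vertex of $C$, and triconnectivity then joins the two. Most later uses of
triconnectivity exhibit a set whose boundary has at most two vertices and contradict this. -/
theorem IsTriconnected.mem_or_mem [Finite V] (hG : IsTriconnected G) {N : Set V}
    (hN : N.ncard ≤ 2) (hC : IsClosedOff G N C) (hne : C.Nonempty) (z : V) : z ∈ C ∨ z ∈ N := by
  by_contra! hz
  obtain ⟨x, hx⟩ := hne
  have hxz : x ≠ z := fun h => hz.1 (h ▸ hx)
  have hcard : 2 ≤ ({x, z}ᶜ : Set V).ncard := by
    have := Set.ncard_add_ncard_compl ({x, z} : Set V)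
    rw [Set.ncard_pair hxz] at this
    have := hG.1
    omega
  have hsub : N ⊆ {x, z}ᶜ := by
    rintro a ha (rfl | rfl)
    · exact hC.notMem a hx ha
    · exact hz.2 ha
  obtain ⟨N', h1, h2, h3⟩ := Set.exists_subsuperset_card_eq hsub hN hcard
  have hxN : x ∉ N' := fun h => h2 h (Or.inl rfl)
  have hzN : z ∉ N' := fun h => h2 h (Or.inr rfl)
  have hsc : SameComponent G N' x z := ⟨hxN, hzN, (hG.2 N' h3).preconnected _ _⟩
  exact hz.1 (hC.mem_of_sameComponent hx (hsc.mono h1))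

/-- If $s$ had no neighbour in $C$, the at most two vertices of $S\setminus\{s\}$ would already
separate $C$ from $z$. -/
theorem IsTriconnected.exists_adj [Finite V] (hG : IsTriconnected G) (hS : S.ncard ≤ 3)
    (hC : IsClosedOff G S C) (hne : C.Nonempty) (hz : z ∉ C) (hzS : z ∉ S) {s : V} (hs : s ∈ S) :
    ∃ x ∈ C, G.Adj x s := by
  by_contra! h
  have hcard : (S \ {s}).ncard ≤ 2 := by
    rw [Set.ncard_sdiff_singleton_of_mem hs]; omega
  have hcl : IsClosedOff G (S \ {s}) C := by
    refine ⟨fun x hx h => hC.notMem x hx h.1, fun x hx y hy hadj => ?_⟩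
    by_cases hys : y = s
    · exact absurd (hys ▸ hadj) (h x hx)
    · exact hC.mem_of_adj x hx y (fun h => hy ⟨h, hys⟩) hadj
  rcases hG.mem_or_mem hcard hcl hne z with h | h
  · exact hz h
  · exact hzS h.1

theorem ncard_pair_le (a b : V) : ({a, b} : Set V).ncard ≤ 2 := by
  refine (Set.ncard_insert_le _ _).trans ?_
  rw [Set.ncard_singleton]

theorem ncard_triple_le (a b c : V) : ({a, b, c} : Set V).ncard ≤ 3 :=
  (Set.ncard_insert_le _ _).trans (Nat.succ_le_succ (ncard_pair_le _ _))

theorem eq_of_subset_triple [Finite V] {a b c : V} (hS : S.ncard = 3) (h : S ⊆ {a, b, c}) :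
    S = {a, b, c} :=
  Set.eq_of_subset_of_ncard_le h (hS ▸ ncard_triple_le a b c)

theorem not_splits_iff {X : Set V} :
    ¬ Splits G S X ↔ ∀ x ∈ X, x ∉ S → ∀ y ∈ X, y ∉ S → SameComponent G S x y := by
  simp only [Splits, not_exists, not_and, not_not, Set.mem_sdiff, and_imp]

theorem eq_of_mem_parts {𝔖 : Set (Set V)} {A B : Set V} (hA : A ∈ parts G 𝔖)
    (hB : B ∈ parts G 𝔖) (h : A ⊆ B) : A = B :=
  h.antisymm (Maximal.le_of_ge (P := fun B : Set V => ∀ S ∈ 𝔖, ¬ Splits G S B) hA hB.1 h)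

/-- The parts for a single cutset are $S$ joined with one component of $G-S$, so counting parts
amounts to counting components. -/
theorem ncard_parts_singleton (hx : x ∉ S) (hy : y ∉ S) (hxy : ¬ SameComponent G S x y)
    (h : ∀ z, z ∉ S → SameComponent G S x z ∨ SameComponent G S y z) :
    (parts G {S}).ncard = 2 := by
  have key : ∀ w, w ∉ S → S ∪ {z | SameComponent G S w z} ∈ parts G {S} := by
    intro w hw
    refine ⟨?_, ?_⟩
    · rintro _ rfl
      rw [not_splits_iff]
      rintro a (ha | ha) has b (hb | hb) hbs
      exacts [absurd ha has, absurd ha has, absurd hb hbs, ha.symm.trans hb]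
    · intro B hB hle b hb
      by_cases hbS : b ∈ S
      · exact Or.inl hbS
      · exact Or.inr (not_splits_iff.1 (hB S rfl) w (hle (Or.inr (.refl hw))) hw b hb hbS)
  have hsub : ∀ A ∈ parts G {S}, ∀ w, w ∉ S → w ∈ A → A = S ∪ {z | SameComponent G S w z} := by
    intro A hA w hw hwA
    refine eq_of_mem_parts hA (key w hw) ?_
    intro a ha
    by_cases haS : a ∈ S
    · exact Or.inl haS
    · exact Or.inr (not_splits_iff.1 (hA.1 S rfl) w hwA hw a ha haS)
  have : parts G {S} = {S ∪ {z | SameComponent G S x z}, S ∪ {z | SameComponent G S y z}} := by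
    refine Set.Subset.antisymm ?_ ?_
    · intro A hA
      by_cases hAS : A ⊆ S
      · have := eq_of_mem_parts hA (key x hx) (hAS.trans Set.subset_union_left)
        exact Or.inl this
      · obtain ⟨w, hwA, hwS⟩ := Set.not_subset.1 hAS
        have hcl := hsub A hA w hwS hwA
        rcases h w hwS with h' | h'
        · left
          exact hsub A hA x hx (hcl ▸ Or.inr h'.symm)
        · right
          exact hsub A hA y hy (hcl ▸ Or.inr h'.symm)
    · rintro _ (rfl | rfl)
      exacts [key x hx, key y hy]
  rw [this, Set.ncard_pair]
  intro h
  have : y ∈ S ∪ {z | SameComponent G S x z} := h ▸ Or.inr (.refl hy)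
  exact this.elim hy hxy

end Basic

/-! ### Wheels: cyclic decompositions around a center -/

section Wheel

variable {V : Type*} {G : SimpleGraph V} {m : ℕ} {p : V} {q : ZMod m → V} {J : ZMod m → Set V}
  {S C : Set V}

/-- The `i`-th part of a cyclic decomposition with center `p`, petals `q` and interiors `J`. -/
def sector (p : V) (q : ZMod m → V) (J : ZMod m → Set V) (i : ZMod m) : Set V :=
  J i ∪ petalTriple p q i (i + 1)

/-- The vertices of `G` are a center `p`, petals `q i` and interiors `J i`, arranged cyclically so
that every edge lies in some sector. -/
structure IsWheel (G : SimpleGraph V) (m : ℕ) (p : V) (q : ZMod m → V) (J : ZMod m → Set V) :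
    Prop where
  four_le : 4 ≤ m
  inj : Function.Injective q
  ne_center : ∀ i, q i ≠ p
  center_notMem : ∀ i, p ∉ J i
  petal_notMem : ∀ i j, q j ∉ J i
  eq_of_mem : ∀ {i j x}, x ∈ J i → x ∈ J j → i = j
  cover : ∀ x, x = p ∨ (∃ i, x = q i) ∨ ∃ i, x ∈ J i
  adj : ∀ x y, G.Adj x y → ∃ i, x ∈ sector p q J i ∧ y ∈ sector p q J i

theorem natCast_ne_zero_of_lt {k : ℕ} (h0 : 0 < k) (hk : k < m) : (k : ZMod m) ≠ 0 := by
  rw [Ne, ZMod.natCast_eq_zero_iff]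
  exact fun h => by have := Nat.le_of_dvd h0 h; omega

/-- Makes $i-1,i,i+1,i+2$ pairwise distinct. The residue 4 may vanish, and the case $m=4$ is treated
separately where it matters. -/
theorem small_ne_zero (hm : 4 ≤ m) :
    (1 : ZMod m) ≠ 0 ∧ (2 : ZMod m) ≠ 0 ∧ (3 : ZMod m) ≠ 0 :=
  ⟨by simpa using natCast_ne_zero_of_lt (m := m) (k := 1) (by omega) (by omega),
    by simpa using natCast_ne_zero_of_lt (m := m) (k := 2) (by omega) (by omega),
    by simpa using natCast_ne_zero_of_lt (m := m) (k := 3) (by omega) (by omega)⟩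

theorem mem_sector {i : ZMod m} {x : V} :
    x ∈ sector p q J i ↔ x ∈ J i ∨ x = p ∨ x = q i ∨ x = q (i + 1) := by
  simp only [sector, petalTriple, Set.mem_union, Set.mem_insert_iff, Set.mem_singleton_iff]

namespace IsWheel

variable (hW : IsWheel G m p q J)

include hW

theorem petal_mem_sector {j k : ZMod m} : q j ∈ sector p q J k ↔ j = k ∨ j = k + 1 := by
  simp [mem_sector, hW.petal_notMem, hW.ne_center, hW.inj.eq_iff]

theorem eq_of_mem_sector {j k : ZMod m} {x : V} (h : x ∈ J k) (h' : x ∈ sector p q J j) :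
    k = j := by
  rcases mem_sector.1 h' with h' | rfl | rfl | rfl
  exacts [hW.eq_of_mem h h', absurd h (hW.center_notMem _), absurd h (hW.petal_notMem _ _),
    absurd h (hW.petal_notMem _ _)]

theorem adj_interior {k : ZMod m} {x y : V} (h : x ∈ J k) (hxy : G.Adj x y) :
    y ∈ J k ∨ y = p ∨ y = q k ∨ y = q (k + 1) := by
  obtain ⟨i, hx, hy⟩ := hW.adj x y hxy
  obtain rfl := hW.eq_of_mem_sector h hx
  exact mem_sector.1 hy

theorem adj_petal {k : ZMod m} {y : V} (h : G.Adj (q k) y) :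
    (y ∈ J k ∨ y = p ∨ y = q (k + 1)) ∨ (y ∈ J (k - 1) ∨ y = p ∨ y = q (k - 1)) := by
  obtain ⟨i, hx, hy⟩ := hW.adj _ y h
  rw [mem_sector] at hy
  have := G.ne_of_adj h
  rcases hW.petal_mem_sector.1 hx with rfl | rfl
  · tauto
  · rw [add_sub_cancel_right]
    tauto

theorem ncard_petals : (Set.range q).ncard = m := by
  rw [Set.ncard_range_of_injective hW.inj, Nat.card_zmod]

theorem exists_petal_notMem [Finite V] (hS : S.ncard ≤ 3) : ∃ j, q j ∉ S := by
  by_contra! h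
  have := Set.ncard_le_ncard (s := Set.range q) (t := S) (by rintro _ ⟨j, rfl⟩; exact h j)
  rw [hW.ncard_petals] at this
  have := hW.four_le
  omega

variable [Finite V] (hG : IsTriconnected G)

include hG

/-- Otherwise the vertices of $J_k$ reachable from $x$ would have their boundary among the other two
vertices of the triple, which triconnectivity forbids. -/
theorem sameComponent_of_mem_interior {k : ZMod m} {x t : V} (hx : x ∈ J k)
    (hS : ∀ y ∈ J k, y ∉ S) (ht : t ∈ petalTriple p q k (k + 1)) (htS : t ∉ S) :
    SameComponent G S x t := by
  by_contra hcon
  have hN : (petalTriple p q k (k + 1) \ {t}).ncard ≤ 2 := by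
    rw [Set.ncard_sdiff_singleton_of_mem ht]
    have := ncard_triple_le p (q k) (q (k + 1))
    unfold petalTriple
    omega
  have htJ : t ∉ J k := by
    rcases ht with rfl | rfl | rfl
    exacts [hW.center_notMem _, hW.petal_notMem _ _, hW.petal_notMem _ _]
  have hcl : IsClosedOff G (petalTriple p q k (k + 1) \ {t})
      {y | y ∈ J k ∧ SameComponent G S x y} := by
    refine ⟨?_, ?_⟩
    · rintro y ⟨hy, -⟩ ⟨rfl | rfl | rfl, -⟩
      exacts [hW.center_notMem _ hy, hW.petal_notMem _ _ hy, hW.petal_notMem _ _ hy]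
    · rintro y ⟨hy, hxy⟩ z hz hyz
      have hzt : z ≠ t := by
        rintro rfl
        exact hcon (hxy.trans (.of_adj hxy.notMem_right htS hyz))
      have hzJ : z ∈ J k := (hW.adj_interior hy hyz).resolve_right fun h => hz ⟨h, hzt⟩
      exact ⟨hzJ, hxy.trans (.of_adj hxy.notMem_right (hS z hzJ) hyz)⟩
  rcases hG.mem_or_mem hN hcl ⟨x, hx, .refl (hS x hx)⟩ t with h | h
  · exact htJ h.1
  · exact h.2 rfl

/-- Without this edge, $\{p,q_{k-1}\}$ would cut $J_{k-1}\cup\{q_k\}$ off from $q_{k+1}$. -/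
theorem adj_petal_succ {k : ZMod m} (hk : J k = ∅) : G.Adj (q k) (q (k + 1)) := by
  by_contra hcon
  obtain ⟨h1, h2, h3⟩ := small_ne_zero hW.four_le
  have hcl : IsClosedOff G {p, q (k - 1)} (insert (q k) (J (k - 1))) := by
    refine ⟨?_, ?_⟩
    · rintro y (rfl | hy) (h | h)
      · exact hW.ne_center _ h
      · exact h1 (by linear_combination hW.inj h)
      · exact hW.center_notMem _ (h ▸ hy)
      · exact hW.petal_notMem _ _ (h ▸ hy)
    · rintro y (rfl | hy) z hz hyz
      · rcases hW.adj_petal hyz with (h | h | h) | h | h | h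
        · simp [hk] at h
        · exact absurd (Or.inl h) hz
        · exact absurd (h ▸ hyz) hcon
        · exact Or.inr h
        · exact absurd (Or.inl h) hz
        · exact absurd (Or.inr h) hz
      · rcases hW.adj_interior hy hyz with h | h | h | h
        · exact Or.inr h
        · exact absurd (Or.inl h) hz
        · exact absurd (Or.inr h) hz
        · rw [sub_add_cancel] at h
          exact Or.inl h
  rcases hG.mem_or_mem (ncard_pair_le _ _) hcl ⟨_, Or.inl rfl⟩ (q (k + 1)) with (h | h) | (h | h)
  · exact h1 (by linear_combination hW.inj h)
  · exact hW.petal_notMem _ _ h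
  · exact hW.ne_center _ h
  · exact h2 (by linear_combination hW.inj h)

/-- Without this edge, $q_{k-1}$ and $q_{k+1}$ would isolate $q_k$. -/
theorem adj_center_petal {k : ZMod m} (hk : J k = ∅) (hk' : J (k - 1) = ∅) : G.Adj (q k) p := by
  by_contra hcon
  obtain ⟨h1, h2, h3⟩ := small_ne_zero hW.four_le
  have hcl : IsClosedOff G {q (k - 1), q (k + 1)} {q k} := by
    refine ⟨?_, ?_⟩
    · rintro y rfl (h | h)
      · exact h1 (by linear_combination hW.inj h)
      · exact h1 (by linear_combination -hW.inj h)
    · rintro y rfl z hz hyz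
      rcases hW.adj_petal hyz with (h | h | h) | h | h | h
      · simp [hk] at h
      · exact absurd (h ▸ hyz) hcon
      · exact absurd (Or.inr h) hz
      · simp [hk'] at h
      · exact absurd (h ▸ hyz) hcon
      · exact absurd (Or.inl h) hz
  rcases hG.mem_or_mem (ncard_pair_le _ _) hcl ⟨_, rfl⟩ p with h | (h | h)
  · exact hW.ne_center _ h.symm
  · exact hW.ne_center _ h.symm
  · exact hW.ne_center _ h.symm

theorem exists_adj_center {k : ZMod m} (hk : (J k).Nonempty) : ∃ x ∈ J k, G.Adj p x := by
  by_contra! hcon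
  have hcl : IsClosedOff G {q k, q (k + 1)} (J k) := by
    refine ⟨?_, ?_⟩
    · rintro y hy (rfl | rfl) <;> exact hW.petal_notMem _ _ hy
    · intro y hy z hz hyz
      rcases hW.adj_interior hy hyz with h | h | h | h
      · exact h
      · exact absurd (h ▸ hyz).symm (hcon y hy)
      · exact absurd (Or.inl h) hz
      · exact absurd (Or.inr h) hz
  rcases hG.mem_or_mem (ncard_pair_le _ _) hcl hk p with h | (h | h)
  · exact hW.center_notMem _ h
  · exact hW.ne_center _ h.symm
  · exact hW.ne_center _ h.symm

theorem sameComponent_petal_succ_of_forall_notMem {k : ZMod m} (hS : ∀ y ∈ J k, y ∉ S)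
    (h : q k ∉ S) (h' : q (k + 1) ∉ S) : SameComponent G S (q k) (q (k + 1)) := by
  rcases (J k).eq_empty_or_nonempty with hk | ⟨x, hx⟩
  · exact .of_adj h h' (hW.adj_petal_succ hG hk)
  · exact (hW.sameComponent_of_mem_interior hG hx hS (by simp [petalTriple]) h).symm.trans
      (hW.sameComponent_of_mem_interior hG hx hS (by simp [petalTriple]) h')

theorem sameComponent_center_of_forall_notMem {k : ZMod m} (hS : ∀ y ∈ J k, y ∉ S)
    (hk : (J k).Nonempty) (hp : p ∉ S) {y : V} (hy : y ∈ sector p q J k) (hyS : y ∉ S) :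
    SameComponent G S p y := by
  obtain ⟨x, hx⟩ := hk
  rcases hy with hy | hy
  · exact (hW.sameComponent_of_mem_interior hG hy hS (by simp [petalTriple]) hp).symm
  · exact (hW.sameComponent_of_mem_interior hG hx hS (by simp [petalTriple]) hp).symm.trans
      (hW.sameComponent_of_mem_interior hG hx hS hy hyS)

/-- A union of components without petals meeting an interior lives in that sector. -/
theorem subset_sector_of_forall_petal_notMem {E : Set V} (hS : S.ncard = 3)
    (hE : IsClosedOff G S E) (hq : ∀ j, q j ∉ E) (hp : p ∉ E) {k : ZMod m} {x : V} (hx : x ∈ E)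
    (hxk : x ∈ J k) :
    S ⊆ sector p q J k ∧ ∀ s ∈ S, ∃ y ∈ E ∩ J k, G.Adj y s := by
  -- An edge can leave $J_k$ only to $p$ or a petal, none of which is in $E$. So $E\cap J_k$ is
  -- itself a union of components, and each vertex of $S$ has a neighbour in it.
  have hcl : IsClosedOff G S (E ∩ J k) := by
    refine ⟨fun y hy => hE.notMem y hy.1, fun y hy z hz hyz => ?_⟩
    have hzE := hE.mem_of_adj y hy.1 z hz hyz
    refine ⟨hzE, ?_⟩
    rcases hW.adj_interior hy.2 hyz with h | rfl | rfl | rfl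
    exacts [h, absurd hzE hp, absurd hzE (hq _), absurd hzE (hq _)]
  obtain ⟨j, hj⟩ := hW.exists_petal_notMem hS.le
  have key : ∀ s ∈ S, ∃ y ∈ E ∩ J k, G.Adj y s := fun s hs =>
    hG.exists_adj hS.le hcl ⟨x, hx, hxk⟩ (fun h => hq j h.1) hj hs
  refine ⟨fun s hs => ?_, key⟩
  obtain ⟨y, hy, hys⟩ := key s hs
  exact mem_sector.2 (hW.adj_interior hy.2 hys)

theorem three_le_ncard_neighborSet : 3 ≤ (G.neighborSet p).ncard := by
  by_contra! h
  have hcl : IsClosedOff G (G.neighborSet p) {p} := by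
    refine ⟨?_, ?_⟩
    · rintro x rfl h
      exact G.loopless.irrefl _ h
    · rintro x rfl y hy hxy
      exact absurd hxy hy
  have := fun z => hG.mem_or_mem (by omega) hcl ⟨p, rfl⟩ z
  have h2 : Set.range q ⊆ G.neighborSet p := by
    rintro _ ⟨j, rfl⟩
    exact (this (q j)).resolve_left (hW.ne_center j)
  have h3 := Set.ncard_le_ncard h2
  rw [hW.ncard_petals] at h3
  have := hW.four_le
  omega

end IsWheel

end Wheel

/-! ### Translation between flowers and wheels -/

section FlowerWheel

variable {V : Type*} {G : SimpleGraph V}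

theorem exists_mem_parts_superset [Finite V] {𝔖 : Set (Set V)} {X : Set V}
    (hX : ∀ S ∈ 𝔖, ¬ Splits G S X) : ∃ A ∈ parts G 𝔖, X ⊆ A := by
  obtain ⟨A, hXA, hA⟩ :=
    Finite.exists_le_maximal (p := fun B : Set V => ∀ S ∈ 𝔖, ¬ Splits G S B) hX
  exact ⟨A, hA, hXA⟩

theorem not_splits_pair {S : Set V} {x y : V} (h : G.Adj x y) : ¬ Splits G S {x, y} := by
  rw [not_splits_iff]
  rintro a (rfl | rfl) ha b (rfl | rfl) hb
  exacts [.refl ha, .of_adj ha hb h, .of_adj ha hb h.symm, .refl ha]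

theorem not_splits_singleton {S : Set V} {x : V} : ¬ Splits G S {x} := by
  rw [not_splits_iff]
  rintro a rfl ha b rfl hb
  exact .refl ha

/-- The common vertex survives the deletion of every member of the family and links the two parts,
so their union is unsplit and maximality applies. -/
theorem subset_of_mem_parts {𝔖 : Set (Set V)} {A B : Set V} (hA : A ∈ parts G 𝔖)
    (hB : B ∈ parts G 𝔖) {x : V} (hx : x ∉ ⋃₀ 𝔖) (hxA : x ∈ A) (hxB : x ∈ B) : B ⊆ A := by
  have h : ∀ S ∈ 𝔖, ¬ Splits G S (A ∪ B) := by
    intro S hS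
    have hxS : x ∉ S := fun h => hx ⟨S, hS, h⟩
    have key : ∀ a ∈ A ∪ B, a ∉ S → SameComponent G S x a := by
      rintro a (ha | ha) haS
      · exact not_splits_iff.1 (hA.1 S hS) x hxA hxS a ha haS
      · exact not_splits_iff.1 (hB.1 S hS) x hxB hxS a ha haS
    rw [not_splits_iff]
    exact fun a ha haS b hb hbS => (key a ha haS).symm.trans (key b hb hbS)
  exact Set.subset_union_right.trans (hA.2 h Set.subset_union_left)

namespace Flower

variable (F : Flower G)

theorem part_mem (i : ZMod F.m) : F.part i ∈ parts G F.gen := F.range_part ▸ ⟨i, rfl⟩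

theorem part_eq_sector (i : ZMod F.m) : F.part i = sector F.center F.petal F.inter i := by
  rw [sector, ← F.boundary_part i]
  exact (Set.sdiff_union_inter _ _).symm

theorem center_mem : F.center ∈ ⋃₀ F.gen := by
  have : F.center ∈ partBoundary F.gen (F.part 0) := by
    rw [F.boundary_part]; exact Or.inl rfl
  exact this.2

theorem petal_mem (i : ZMod F.m) : F.petal i ∈ ⋃₀ F.gen := by
  have : F.petal i ∈ partBoundary F.gen (F.part i) := by
    rw [F.boundary_part]; exact Or.inr (Or.inl rfl)
  exact this.2

/-- Single vertices and adjacent pairs are split by no set, hence lie in some part: this gives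
covering and the location of edges. -/
theorem isWheel [Finite V] : IsWheel G F.m F.center F.petal F.inter where
  four_le := F.four_le
  inj := F.petal_injective
  ne_center := F.petal_ne_center
  center_notMem i h := h.2 F.center_mem
  petal_notMem i j h := h.2 (F.petal_mem j)
  eq_of_mem {i j x} hi hj := by
    apply F.part_injective
    exact Set.Subset.antisymm
      (subset_of_mem_parts (F.part_mem j) (F.part_mem i) hi.2 hj.1 hi.1)
      (subset_of_mem_parts (F.part_mem i) (F.part_mem j) hi.2 hi.1 hj.1)
  cover x := by
    obtain ⟨A, hA, hx⟩ := exists_mem_parts_superset (𝔖 := F.gen)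
      (fun S _ => not_splits_singleton (G := G) (S := S) (x := x))
    rw [← F.range_part] at hA
    obtain ⟨i, rfl⟩ := hA
    rw [Set.singleton_subset_iff, part_eq_sector, mem_sector] at hx
    rcases hx with h | h | h | h
    exacts [Or.inr (Or.inr ⟨i, h⟩), Or.inl h, Or.inr (Or.inl ⟨_, h⟩), Or.inr (Or.inl ⟨_, h⟩)]
  adj x y h := by
    obtain ⟨A, hA, hx⟩ := exists_mem_parts_superset (𝔖 := F.gen)
      (fun S _ => not_splits_pair (S := S) h)
    rw [← F.range_part] at hA
    obtain ⟨i, rfl⟩ := hA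
    rw [part_eq_sector] at hx
    exact ⟨i, hx (Or.inl rfl), hx (Or.inr rfl)⟩

end Flower

namespace IsWheel

variable {m : ℕ} {p : V} {q : ZMod m → V} {J : ZMod m → Set V} (hW : IsWheel G m p q J)

include hW

theorem petal_mem_petalTriple {i j k : ZMod m} : q k ∈ petalTriple p q i j ↔ k = i ∨ k = j := by
  simp [petalTriple, hW.ne_center, hW.inj.eq_iff]

theorem interior_notMem_petalTriple {i j k : ZMod m} {x : V} (hx : x ∈ J k) :
    x ∉ petalTriple p q i j := by
  rintro (rfl | rfl | rfl)
  exacts [hW.center_notMem _ hx, hW.petal_notMem _ _ hx, hW.petal_notMem _ _ hx]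

theorem ncard_petalTriple {i j : ZMod m} (h : i ≠ j) : (petalTriple p q i j).ncard = 3 := by
  rw [Set.ncard_eq_three]
  exact ⟨p, q i, q j, (hW.ne_center i).symm, (hW.ne_center j).symm, hW.inj.ne h, rfl⟩

theorem isClosedOff_short_arc (i : ZMod m) :
    IsClosedOff G (petalTriple p q i (i + 2)) (insert (q (i + 1)) (J i ∪ J (i + 1))) := by
  obtain ⟨h1, h2, h3⟩ := small_ne_zero hW.four_le
  refine ⟨?_, ?_⟩
  · rintro x (rfl | hx | hx)
    · rw [hW.petal_mem_petalTriple, not_or]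
      exact ⟨fun h => h1 (by linear_combination h), fun h => h1 (by linear_combination -h)⟩
    · exact hW.interior_notMem_petalTriple hx
    · exact hW.interior_notMem_petalTriple hx
  · rintro x (rfl | hx | hx) y hy hxy
    · rcases hW.adj_petal hxy with (h | h | h) | h | h | h
      · exact Or.inr (Or.inr h)
      · exact absurd (Or.inl h) hy
      · rw [add_assoc, one_add_one_eq_two] at h
        exact absurd (Or.inr (Or.inr h)) hy
      · rw [add_sub_cancel_right] at h
        exact Or.inr (Or.inl h)
      · exact absurd (Or.inl h) hy
      · rw [add_sub_cancel_right] at h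
        exact absurd (Or.inr (Or.inl h)) hy
    · rcases hW.adj_interior hx hxy with h | h | h | h
      · exact Or.inr (Or.inl h)
      · exact absurd (Or.inl h) hy
      · exact absurd (Or.inr (Or.inl h)) hy
      · exact Or.inl h
    · rcases hW.adj_interior hx hxy with h | h | h | h
      · exact Or.inr (Or.inr h)
      · exact absurd (Or.inl h) hy
      · exact Or.inl h
      · rw [add_assoc, one_add_one_eq_two] at h
        exact absurd (Or.inr (Or.inr h)) hy

/-- A vertex of $A$ in $J_i$ confines $A$ by both $Q_{i,i+2}$ and $Q_{i-1,i+1}$, whose arcs overlap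
in sector $i$. If $A$ meets no interior, a petal $q_a\in A$ leaves only $p,q_{a-1},q_a,q_{a+1}$, and
$q_{a-1}$, $q_{a+1}$ cannot both occur. -/
theorem subset_sector_of_not_splits {A : Set V}
    (hA : ∀ i, ¬ Splits G (petalTriple p q i (i + 2)) A) : ∃ k, A ⊆ sector p q J k := by
  obtain ⟨h1, h2, h3⟩ := small_ne_zero hW.four_le
  have key : ∀ i, ∀ x ∈ A, x ∈ insert (q (i + 1)) (J i ∪ J (i + 1)) → ∀ y ∈ A,
      y ∈ petalTriple p q i (i + 2) ∨ y ∈ insert (q (i + 1)) (J i ∪ J (i + 1)) := by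
    intro i x hx hxi y hy
    by_contra! hcon
    have hcl := hW.isClosedOff_short_arc i
    exact hcon.2 (hcl.mem_of_sameComponent hxi
      (not_splits_iff.1 (hA i) x hx (hcl.notMem x hxi) y hy hcon.1))
  by_cases hint : ∃ x ∈ A, ∃ i, x ∈ J i
  · obtain ⟨x, hx, i, hxi⟩ := hint
    refine ⟨i, fun y hy => ?_⟩
    have k1 := key i x hx (Or.inr (Or.inl hxi)) y hy
    have k2 := key (i - 1) x hx (Or.inr (Or.inr (by rwa [sub_add_cancel]))) y hy
    rw [show i - 1 + 2 = i + 1 by ring, sub_add_cancel] at k2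
    rw [mem_sector]
    rcases hW.cover y with rfl | ⟨k, rfl⟩ | ⟨k, hk⟩
    · exact Or.inr (Or.inl rfl)
    · simp only [hW.petal_mem_petalTriple, Set.mem_insert_iff, Set.mem_union, hW.petal_notMem,
        hW.inj.eq_iff, or_false] at k1 k2
      right; right
      simp only [hW.inj.eq_iff]
      rcases k1 with (h | rfl) | h
      · exact Or.inl h
      · rcases k2 with (h | h) | h
        · exact absurd (by linear_combination h) h3
        · exact absurd (by linear_combination h) h1
        · exact absurd (by linear_combination h) h2
      · exact Or.inr h
    · left
      have e1 : y ∈ J i ∨ y ∈ J (i + 1) := by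
        rcases k1 with h | rfl | h
        exacts [absurd h (hW.interior_notMem_petalTriple hk), absurd hk (hW.petal_notMem _ _), h]
      have e2 : y ∈ J (i - 1) ∨ y ∈ J i := by
        rcases k2 with h | rfl | h
        exacts [absurd h (hW.interior_notMem_petalTriple hk), absurd hk (hW.petal_notMem _ _), h]
      rcases e1 with h | h
      · exact h
      · rcases e2 with h' | h'
        · exact absurd (by linear_combination hW.eq_of_mem h h') h2
        · exact h'
  · push Not at hint
    have keyq : ∀ i k, q (i + 1) ∈ A → q k ∈ A → k = i ∨ k = i + 1 ∨ k = i + 2 := by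
      intro i k hi hk
      have := key i _ hi (Or.inl rfl) _ hk
      simp only [hW.petal_mem_petalTriple, Set.mem_insert_iff, Set.mem_union, hW.petal_notMem,
        hW.inj.eq_iff, or_false] at this
      tauto
    by_cases hq : ∃ a, q a ∈ A
    · obtain ⟨a, ha⟩ := hq
      have hk : ∀ k, q k ∈ A → k = a - 1 ∨ k = a ∨ k = a + 1 := by
        intro k hk
        have := keyq (a - 1) k (by rwa [sub_add_cancel]) hk
        rwa [sub_add_cancel, show a - 1 + 2 = a + 1 by ring] at this
      by_cases ha1 : q (a + 1) ∈ A
      · refine ⟨a, fun y hy => mem_sector.2 ?_⟩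
        rcases hW.cover y with rfl | ⟨k, rfl⟩ | ⟨k, hyk⟩
        · exact Or.inr (Or.inl rfl)
        · rcases hk k hy with rfl | rfl | rfl
          · rcases keyq a _ ha1 hy with h | h | h
            · exact absurd (by linear_combination -h) h1
            · exact absurd (by linear_combination -h) h2
            · exact absurd (by linear_combination -h) h3
          · simp
          · simp
        · exact absurd hyk (hint y hy k)
      · refine ⟨a - 1, fun y hy => mem_sector.2 ?_⟩
        rcases hW.cover y with rfl | ⟨k, rfl⟩ | ⟨k, hyk⟩
        · exact Or.inr (Or.inl rfl)
        · rcases hk k hy with rfl | rfl | rfl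
          · simp
          · simp
          · exact absurd hy ha1
        · exact absurd hyk (hint y hy k)
    · push Not at hq
      refine ⟨0, fun y hy => mem_sector.2 ?_⟩
      rcases hW.cover y with rfl | ⟨k, rfl⟩ | ⟨k, hyk⟩
      exacts [Or.inr (Or.inl rfl), absurd hy (hq k), absurd hyk (hint y hy k)]

theorem sector_subset_sector {j k : ZMod m} (h : sector p q J k ⊆ sector p q J j) : k = j := by
  obtain ⟨h1, h2, h3⟩ := small_ne_zero hW.four_le
  have e1 := hW.petal_mem_sector.1 (h (hW.petal_mem_sector.2 (Or.inl rfl)))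
  have e2 := hW.petal_mem_sector.1 (h (hW.petal_mem_sector.2 (Or.inr rfl)))
  rcases e1 with e1 | e1
  · exact e1
  · rcases e2 with e2 | e2
    · exact absurd (by linear_combination e2 - e1) h2
    · exact add_right_cancel e2

variable [Finite V] (hG : IsTriconnected G)

include hG

theorem sameComponent_of_mem_sector {S : Set V} {k : ZMod m} {x y : V} (hp : p ∈ S)
    (hS : ∀ y ∈ J k, y ∉ S) (hq : q k ∉ S ∨ q (k + 1) ∉ S) (hx : x ∈ sector p q J k) (hxS : x ∉ S)
    (hy : y ∈ sector p q J k) (hyS : y ∉ S) : SameComponent G S x y := by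
  have ht : ∃ t ∈ petalTriple p q k (k + 1), t ∉ S :=
    hq.elim (fun h => ⟨_, Or.inr (Or.inl rfl), h⟩) (fun h => ⟨_, Or.inr (Or.inr rfl), h⟩)
  obtain ⟨t, ht, htS⟩ := ht
  rcases (J k).eq_empty_or_nonempty with hk | ⟨w, hw⟩
  · have hadj := hW.adj_petal_succ hG hk
    rw [mem_sector] at hx hy
    rcases hx with hx | rfl | rfl | rfl
    · simp [hk] at hx
    · exact absurd hp hxS
    · rcases hy with hy | rfl | rfl | rfl
      · simp [hk] at hy
      · exact absurd hp hyS
      · exact .refl hxS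
      · exact .of_adj hxS hyS hadj
    · rcases hy with hy | rfl | rfl | rfl
      · simp [hk] at hy
      · exact absurd hp hyS
      · exact .of_adj hxS hyS hadj.symm
      · exact .refl hxS
  · have key : ∀ z ∈ sector p q J k, z ∉ S → SameComponent G S t z := by
      rintro z (hz | hz) hzS
      · exact (hW.sameComponent_of_mem_interior hG hz hS ht htS).symm
      · exact (hW.sameComponent_of_mem_interior hG hw hS ht htS).symm.trans
          (hW.sameComponent_of_mem_interior hG hw hS hz hzS)
    exact (key x hx hxS).symm.trans (key y hy hyS)

theorem not_splits_sector (i k : ZMod m) :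
    ¬ Splits G (petalTriple p q i (i + 2)) (sector p q J k) := by
  obtain ⟨h1, h2, h3⟩ := small_ne_zero hW.four_le
  rw [not_splits_iff]
  intro x hx hxS y hy hyS
  refine hW.sameComponent_of_mem_sector hG (Or.inl rfl)
    (fun _ h => hW.interior_notMem_petalTriple h) ?_ hx hxS hy hyS
  simp only [hW.petal_mem_petalTriple, ← not_and_or]
  rintro ⟨rfl | rfl, h | h⟩
  · exact h1 (by linear_combination h)
  · exact h1 (by linear_combination -h)
  · exact h3 (by linear_combination h)
  · exact h1 (by linear_combination h)

/-- The flower given by a cyclic decomposition. -/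
def toFlower : Flower G where
  m := m
  four_le := hW.four_le
  center := p
  petal := q
  petal_injective := hW.inj
  petal_ne_center := hW.ne_center
  -- The shortest inner sets already have the sectors as their parts, so longer ones are not needed.
  gen := Set.range fun i => petalTriple p q i (i + 2)
  gen_inner := by
    obtain ⟨h1, h2, h3⟩ := small_ne_zero hW.four_le
    rintro _ ⟨i, rfl⟩
    exact ⟨i, i + 2, fun h => h2 (by linear_combination -h), fun h => h1 (by linear_combination h),
      fun h => h3 (by linear_combination -h), rfl⟩
  gen_cutsets := by
    obtain ⟨h1, h2, h3⟩ := small_ne_zero hW.four_le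
    rintro _ ⟨i, rfl⟩
    refine ⟨hW.ncard_petalTriple fun h => h2 (by linear_combination -h), ?_⟩
    have hcl := hW.isClosedOff_short_arc i
    refine isCutset_iff.2 ⟨q (i + 1), hcl.notMem _ (Or.inl rfl), q (i + 3), ?_, fun h => ?_⟩
    · rw [hW.petal_mem_petalTriple, not_or]
      exact ⟨fun h => h3 (by linear_combination h), fun h => h1 (by linear_combination h)⟩
    · rcases hcl.mem_of_sameComponent (Or.inl rfl) h with h | h | h
      · exact h2 (by linear_combination hW.inj h)
      · exact hW.petal_notMem _ _ h
      · exact hW.petal_notMem _ _ h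
  part := sector p q J
  part_injective := fun _ _ h => hW.sector_subset_sector h.le
  range_part := by
    ext A
    constructor
    · rintro ⟨k, rfl⟩
      refine ⟨?_, fun B hB hle => ?_⟩
      · rintro _ ⟨i, rfl⟩
        exact hW.not_splits_sector hG i k
      · obtain ⟨j, hj⟩ := hW.subset_sector_of_not_splits fun i => hB _ ⟨i, rfl⟩
        obtain rfl := hW.sector_subset_sector (hle.trans hj)
        exact hj
    · intro hA
      obtain ⟨k, hk⟩ := hW.subset_sector_of_not_splits fun i => hA.1 _ ⟨i, rfl⟩
      refine ⟨k, Set.Subset.antisymm (hA.2 ?_ hk) hk⟩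
      rintro _ ⟨i, rfl⟩
      exact hW.not_splits_sector hG i k
  boundary_part := by
    intro k
    ext x
    constructor
    · rintro ⟨hx | hx, -, ⟨i, rfl⟩, hx'⟩
      · exact absurd hx' (hW.interior_notMem_petalTriple hx)
      · exact hx
    · intro hx
      refine ⟨Or.inr hx, ?_⟩
      rcases hx with rfl | rfl | rfl
      exacts [⟨_, ⟨k, rfl⟩, Or.inl rfl⟩, ⟨_, ⟨k, rfl⟩, Or.inr (Or.inl rfl)⟩,
        ⟨_, ⟨k + 1, rfl⟩, Or.inr (Or.inl rfl)⟩]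

theorem toFlower_vertexSet : (hW.toFlower hG).vertexSet = insert p (Set.range q) := rfl

end IsWheel

end FlowerWheel

/-! ### Inserting a petal, and what maximality gives -/

section Insertion

variable {V : Type*} {G : SimpleGraph V} {m : ℕ} {p : V} {q : ZMod m → V} {J : ZMod m → Set V}

theorem val_add_one_of_lt [NeZero m] {x : ZMod m} (h : x.val + 1 < m) :
    (x + 1).val = x.val + 1 := by
  have : Fact (1 < m) := ⟨by omega⟩
  rw [ZMod.val_add_of_lt (by rwa [ZMod.val_one]), ZMod.val_one]

theorem zmod_add_one_eq_zero {n : ℕ} (j : ZMod (n + 1)) (h : j.val = n) : j + 1 = 0 := by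
  rw [← ZMod.natCast_zmod_val j, h]
  exact_mod_cast ZMod.natCast_self (n + 1)

namespace IsWheel

variable (hW : IsWheel G m p q J)

include hW

/-- If removing the center and a vertex `r` of an interior separates the two adjacent petals inside
their sector, then `r` can be inserted as a new petal. -/
theorem exists_insert {i : ZMod m} {r : V} (hr : r ∈ J i)
    (hsep : ¬ SameComponent G ({p, r} ∪ (sector p q J i)ᶜ) (q i) (q (i + 1))) :
    ∃ (q' : ZMod (m + 1) → V) (J' : ZMod (m + 1) → Set V), IsWheel G (m + 1) p q' J' ∧
      Set.range q' = insert r (Set.range q) := by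
  have hm := hW.four_le
  have : NeZero m := ⟨by omega⟩
  -- Deleting everything outside the sector restricts attention to it. The component $A$ of $q_i$
  -- becomes the half of the sector between $q_i$ and $r$.
  set R := {p, r} ∪ (sector p q J i)ᶜ with hR
  set A : Set V := {y | SameComponent G R (q i) y} with hA
  have hcl : IsClosedOff G R A := isClosedOff_component
  have hpr : p ≠ r := fun h => hW.center_notMem i (h ▸ hr)
  have hqr : ∀ j, q j ≠ r := fun j h => hW.petal_notMem i j (h ▸ hr)
  have hqiR : q i ∉ R := by
    rintro ((h | h) | h)
    exacts [hW.ne_center _ h, hqr _ h, h (hW.petal_mem_sector.2 (Or.inl rfl))]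
  have hqA : q i ∈ A := SameComponent.refl hqiR
  have hAsub : ∀ y ∈ A, y = q i ∨ y ∈ J i := by
    intro y hy
    have hyR := hcl.notMem y hy
    have hys : y ∈ sector p q J i := by
      by_contra h
      exact hyR (Or.inr h)
    rcases mem_sector.1 hys with h | rfl | h | rfl
    exacts [Or.inr h, absurd (Or.inl (Or.inl rfl)) hyR, Or.inl h, absurd hy hsep]
  have hrA : r ∉ A := fun h => hcl.notMem r h (Or.inl (Or.inr rfl))
  have hpA : p ∉ A := fun h => hcl.notMem p h (Or.inl (Or.inl rfl))
  -- Old indices are listed from $i+1$, so the sector to be divided comes last, at $m-1$. Positions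
  -- below $m-1$ are copied, positions $m-1$ and $m$ hold the two halves, and $r$ is the petal at
  -- position $m$.
  let b : ℕ → ZMod m := fun v => i + 1 + v
  have hbm : b (m - 1) = i := by
    have : ((m - 1 : ℕ) : ZMod m) = -1 := by
      rw [Nat.cast_sub (by omega), ZMod.natCast_self]; simp
    simp only [b, this]; ring
  have hbinj : ∀ v < m, ∀ w < m, b v = b w → v = w := by
    intro v hv w hw h
    have : (v : ZMod m) = w := add_left_cancel h
    rw [← ZMod.val_natCast_of_lt hv, this, ZMod.val_natCast_of_lt hw]
  have hbsurj : ∀ k, ∃ v < m, b v = k := by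
    intro k
    refine ⟨(k - i - 1).val, ZMod.val_lt _, ?_⟩
    simp only [b, ZMod.natCast_zmod_val]
    ring
  have hbsucc : ∀ v, b v + 1 = b (v + 1) := by
    intro v
    simp only [b]; push_cast; ring
  have hb0 : b 0 = i + 1 := by simp [b]
  let q' : ZMod (m + 1) → V := fun j => if j.val < m then q (b j.val) else r
  let J' : ZMod (m + 1) → Set V := fun j =>
    if j.val < m - 1 then J (b j.val)
    else if j.val = m - 1 then A \ {q i} else J i \ insert r A
  have hidx : ∀ v ≤ m, ∃ j : ZMod (m + 1), j.val = v := fun v hv =>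
    ⟨v, ZMod.val_natCast_of_lt (by omega)⟩
  have hlt : ∀ j : ZMod (m + 1), j.val < m + 1 := fun j => ZMod.val_lt j
  have hq'1 : ∀ j : ZMod (m + 1), j.val < m → q' j = q (b j.val) := fun j h => if_pos h
  have hq'2 : ∀ j : ZMod (m + 1), j.val = m → q' j = r := fun j h => if_neg (by omega)
  have hJ'1 : ∀ j : ZMod (m + 1), j.val < m - 1 → J' j = J (b j.val) := fun j h => if_pos h
  have hJ'2 : ∀ j : ZMod (m + 1), j.val = m - 1 → J' j = A \ {q i} := fun j h => by
    simp only [J']; rw [if_neg (by omega), if_pos h]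
  have hJ'3 : ∀ j : ZMod (m + 1), j.val = m → J' j = J i \ insert r A := fun j h => by
    simp only [J']; rw [if_neg (by omega), if_neg (by omega)]
  have htri : ∀ j : ZMod (m + 1), j.val < m - 1 ∨ j.val = m - 1 ∨ j.val = m := fun j => by
    have := hlt j; omega
  have hJ'sub : ∀ j x, x ∈ J' j → ∃ v < m, x ∈ J (b v) ∧ (v < m - 1 → j.val = v) ∧
      (v = m - 1 → j.val = m - 1 ∧ x ∈ A ∨ j.val = m ∧ x ∉ A) := by
    intro j x hx
    rcases htri j with h | h | h
    · rw [hJ'1 j h] at hx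
      exact ⟨j.val, by omega, hx, fun _ => rfl, fun _ => by omega⟩
    · rw [hJ'2 j h] at hx
      exact ⟨m - 1, by omega, by rw [hbm]; exact (hAsub x hx.1).resolve_left hx.2,
        fun _ => by omega, fun _ => Or.inl ⟨h, hx.1⟩⟩
    · rw [hJ'3 j h] at hx
      exact ⟨m - 1, by omega, by rw [hbm]; exact hx.1, fun _ => by omega,
        fun _ => Or.inr ⟨h, fun hA => hx.2 (Or.inr hA)⟩⟩
  have hrJ' : ∀ j, r ∉ J' j := by
    intro j hj
    rcases htri j with h | h | h
    · rw [hJ'1 j h] at hj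
      have := hbinj j.val (by omega) (m - 1) (by omega) (by rw [hbm]; exact hW.eq_of_mem hj hr)
      omega
    · rw [hJ'2 j h] at hj
      exact hrA hj.1
    · rw [hJ'3 j h] at hj
      exact hj.2 (Or.inl rfl)
  refine ⟨q', J', ⟨by omega, ?_, ?_, ?_, ?_, ?_, ?_, ?_⟩, ?_⟩
  · intro x y hxy
    apply ZMod.val_injective
    have hx := hlt x
    have hy := hlt y
    by_cases hxm : x.val < m
    · by_cases hym : y.val < m
      · rw [hq'1 x hxm, hq'1 y hym] at hxy
        exact hbinj _ hxm _ hym (hW.inj hxy)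
      · rw [hq'1 x hxm, hq'2 y (by omega)] at hxy
        exact absurd hxy (hqr _)
    · by_cases hym : y.val < m
      · rw [hq'1 y hym, hq'2 x (by omega)] at hxy
        exact absurd hxy.symm (hqr _)
      · omega
  · intro j
    by_cases hjm : j.val < m
    · rw [hq'1 j hjm]; exact hW.ne_center _
    · have := hlt j
      rw [hq'2 j (by omega)]; exact hpr.symm
  · intro j hj
    obtain ⟨v, -, hv, -⟩ := hJ'sub j p hj
    exact hW.center_notMem _ hv
  · intro k j hj
    by_cases hjm : j.val < m
    · rw [hq'1 j hjm] at hj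
      obtain ⟨v, -, hv, -⟩ := hJ'sub k _ hj
      exact hW.petal_notMem _ _ hv
    · have := hlt j
      rw [hq'2 j (by omega)] at hj
      exact hrJ' _ hj
  · intro j k x hj hk
    obtain ⟨v, hvm, hv, hv1, hv2⟩ := hJ'sub j x hj
    obtain ⟨w, hwm, hw, hw1, hw2⟩ := hJ'sub k x hk
    obtain rfl := hbinj v hvm w hwm (hW.eq_of_mem hv hw)
    apply ZMod.val_injective
    rcases Nat.lt_or_ge v (m - 1) with h | h
    · rw [hv1 h, hw1 h]
    · have h' : v = m - 1 := by omega
      rcases hv2 h' with ⟨e, e'⟩ | ⟨e, e'⟩ <;> rcases hw2 h' with ⟨f, f'⟩ | ⟨f, f'⟩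
      · omega
      · exact absurd e' f'
      · exact absurd f' e'
      · omega
  · intro x
    rcases hW.cover x with h | ⟨k, rfl⟩ | ⟨k, hk⟩
    · exact Or.inl h
    · obtain ⟨v, hv, rfl⟩ := hbsurj k
      obtain ⟨j, rfl⟩ := hidx v hv.le
      exact Or.inr (Or.inl ⟨j, (hq'1 j hv).symm⟩)
    · obtain ⟨v, hv, rfl⟩ := hbsurj k
      rcases Nat.lt_or_ge v (m - 1) with h | h
      · obtain ⟨j, rfl⟩ := hidx v hv.le
        exact Or.inr (Or.inr ⟨j, by rwa [hJ'1 j h]⟩)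
      · obtain rfl : v = m - 1 := by omega
        rw [hbm] at hk
        obtain ⟨j1, hj1⟩ := hidx (m - 1) (by omega)
        obtain ⟨j2, hj2⟩ := hidx m (by omega)
        by_cases hxr : x = r
        · exact Or.inr (Or.inl ⟨j2, by rw [hq'2 j2 hj2, hxr]⟩)
        · by_cases hxA : x ∈ A
          · refine Or.inr (Or.inr ⟨j1, ?_⟩)
            rw [hJ'2 j1 hj1]
            exact ⟨hxA, fun h => hW.petal_notMem i i (h ▸ hk)⟩
          · refine Or.inr (Or.inr ⟨j2, ?_⟩)
            rw [hJ'3 j2 hj2]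
            exact ⟨hk, fun h => h.elim hxr hxA⟩
  · intro x y hxy
    obtain ⟨k, hx, hy⟩ := hW.adj x y hxy
    obtain ⟨v, hv, rfl⟩ := hbsurj k
    rcases Nat.lt_or_ge v (m - 1) with h | h
    · obtain ⟨j, rfl⟩ := hidx v hv.le
      have hj1 : (j + 1).val = j.val + 1 := val_add_one_of_lt (by omega)
      have hsec : sector p q' J' j = sector p q J (b j.val) := by
        simp only [sector, petalTriple]
        rw [hJ'1 j h, hq'1 j hv, hq'1 (j + 1) (by omega), hj1, hbsucc]
      exact ⟨j, by rwa [hsec], by rwa [hsec]⟩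
    · obtain rfl : v = m - 1 := by omega
      rw [hbm] at hx hy
      obtain ⟨j1, hj1⟩ := hidx (m - 1) (by omega)
      obtain ⟨j2, hj2⟩ := hidx m (by omega)
      have hj1' : (j1 + 1).val = m := by rw [val_add_one_of_lt (by omega)]; omega
      -- The only wrap-around: the second half ends at position 0, which is the old petal $q_{i+1}$.
      have hj2' : (j2 + 1).val = 0 := by rw [zmod_add_one_eq_zero j2 hj2, ZMod.val_zero]
      have hq1 : q' j1 = q i := by rw [hq'1 j1 (by omega), hj1, hbm]
      have hq1' : q' (j1 + 1) = r := hq'2 _ hj1'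
      have hq2 : q' j2 = r := hq'2 j2 hj2
      have hq2' : q' (j2 + 1) = q (i + 1) := by
        rw [hq'1 _ (by omega), hj2', hb0]
      have hin : ∀ z, z ∈ insert p (insert r A) → z ∈ sector p q' J' j1 := by
        rintro z hz
        rw [mem_sector, hq1, hq1', hJ'2 j1 hj1]
        by_cases hzq : z = q i
        · exact Or.inr (Or.inr (Or.inl hzq))
        · rcases hz with h | h | h
          exacts [Or.inr (Or.inl h), Or.inr (Or.inr (Or.inr h)), Or.inl ⟨h, hzq⟩]
      have hout : ∀ z ∈ sector p q J i, z ∉ A → z ∈ sector p q' J' j2 := by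
        rintro z hz hzA
        rw [mem_sector, hq2, hq2', hJ'3 j2 hj2]
        by_cases hzr : z = r
        · exact Or.inr (Or.inr (Or.inl hzr))
        · rcases mem_sector.1 hz with h | h | h | h
          exacts [Or.inl ⟨h, fun h => h.elim hzr hzA⟩, Or.inr (Or.inl h),
            absurd (h ▸ hqA) hzA, Or.inr (Or.inr (Or.inr h))]
      have hAadj : ∀ z ∈ A, ∀ w ∈ sector p q J i, G.Adj z w → w ∈ insert p (insert r A) := by
        intro z hz w hw hzw
        by_contra! hcon
        refine hcon (Or.inr (Or.inr (hcl.mem_of_adj z hz w ?_ hzw)))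
        rintro ((h | h) | h)
        exacts [hcon (Or.inl h), hcon (Or.inr (Or.inl h)), h hw]
      by_cases hxA : x ∈ A
      · exact ⟨j1, hin x (Or.inr (Or.inr hxA)), hin y (hAadj x hxA y hy hxy)⟩
      · by_cases hyA : y ∈ A
        · exact ⟨j1, hin x (hAadj y hyA x hx hxy.symm), hin y (Or.inr (Or.inr hyA))⟩
        · exact ⟨j2, hout x hx hxA, hout y hy hyA⟩
  · ext x
    constructor
    · rintro ⟨j, rfl⟩
      by_cases hjm : j.val < m
      · rw [hq'1 j hjm]; exact Or.inr ⟨_, rfl⟩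
      · have := hlt j
        rw [hq'2 j (by omega)]; exact Or.inl rfl
    · rintro (rfl | ⟨k, rfl⟩)
      · obtain ⟨j2, hj2⟩ := hidx m (by omega)
        exact ⟨j2, hq'2 j2 hj2⟩
      · obtain ⟨v, hv, rfl⟩ := hbsurj k
        obtain ⟨j, rfl⟩ := hidx v hv.le
        exact ⟨j, hq'1 j hv⟩

end IsWheel

/-- No interior vertex separates, together with the center, two consecutive petals inside their
sector: it could be inserted as a petal. -/
theorem Flower.IsMaximal.sameComponent [Finite V] {F : Flower G} (hmax : F.IsMaximal)
    (hG : IsTriconnected G) {i : ZMod F.m} {r : V} (hr : r ∈ F.inter i) :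
    SameComponent G ({F.center, r} ∪ (sector F.center F.petal F.inter i)ᶜ)
      (F.petal i) (F.petal (i + 1)) := by
  by_contra hsep
  obtain ⟨q', J', hW', hrange⟩ := F.isWheel.exists_insert hr hsep
  have h := hmax (hW'.toFlower hG) rfl (by
    rw [IsWheel.toFlower_vertexSet, hrange]
    exact Set.insert_subset_insert (Set.subset_insert _ _))
  have hr' : r ∈ F.vertexSet := by
    rw [← h, IsWheel.toFlower_vertexSet, hrange]
    exact Or.inr (Or.inl rfl)
  rcases hr' with rfl | ⟨j, rfl⟩
  · exact F.isWheel.center_notMem _ hr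
  · exact F.isWheel.petal_notMem _ _ hr

end Insertion

/-! ### Propagating a property around the cycle of indices -/

section Cyclic

variable {m : ℕ} {X : ZMod m → Prop}

theorem iff_of_steps [NeZero m] (a : ZMod m) (n : ℕ)
    (hX : ∀ v : ℕ, v < n → (X (a + v) ↔ X (a + v + 1))) {i j : ZMod m} (hi : (i - a).val ≤ n)
    (hj : (j - a).val ≤ n) : X i ↔ X j := by
  have key : ∀ v : ℕ, v ≤ n → (X a ↔ X (a + v)) := by
    intro v
    induction v with
    | zero => simp
    | succ v ih =>
      intro hv
      rw [ih (by omega), hX v (by omega)]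
      push_cast
      rw [add_assoc]
  have e : ∀ i : ZMod m, a + ((i - a).val : ZMod m) = i := fun i => by
    rw [ZMod.natCast_zmod_val]; ring
  have hi' := key _ hi
  have hj' := key _ hj
  rw [e] at hi' hj'
  exact hi'.symm.trans hj'

theorem val_add_lt_of_ne [NeZero m] {x : ZMod m} {k : ℕ}
    (h : ∀ l : ℕ, l < m → m ≤ l + k → x ≠ l) : x.val + k < m := by
  by_contra hcon
  exact h x.val (ZMod.val_lt x) (by omega) (ZMod.natCast_zmod_val x).symm

/-- A cycle minus one edge is a path through all $m$ indices, starting at $d+1$. The next two lemmas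
do the same after removing one vertex or two consecutive vertices. -/
theorem iff_of_steps_of_ne (hm : 4 ≤ m) (d : ZMod m) (hX : ∀ j, j ≠ d → (X j ↔ X (j + 1)))
    (i j : ZMod m) : X i ↔ X j := by
  have : NeZero m := ⟨by omega⟩
  refine iff_of_steps (d + 1) (m - 1) (fun v hv => hX _ fun h => ?_) ?_ ?_
  · exact natCast_ne_zero_of_lt (m := m) (k := v + 1) (by omega) (by omega)
      (by push_cast; linear_combination h)
  · have := ZMod.val_lt (i - (d + 1)); omega
  · have := ZMod.val_lt (j - (d + 1)); omega

theorem iff_of_steps_off_vertex (hm : 4 ≤ m) (c : ZMod m)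
    (hX : ∀ j, j ≠ c → j + 1 ≠ c → (X j ↔ X (j + 1))) {i j : ZMod m} (hi : i ≠ c) (hj : j ≠ c) :
    X i ↔ X j := by
  have : NeZero m := ⟨by omega⟩
  have hval : ∀ i : ZMod m, i ≠ c → (i - (c + 1)).val ≤ m - 2 := by
    intro i hi
    have := val_add_lt_of_ne (x := i - (c + 1)) (k := 1) fun l hl hl' h => by
      have h' : ((l + 1 : ℕ) : ZMod m) = 0 := by
        rw [show l + 1 = m by omega, ZMod.natCast_self]
      push_cast at h'
      exact hi (by linear_combination h + h')
    omega
  refine iff_of_steps (c + 1) (m - 2) (fun v hv => hX _ (fun h => ?_) fun h => ?_)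
    (hval i hi) (hval j hj)
  · exact natCast_ne_zero_of_lt (m := m) (k := v + 1) (by omega) (by omega)
      (by push_cast; linear_combination h)
  · exact natCast_ne_zero_of_lt (m := m) (k := v + 2) (by omega) (by omega)
      (by push_cast; linear_combination h)

theorem iff_of_steps_off_pair (hm : 4 ≤ m) (c : ZMod m)
    (hX : ∀ j, j ≠ c → j ≠ c + 1 → j + 1 ≠ c → (X j ↔ X (j + 1))) {i j : ZMod m} (hi : i ≠ c)
    (hi' : i ≠ c + 1) (hj : j ≠ c) (hj' : j ≠ c + 1) : X i ↔ X j := by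
  have : NeZero m := ⟨by omega⟩
  have hval : ∀ i : ZMod m, i ≠ c → i ≠ c + 1 → (i - (c + 2)).val ≤ m - 3 := by
    intro i hi hi'
    have := val_add_lt_of_ne (x := i - (c + 2)) (k := 2) fun l hl hl' h => by
      rcases (show l + 1 = m ∨ l + 2 = m by omega) with e | e
      · have h' : ((l + 1 : ℕ) : ZMod m) = 0 := by rw [e, ZMod.natCast_self]
        push_cast at h'
        exact hi' (by linear_combination h + h')
      · have h' : ((l + 2 : ℕ) : ZMod m) = 0 := by rw [e, ZMod.natCast_self]
        push_cast at h'
        exact hi (by linear_combination h + h')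
    omega
  refine iff_of_steps (c + 2) (m - 3) (fun v hv => hX _ (fun h => ?_) (fun h => ?_) fun h => ?_)
    (hval i hi hi') (hval j hj hj')
  · exact natCast_ne_zero_of_lt (m := m) (k := v + 2) (by omega) (by omega)
      (by push_cast; linear_combination h)
  · exact natCast_ne_zero_of_lt (m := m) (k := v + 1) (by omega) (by omega)
      (by push_cast; linear_combination h)
  · exact natCast_ne_zero_of_lt (m := m) (k := v + 3) (by omega) (by omega)
      (by push_cast; linear_combination h)

end Cyclic

/-! ### Tight wheels: links between petals, empty interiors, nondegeneracy -/

section Links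

variable {V : Type*} [Finite V] {G : SimpleGraph V} {m : ℕ} {p : V} {q : ZMod m → V}
  {J : ZMod m → Set V} {S C : Set V}

/-- A cyclic decomposition of a triconnected graph in which no interior vertex can be inserted as
a new petal and whose center and petals are not covered by a cut of three edges. -/
structure IsTightWheel (G : SimpleGraph V) (m : ℕ) (p : V) (q : ZMod m → V)
    (J : ZMod m → Set V) : Prop extends IsWheel G m p q J where
  triconnected : IsTriconnected G
  link : ∀ k, ∀ r ∈ J k, SameComponent G ({p, r} ∪ (sector p q J k)ᶜ) (q k) (q (k + 1))
  nondegenerate : ¬ ∃ M ∈ mixedCuts G 3, insert p (Set.range q) ⊆ M.vertexSet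

theorem Flower.isTightWheel (hG : IsTriconnected G) (F : Flower G) (hmax : F.IsMaximal)
    (hnd : F.IsNondegenerate) : IsTightWheel G F.m F.center F.petal F.inter where
  toIsWheel := F.isWheel
  triconnected := hG
  link _ _ hr := hmax.sameComponent hG hr
  nondegenerate := hnd

namespace IsTightWheel

variable (hW : IsTightWheel G m p q J)

include hW

/-- A single vertex of $S$ in the interior is handled by maximality, which tolerates the loss of $p$
and of everything outside the sector as well. With no such vertex, triconnectivity suffices. -/
theorem sameComponent_petal_succ {k : ZMod m} (hS : (J k ∩ S).Subsingleton) (h : q k ∉ S)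
    (h' : q (k + 1) ∉ S) : SameComponent G S (q k) (q (k + 1)) := by
  by_cases hr : ∃ r ∈ J k, r ∈ S
  · obtain ⟨r, hr, hrS⟩ := hr
    refine (hW.link k r hr).mono fun s hs => ?_
    by_cases hsk : s ∈ sector p q J k
    · rcases mem_sector.1 hsk with hsk | rfl | rfl | rfl
      exacts [Or.inl (Or.inr (hS ⟨hsk, hs⟩ ⟨hr, hrS⟩)), Or.inl (Or.inl rfl), absurd hs h,
        absurd hs h']
    · exact Or.inr hsk
  · push Not at hr
    exact hW.sameComponent_petal_succ_of_forall_notMem hW.triconnected hr h h'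

theorem petal_succ_mem (hC : IsClosedOff G S C) {k : ZMod m} (hS : (J k ∩ S).Subsingleton)
    (h : q k ∈ C) (h' : q (k + 1) ∉ S) : q (k + 1) ∈ C :=
  hC.mem_of_sameComponent h (hW.sameComponent_petal_succ hS (hC.notMem _ h) h')

theorem petal_mem_of_succ_mem (hC : IsClosedOff G S C) {k : ZMod m}
    (hS : (J k ∩ S).Subsingleton) (h : q (k + 1) ∈ C) (h' : q k ∉ S) : q k ∈ C :=
  hC.mem_of_sameComponent h (hW.sameComponent_petal_succ hS h' (hC.notMem _ h)).symm

/-- A nonempty interior untouched by $S$ would join the petal to $p$. -/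
theorem interior_eq_empty (hC : IsClosedOff G S C) (hp : p ∉ S) (hpC : p ∉ C) {k : ZMod m}
    (hS : ∀ y ∈ J k, y ∉ S) (h : q k ∈ C ∨ q (k + 1) ∈ C) : J k = ∅ := by
  by_contra hne
  have hne := Set.nonempty_iff_ne_empty.2 hne
  rcases h with h | h
  · exact hpC (hC.mem_of_sameComponent h (hW.sameComponent_center_of_forall_notMem
      hW.triconnected hS hne hp (hW.petal_mem_sector.2 (Or.inl rfl)) (hC.notMem _ h)).symm)
  · exact hpC (hC.mem_of_sameComponent h (hW.sameComponent_center_of_forall_notMem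
      hW.triconnected hS hne hp (hW.petal_mem_sector.2 (Or.inr rfl)) (hC.notMem _ h)).symm)

/-- If both adjacent interiors avoided $S$ they would be empty, and the petal would be adjacent to
$p$. This drives the counting: three vertices of $S$ can serve only a few petals. -/
theorem interior_meets (hC : IsClosedOff G S C) (hp : p ∉ S) (hpC : p ∉ C) {k : ZMod m}
    (h : q k ∈ C) : (∃ y ∈ J k, y ∈ S) ∨ ∃ y ∈ J (k - 1), y ∈ S := by
  by_contra! hcon
  have e1 := hW.interior_eq_empty hC hp hpC hcon.1 (Or.inl h)
  have e2 := hW.interior_eq_empty hC hp hpC hcon.2 (Or.inr (by rwa [sub_add_cancel]))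
  exact hpC (hC.mem_of_adj _ h p hp (hW.adj_center_petal hW.triconnected e1 e2))

/-- If the two petals of a sector are cut off from the center and the cut has a single vertex in
the interior of the sector, this vertex is the only neighbour of the center in the sector. -/
theorem unique_neighbor (hC : IsClosedOff G S C) (hp : p ∉ S) (hpC : p ∉ C) {k : ZMod m}
    (h : q k ∈ C) (h' : q (k + 1) ∈ C) {s : V} (hs : s ∈ J k) (hsS : s ∈ S)
    (hS : (J k ∩ S).Subsingleton) :
    G.Adj p s ∧ ∀ y ∈ sector p q J k, G.Adj p y → y = s := by
  -- What remains of $J_k$ outside $C$ and $s$ has boundary in $\{p,s\}$, hence is empty. As $p$ has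
  -- no neighbour in $C$, only $s$ can be its neighbour here.
  have hcl : IsClosedOff G {p, s} ((J k \ C) \ {s}) := by
    refine ⟨?_, ?_⟩
    · rintro x hx (rfl | rfl)
      · exact hW.center_notMem _ hx.1.1
      · exact hx.2 rfl
    · rintro x ⟨⟨hx, hxC⟩, hxs⟩ y hy hxy
      have hxS : x ∉ S := fun h => hxs (hS ⟨hx, h⟩ ⟨hs, hsS⟩)
      have hyC : y ∉ C := fun hyC => hxC (hC.mem_of_adj y hyC x hxS hxy.symm)
      rcases hW.adj_interior hx hxy with e | rfl | rfl | rfl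
      · exact ⟨⟨e, hyC⟩, fun e' => hy (Or.inr e')⟩
      · exact absurd (Or.inl rfl) hy
      · exact absurd h hyC
      · exact absurd h' hyC
  have hempty : ∀ x ∈ J k, x ∉ C → x = s := by
    intro x hx hxC
    by_contra hxs
    rcases hW.triconnected.mem_or_mem (ncard_pair_le _ _) hcl ⟨x, ⟨hx, hxC⟩, hxs⟩ (q k)
      with e | e | e
    · exact hW.petal_notMem _ _ e.1.1
    · exact hW.ne_center _ e
    · exact hW.petal_notMem _ _ (e ▸ hs)
  have huniq : ∀ y ∈ sector p q J k, G.Adj p y → y = s := by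
    intro y hy hpy
    have hyC : y ∉ C := fun hyC => hpC (hC.mem_of_adj y hyC p hp hpy.symm)
    rcases mem_sector.1 hy with e | rfl | rfl | rfl
    exacts [hempty y e hyC, absurd hpy (G.loopless.irrefl _), absurd h hyC, absurd h' hyC]
  obtain ⟨x, hx, hpx⟩ := hW.exists_adj_center hW.triconnected ⟨s, hs⟩
  have := huniq x (Or.inl hx) hpx
  exact ⟨this ▸ hpx, huniq⟩

/-- Deleting the edges $q_{k-1}q_k$, $q_{k+1}q_{k+2}$ and $ps$ cuts $J_k\cup\{q_k,q_{k+1}\}$ off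
from $p$. Since there are only four petals, the ends of these edges include all of $V(F)$, against
nondegeneracy. -/
theorem false_of_unique_neighbor {k : ZMod m} (hall : ∀ j, j = k - 1 ∨ j = k ∨ j = k + 1 ∨ j = k + 2)
    (h1 : J (k - 1) = ∅) (h2 : J (k + 1) = ∅) {s : V} (hs : s ∈ J k) (hps : G.Adj p s)
    (huniq : ∀ y ∈ sector p q J k, G.Adj p y → y = s) : False := by
  obtain ⟨n1, n2, n3⟩ := small_ne_zero hW.four_le
  have e1 : G.Adj (q (k - 1)) (q k) := by
    simpa using hW.adj_petal_succ hW.triconnected h1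
  have e2 : G.Adj (q (k + 1)) (q (k + 2)) := by
    simpa [add_assoc, one_add_one_eq_two] using hW.adj_petal_succ hW.triconnected h2
  have hsq : ∀ j, q j ≠ s := fun j h => hW.petal_notMem _ _ (h ▸ hs)
  have hcl : IsClosedOff (G.deleteEdges {s(q (k - 1), q k), s(q (k + 1), q (k + 2)), s(p, s)}) ∅
      (J k ∪ {q k, q (k + 1)}) := by
    refine ⟨fun _ _ h => h, ?_⟩
    rintro x hx y - hxy
    rw [SimpleGraph.deleteEdges_adj] at hxy
    obtain ⟨hxy, hne⟩ := hxy
    have hpx : ∀ x ∈ sector p q J k, y = p → G.Adj x y →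
        s(x, y) ∉ ({s(q (k - 1), q k), s(q (k + 1), q (k + 2)), s(p, s)} : Set (Sym2 V)) →
        y ∈ J k ∪ {q k, q (k + 1)} := by
      rintro x hx rfl hxy hne
      obtain rfl := huniq x hx hxy.symm
      exact absurd (Or.inr (Or.inr Sym2.eq_swap)) hne
    rcases hx with hx | rfl | rfl
    · rcases hW.adj_interior hx hxy with e | e | rfl | rfl
      · exact Or.inl e
      · exact hpx x (Or.inl hx) e hxy hne
      · exact Or.inr (Or.inl rfl)
      · exact Or.inr (Or.inr rfl)
    · rcases hW.adj_petal hxy with (e | e | rfl) | e | e | rfl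
      · exact Or.inl e
      · exact hpx _ (hW.petal_mem_sector.2 (Or.inl rfl)) e hxy hne
      · exact Or.inr (Or.inr rfl)
      · simp [h1] at e
      · exact hpx _ (hW.petal_mem_sector.2 (Or.inl rfl)) e hxy hne
      · exact absurd (Or.inl Sym2.eq_swap) hne
    · rcases hW.adj_petal hxy with (e | e | rfl) | e | e | rfl
      · simp [h2] at e
      · exact hpx _ (hW.petal_mem_sector.2 (Or.inr rfl)) e hxy hne
      · rw [add_assoc, one_add_one_eq_two] at hne
        exact absurd (Or.inr (Or.inl rfl)) hne
      · rw [add_sub_cancel_right] at e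
        exact Or.inl e
      · exact hpx _ (hW.petal_mem_sector.2 (Or.inr rfl)) e hxy hne
      · rw [add_sub_cancel_right]
        exact Or.inr (Or.inl rfl)
  refine hW.nondegenerate
    ⟨⟨∅, {s(q (k - 1), q k), s(q (k + 1), q (k + 2)), s(p, s)}⟩, ⟨⟨?_, ?_⟩, ?_, ?_⟩, ?_⟩
  · rintro _ (rfl | rfl | rfl)
    exacts [e1, e2, hps]
  · refine isCutset_iff.2 ⟨q k, id, p, id, fun h => ?_⟩
    rcases hcl.mem_of_sameComponent (Or.inr (Or.inl rfl)) h with h | h | h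
    exacts [hW.center_notMem _ h, hW.ne_center _ h.symm, hW.ne_center _ h.symm]
  · rw [Set.ncard_eq_three]
    refine ⟨_, _, _, ?_, ?_, ?_, rfl⟩
    · rw [Ne, Sym2.eq_iff]
      rintro (⟨h, -⟩ | ⟨-, h⟩)
      · exact n2 (by linear_combination -hW.inj h)
      · exact n1 (by linear_combination -hW.inj h)
    · rw [Ne, Sym2.eq_iff]
      rintro (⟨h, -⟩ | ⟨h, -⟩)
      exacts [hW.ne_center _ h, hsq _ h]
    · rw [Ne, Sym2.eq_iff]
      rintro (⟨h, -⟩ | ⟨h, -⟩)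
      exacts [hW.ne_center _ h, hsq _ h]
  · simp
  · rintro _ (rfl | ⟨j, rfl⟩)
    · exact Or.inr ⟨_, Or.inr (Or.inr rfl), Sym2.mem_mk_left _ _⟩
    · rcases hall j with rfl | rfl | rfl | rfl
      · exact Or.inr ⟨_, Or.inl rfl, Sym2.mem_mk_left _ _⟩
      · exact Or.inr ⟨_, Or.inl rfl, Sym2.mem_mk_right _ _⟩
      · exact Or.inr ⟨_, Or.inr (Or.inl rfl), Sym2.mem_mk_left _ _⟩
      · exact Or.inr ⟨_, Or.inr (Or.inl rfl), Sym2.mem_mk_right _ _⟩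

end IsTightWheel

end Links

/-! ### Three-vertex sets avoiding the center -/

section CutsOffCenter

variable {V : Type*} [Finite V] {G : SimpleGraph V} {m : ℕ} {p : V} {q : ZMod m → V}
  {J : ZMod m → Set V} {S C : Set V}

/-- Two sectors touching every petal can only be opposite sectors of a four-petal wheel. -/
theorem opposite_of_forall (hm : 4 ≤ m) {d e : ZMod m} (hde : d ≠ e)
    (h : ∀ j, j = d ∨ j = d + 1 ∨ j = e ∨ j = e + 1) :
    e = d + 2 ∧ ∀ j, j = e - 1 ∨ j = e ∨ j = e + 1 ∨ j = e + 2 := by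
  obtain ⟨n1, n2, n3⟩ := small_ne_zero hm
  have he : e = d + 2 := by
    rcases h (d + 2) with e1 | e1 | e1 | e1
    · exact absurd (by linear_combination e1) n2
    · exact absurd (by linear_combination e1) n1
    · exact e1.symm
    · rcases h (d + 3) with e2 | e2 | e2 | e2
      · exact absurd (by linear_combination e2) n3
      · exact absurd (by linear_combination e2) n2
      · exact absurd (by linear_combination e2 - e1) n2
      · exact absurd (by linear_combination e2 - e1) n1
  subst he
  have h4 : d = d + 2 + 2 := by
    rcases h (d + 2 + 2) with e1 | e1 | e1 | e1
    · exact e1.symm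
    · exact absurd (by linear_combination e1) n3
    · exact absurd (by linear_combination e1) n2
    · exact absurd (by linear_combination e1) n1
  refine ⟨rfl, fun j => ?_⟩
  rcases h j with e1 | e1 | e1 | e1
  · exact Or.inr (Or.inr (Or.inr (e1.trans h4)))
  · exact Or.inl (by linear_combination e1)
  · exact Or.inr (Or.inl e1)
  · exact Or.inr (Or.inr (Or.inl e1))

namespace IsTightWheel

variable (hW : IsTightWheel G m p q J)

include hW

/-- The one vertex of $S$ in $J_e$ is the only neighbour of $p$ in sector $e$, and both adjacent
sectors avoid $S$ and so are empty: this is the situation nondegeneracy excludes. -/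
theorem false_of_opposite (hC : IsClosedOff G S C) (hp : p ∉ S) (hpC : p ∉ C) {d e : ZMod m}
    (hde : d ≠ e) (hclean : ∀ k, ∀ y ∈ J k, y ∈ S → k = d ∨ k = e)
    (hsub : (J e ∩ S).Subsingleton) (hne : (J e ∩ S).Nonempty)
    (hall : ∀ j, j = d ∨ j = d + 1 ∨ j = e ∨ j = e + 1)
    (hmem : ∀ j, j ≠ d → j ≠ d + 1 → q j ∈ C) : False := by
  obtain ⟨n1, n2, n3⟩ := small_ne_zero hW.four_le
  obtain ⟨rfl, hall'⟩ := opposite_of_forall hW.four_le hde hall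
  obtain ⟨t, ht, htS⟩ := hne
  have m1 : q (d + 2) ∈ C := hmem _ (fun h => n2 (by linear_combination h))
    fun h => n1 (by linear_combination h)
  have m2 : q (d + 2 + 1) ∈ C := hmem _ (fun h => n3 (by linear_combination h))
    fun h => n2 (by linear_combination h)
  obtain ⟨hpt, huniq⟩ := hW.unique_neighbor hC hp hpC m1 m2 ht htS hsub
  refine hW.false_of_unique_neighbor hall' ?_ ?_ ht hpt huniq
  · refine hW.interior_eq_empty hC hp hpC (fun y hy hyS => ?_) (Or.inr (by rwa [sub_add_cancel]))
    rcases hclean _ y hy hyS with h | h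
    · exact n1 (by linear_combination h)
    · exact n1 (by linear_combination -h)
  · refine hW.interior_eq_empty hC hp hpC (fun y hy hyS => ?_) (Or.inl m2)
    rcases hclean _ y hy hyS with h | h
    · exact n3 (by linear_combination h)
    · exact n1 (by linear_combination h)

omit [Finite V] in
/-- How three vertices other than the center are distributed over petals and interiors. -/
theorem distribution (hS : S.ncard = 3) (hp : p ∉ S) :
    (∃ d, ∀ k, ∀ y ∈ J k, y ∈ S → k = d) ∨
    (∃ d e, d ≠ e ∧ (∀ k, ∀ y ∈ J k, y ∈ S → k = d ∨ k = e) ∧ (J e ∩ S).Subsingleton ∧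
      (J e ∩ S).Nonempty ∧ ∀ j, q j ∉ S) ∨
    (∃ c d e, d ≠ e ∧ q c ∈ S ∧ (∀ j, q j ∈ S → j = c) ∧
      (∀ k, ∀ y ∈ J k, y ∈ S → k = d ∨ k = e) ∧ (∀ k, (J k ∩ S).Subsingleton) ∧
      (J d ∩ S).Nonempty ∧ (J e ∩ S).Nonempty) ∨
    ((∀ j, q j ∉ S) ∧ ∀ k, (J k ∩ S).Subsingleton) := by
  have hnot : ∀ {j k x}, x ∈ J k → q j ≠ x := fun hx h => hW.petal_notMem _ _ (h ▸ hx)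
  have two : ∀ c d e s t, s ∈ J d → t ∈ J e → S = {s, t, q c} →
      (∃ d, ∀ k, ∀ y ∈ J k, y ∈ S → k = d) ∨
      (∃ c d e, d ≠ e ∧ q c ∈ S ∧ (∀ j, q j ∈ S → j = c) ∧
      (∀ k, ∀ y ∈ J k, y ∈ S → k = d ∨ k = e) ∧ (∀ k, (J k ∩ S).Subsingleton) ∧
      (J d ∩ S).Nonempty ∧ (J e ∩ S).Nonempty) := by
    rintro c d e s t hs ht rfl
    have hmem : ∀ k, ∀ y ∈ J k, y ∈ ({s, t, q c} : Set V) → (y = s ∧ k = d) ∨ (y = t ∧ k = e) := by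
      rintro k y hy (rfl | rfl | rfl)
      exacts [Or.inl ⟨rfl, hW.eq_of_mem hy hs⟩, Or.inr ⟨rfl, hW.eq_of_mem hy ht⟩,
        absurd hy (hW.petal_notMem _ _)]
    by_cases hde : d = e
    · subst hde
      exact Or.inl ⟨d, fun k y hy hyS => (hmem k y hy hyS).elim And.right And.right⟩
    · refine Or.inr ⟨c, d, e, hde, by simp, ?_,
        fun k y hy hyS => (hmem k y hy hyS).imp And.right And.right, ?_, ⟨s, hs, by simp⟩,
        ⟨t, ht, by simp⟩⟩
      · rintro j (h | h | h)
        exacts [absurd h (hnot hs), absurd h (hnot ht), hW.inj h]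
      · rintro k y ⟨hy, hyS⟩ z ⟨hz, hzS⟩
        rcases hmem k y hy hyS with ⟨rfl, rfl⟩ | ⟨rfl, rfl⟩ <;>
          rcases hmem _ z hz hzS with ⟨rfl, h⟩ | ⟨rfl, h⟩
        exacts [rfl, absurd h hde, absurd h.symm hde, rfl]
  have one : ∀ a b d s, s ∈ J d → S = {s, q a, q b} → ∃ d, ∀ k, ∀ y ∈ J k, y ∈ S → k = d := by
    rintro a b d s hs rfl
    refine ⟨d, ?_⟩
    rintro k y hy (rfl | rfl | rfl)
    exacts [hW.eq_of_mem hy hs, absurd hy (hW.petal_notMem _ _), absurd hy (hW.petal_notMem _ _)]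
  have three : ∀ d e s r t, s ∈ J d → r ∈ J d → t ∈ J e → d ≠ e → S = {s, r, t} →
      ∃ d e, d ≠ e ∧ (∀ k, ∀ y ∈ J k, y ∈ S → k = d ∨ k = e) ∧ (J e ∩ S).Subsingleton ∧
      (J e ∩ S).Nonempty ∧ ∀ j, q j ∉ S := by
    rintro d e s r t hs hr ht hde rfl
    refine ⟨d, e, hde, ?_, ?_, ⟨t, ht, by simp⟩, ?_⟩
    · rintro k y hy (rfl | rfl | rfl)
      exacts [Or.inl (hW.eq_of_mem hy hs), Or.inl (hW.eq_of_mem hy hr),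
        Or.inr (hW.eq_of_mem hy ht)]
    · have : ∀ y, y ∈ J e → y ∈ ({s, r, t} : Set V) → y = t := by
        rintro y hy (rfl | rfl | rfl)
        exacts [absurd (hW.eq_of_mem hs hy) hde, absurd (hW.eq_of_mem hr hy) hde, rfl]
      exact fun y hy z hz => (this y hy.1 hy.2).trans (this z hz.1 hz.2).symm
    · rintro j (h | h | h)
      exacts [hnot hs h, hnot hr h, hnot ht h]
  obtain ⟨x, y, z, -, -, -, hxyz⟩ := Set.ncard_eq_three.1 hS
  have hloc : ∀ x ∈ S, (∃ i, x = q i) ∨ ∃ i, x ∈ J i := fun x hx =>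
    (hW.cover x).resolve_left fun h => hp (h ▸ hx)
  have h1 : ({x, y, z} : Set V) = {y, z, x} := by
    rw [Set.insert_comm, Set.pair_comm]
  have h2 : ({x, y, z} : Set V) = {x, z, y} := by
    rw [Set.pair_comm]
  have h3 : ({x, y, z} : Set V) = {z, x, y} := by
    rw [h2, Set.insert_comm]
  have h4 : ({x, y, z} : Set V) = {y, x, z} := Set.insert_comm _ _ _
  rcases hloc x (by simp [hxyz]) with ⟨i, hx⟩ | ⟨i, hx⟩ <;>
    rcases hloc y (by simp [hxyz]) with ⟨j, hy⟩ | ⟨j, hy⟩ <;>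
    rcases hloc z (by simp [hxyz]) with ⟨k, hz⟩ | ⟨k, hz⟩
  · left
    -- No vertex of $S$ is interior, so any index serves.
    refine ⟨0, fun l w hw hwS => ?_⟩
    rw [hxyz] at hwS
    rcases hwS with rfl | rfl | rfl
    exacts [absurd hx.symm (hnot hw), absurd hy.symm (hnot hw), absurd hz.symm (hnot hw)]
  · exact Or.inl (one i j k z hz (by rw [hxyz, h3, hx, hy]))
  · exact Or.inl (one i k j y hy (by rw [hxyz, h4, hx, hz]))
  · exact (two i j k y z hy hz (by rw [hxyz, h1, hx])).imp_right fun h => Or.inr (Or.inl h)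
  · exact Or.inl (one j k i x hx (by rw [hxyz, hy, hz]))
  · exact (two j i k x z hx hz (by rw [hxyz, h2, hy])).imp_right fun h => Or.inr (Or.inl h)
  · exact (two k i j x y hx hy (by rw [hxyz, hz])).imp_right fun h => Or.inr (Or.inl h)
  · by_cases hij : i = j
    · subst hij
      by_cases hik : i = k
      · subst hik
        left
        refine ⟨i, fun l w hw hwS => ?_⟩
        rw [hxyz] at hwS
        rcases hwS with rfl | rfl | rfl
        exacts [hW.eq_of_mem hw hx, hW.eq_of_mem hw hy, hW.eq_of_mem hw hz]
      · exact Or.inr (Or.inl (three i k x y z hx hy hz hik hxyz))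
    · by_cases hik : i = k
      · subst hik
        exact Or.inr (Or.inl (three i j x z y hx hz hy hij (by rw [hxyz, h2])))
      · by_cases hjk : j = k
        · subst hjk
          exact Or.inr (Or.inl (three j i y z x hy hz hx (Ne.symm hij) (by rw [hxyz, h1])))
        · refine Or.inr (Or.inr (Or.inr ⟨?_, ?_⟩))
          · intro l hl
            rw [hxyz] at hl
            rcases hl with h | h | h
            exacts [hnot hx h, hnot hy h, hnot hz h]
          · rintro l v ⟨hv, hvS⟩ w ⟨hw, hwS⟩
            rw [hxyz] at hvS hwS
            rcases hvS with rfl | rfl | rfl <;> rcases hwS with rfl | rfl | rfl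
            · rfl
            · exact absurd ((hW.eq_of_mem hx hv).trans (hW.eq_of_mem hw hy)) hij
            · exact absurd ((hW.eq_of_mem hx hv).trans (hW.eq_of_mem hw hz)) hik
            · exact absurd ((hW.eq_of_mem hx hw).trans (hW.eq_of_mem hv hy)) hij
            · rfl
            · exact absurd ((hW.eq_of_mem hy hv).trans (hW.eq_of_mem hw hz)) hjk
            · exact absurd ((hW.eq_of_mem hx hw).trans (hW.eq_of_mem hv hz)) hik
            · exact absurd ((hW.eq_of_mem hy hw).trans (hW.eq_of_mem hv hz)) hjk
            · rfl

/-- `S` cuts off only the petal `q a` from the center. -/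
def CutsOne (J : ZMod m → Set V) (q : ZMod m → V) (S : Set V) (a : ZMod m) : Prop :=
  (J (a - 1) = ∅ ∧ q (a - 1) ∈ S ∧ (J a ∩ S).Nonempty ∧
    (q (a + 1) ∈ S ∨ ¬ (J a ∩ S).Subsingleton)) ∨
  (J a = ∅ ∧ q (a + 1) ∈ S ∧ (J (a - 1) ∩ S).Nonempty ∧
    (q (a - 1) ∈ S ∨ ¬ (J (a - 1) ∩ S).Subsingleton))

/-- `S` cuts off the petals `q a` and `q (a + 1)` from the center. -/
structure CutsTwo (G : SimpleGraph V) (p : V) (q : ZMod m → V) (J : ZMod m → Set V) (S : Set V)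
    (a : ZMod m) : Prop where
  left_empty : J (a - 1) = ∅
  right_empty : J (a + 1) = ∅
  left_mem : q (a - 1) ∈ S
  right_mem : q (a + 2) ∈ S
  subsingleton : (J a ∩ S).Subsingleton
  exists_unique_neighbor :
    ∃ s ∈ J a, s ∈ S ∧ G.Adj p s ∧ ∀ y ∈ sector p q J a, G.Adj p y → y = s

/-- `S` is the neighbourhood of the center. -/
structure CutsAll (G : SimpleGraph V) (p : V) (q : ZMod m → V) (J : ZMod m → Set V) (S : Set V) :
    Prop where
  eq_neighborSet : S = G.neighborSet p
  subsingleton : ∀ k, (J k ∩ S).Subsingleton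
  exists_petal : ∃ c, ∀ j, q j ∈ S → j = c
  petals_notMem : ∀ k, (J k ∩ S).Nonempty → q k ∉ S ∧ q (k + 1) ∉ S

/-- Every petal of $C$ borders $J_d$, so it is $q_d$ or $q_{d+1}$. Going outward from such a petal,
the next interior avoids $S$, hence is empty, and the next petal must lie in $S$ since it cannot lie
in $C$. -/
theorem cuts_of_single (hS : S.ncard = 3) (hC : IsClosedOff G S C) (hp : p ∉ S) (hpC : p ∉ C)
    (hne : ∃ j, q j ∈ C) {d : ZMod m} (hd : ∀ k, ∀ y ∈ J k, y ∈ S → k = d) :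
    (∃ a, (∀ j, q j ∈ C ↔ j = a) ∧ CutsOne J q S a) ∨
    (∃ a, (∀ j, q j ∈ C ↔ j = a ∨ j = a + 1) ∧ CutsTwo G p q J S a) := by
  obtain ⟨n1, n2, n3⟩ := small_ne_zero hW.four_le
  have hP : ∀ j, q j ∈ C → j = d ∨ j = d + 1 := by
    intro j hj
    rcases hW.interior_meets hC hp hpC hj with ⟨y, hy, hyS⟩ | ⟨y, hy, hyS⟩
    · exact Or.inl (hd _ y hy hyS)
    · exact Or.inr (by linear_combination hd _ y hy hyS)
  have hclean : ∀ k, k ≠ d → ∀ y ∈ J k, y ∉ S := fun k hk y hy hyS => hk (hd k y hy hyS)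
  have hsub : ∀ k, k ≠ d → (J k ∩ S).Subsingleton :=
    fun k hk y hy => absurd hy.2 (hclean k hk y hy.1)
  have hJd : (J d ∩ S).Nonempty := by
    obtain ⟨j, hj⟩ := hne
    rcases hW.interior_meets hC hp hpC hj with ⟨y, hy, hyS⟩ | ⟨y, hy, hyS⟩
    · exact ⟨y, hd _ y hy hyS ▸ hy, hyS⟩
    · exact ⟨y, hd _ y hy hyS ▸ hy, hyS⟩
  have d1 : d - 1 ≠ d := fun h => n1 (by linear_combination -h)
  have d2 : d + 1 ≠ d := fun h => n1 (by linear_combination h)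
  have left : q d ∈ C → J (d - 1) = ∅ ∧ q (d - 1) ∈ S := by
    intro h
    have h' : q (d - 1 + 1) ∈ C := by rwa [sub_add_cancel]
    refine ⟨hW.interior_eq_empty hC hp hpC (hclean _ d1) (Or.inr h'), ?_⟩
    by_contra hcon
    rcases hP _ (hW.petal_mem_of_succ_mem hC (hsub _ d1) h' hcon) with e | e
    · exact d1 e
    · exact n2 (by linear_combination -e)
  have right : q (d + 1) ∈ C → J (d + 1) = ∅ ∧ q (d + 1 + 1) ∈ S := by
    intro h
    refine ⟨hW.interior_eq_empty hC hp hpC (hclean _ d2) (Or.inl h), ?_⟩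
    by_contra hcon
    rcases hP _ (hW.petal_succ_mem hC (hsub _ d2) h hcon) with e | e
    · exact n2 (by linear_combination e)
    · exact n1 (by linear_combination e)
  by_cases hd0 : q d ∈ C <;> by_cases hd1 : q (d + 1) ∈ C
  · right
    obtain ⟨l1, l2⟩ := left hd0
    obtain ⟨r1, r2⟩ := right hd1
    rw [add_assoc, one_add_one_eq_two] at r2
    -- The distinct petals $q_{d-1}$ and $q_{d+2}$ use up two of the three vertices of $S$.
    have hss : (J d ∩ S).Subsingleton := by
      rintro y ⟨hy, hyS⟩ z ⟨hz, hzS⟩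
      have e : ({y, q (d - 1), q (d + 2)} : Set V) = S := by
        refine Set.eq_of_subset_of_ncard_le ?_ ?_
        · rintro _ (rfl | rfl | rfl)
          exacts [hyS, l2, r2]
        · rw [hS, ← Set.ncard_eq_three.2
            ⟨y, q (d - 1), q (d + 2), ?_, ?_, ?_, rfl⟩]
          · exact fun h => hW.petal_notMem _ _ (h ▸ hy)
          · exact fun h => hW.petal_notMem _ _ (h ▸ hy)
          · exact fun h => n3 (by linear_combination -hW.inj h)
      rw [← e] at hzS
      rcases hzS with h | rfl | rfl
      exacts [h.symm, absurd hz (hW.petal_notMem _ _), absurd hz (hW.petal_notMem _ _)]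
    obtain ⟨s, hs, hsS⟩ := hJd
    refine ⟨d, fun j => ⟨hP j, ?_⟩, l1, r1, l2, r2, hss, s, hs, hsS,
      hW.unique_neighbor hC hp hpC hd0 hd1 hs hsS hss⟩
    rintro (rfl | rfl)
    exacts [hd0, hd1]
  · left
    obtain ⟨l1, l2⟩ := left hd0
    refine ⟨d, fun j => ⟨fun h => (hP j h).resolve_right fun e => hd1 (e ▸ h), ?_⟩,
      Or.inl ⟨l1, l2, hJd, ?_⟩⟩
    · rintro rfl
      exact hd0
    · by_contra! hcon
      exact hd1 (hW.petal_succ_mem hC hcon.2 hd0 hcon.1)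
  · left
    obtain ⟨r1, r2⟩ := right hd1
    refine ⟨d + 1, fun j => ⟨fun h => (hP j h).resolve_left fun e => hd0 (e ▸ h), ?_⟩,
      Or.inr ⟨r1, r2, ?_⟩⟩
    · rintro rfl
      exact hd1
    · rw [add_sub_cancel_right]
      refine ⟨hJd, ?_⟩
      by_contra! hcon
      exact hd0 (hW.petal_mem_of_succ_mem hC hcon.2 hd1 hcon.1)
  · obtain ⟨j, hj⟩ := hne
    rcases hP j hj with rfl | rfl
    exacts [absurd hj hd0, absurd hj hd1]

/-- Petals outside $S$ are in $C$, so not adjacent to $p$. In a sector whose interior meets $S$, the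
only neighbour of $p$ is that vertex of $S$; the other interiors are empty. So all neighbours of $p$
lie in $S$, and there are at least three of them. -/
theorem eq_neighborSet (hS : S.ncard = 3) (hC : IsClosedOff G S C) (hp : p ∉ S) (hpC : p ∉ C)
    (hsub : ∀ k, (J k ∩ S).Subsingleton) (hall : ∀ j, q j ∉ S → q j ∈ C)
    (hc : ∃ c, ∀ j, q j ∈ S → j = c)
    (hdirty : ∀ k, (J k ∩ S).Nonempty → q k ∉ S ∧ q (k + 1) ∉ S) : S = G.neighborSet p := by
  obtain ⟨n1, n2, n3⟩ := small_ne_zero hW.four_le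
  obtain ⟨c, hc⟩ := hc
  have hle : G.neighborSet p ⊆ S := by
    intro y hy
    rcases hW.cover y with rfl | ⟨j, rfl⟩ | ⟨k, hk⟩
    · exact absurd hy (G.loopless.irrefl _)
    · by_contra hcon
      exact hpC (hC.mem_of_adj _ (hall j hcon) p hp (SimpleGraph.Adj.symm hy))
    · by_cases hne : (J k ∩ S).Nonempty
      · obtain ⟨s, hs, hsS⟩ := hne
        obtain ⟨e1, e2⟩ := hdirty k ⟨s, hs, hsS⟩
        obtain ⟨-, h⟩ := hW.unique_neighbor hC hp hpC (hall _ e1) (hall _ e2) hs hsS (hsub k)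
        rw [h y (Or.inl hk) hy]
        exact hsS
      · have hclean : ∀ y ∈ J k, y ∉ S := fun y hy hyS => hne ⟨y, hy, hyS⟩
        have : q k ∈ C ∨ q (k + 1) ∈ C := by
          by_contra! hcon
          have e1 := hc k (by by_contra h; exact hcon.1 (hall _ h))
          have e2 := hc (k + 1) (by by_contra h; exact hcon.2 (hall _ h))
          exact n1 (by linear_combination e2 - e1)
        rw [hW.interior_eq_empty hC hp hpC hclean this] at hk
        exact absurd hk (Set.notMem_empty _)
  refine (Set.eq_of_subset_of_ncard_le hle ?_).symm
  rw [hS]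
  exact hW.three_le_ncard_neighborSet hW.triconnected

/-- The sets of three vertices cutting off petals from the center. -/
theorem cuts (hS : S.ncard = 3) (hC : IsClosedOff G S C) (hp : p ∉ S) (hpC : p ∉ C)
    (hne : ∃ j, q j ∈ C) :
    (∃ a, (∀ j, q j ∈ C ↔ j = a) ∧ CutsOne J q S a) ∨
    (∃ a, (∀ j, q j ∈ C ↔ j = a ∨ j = a + 1) ∧ CutsTwo G p q J S a) ∨
    (CutsAll G p q J S ∧ ∀ j, q j ∉ S → q j ∈ C) := by
  obtain ⟨n1, n2, n3⟩ := small_ne_zero hW.four_le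
  have hstep : ∀ j, (J j ∩ S).Subsingleton → q j ∉ S → q (j + 1) ∉ S →
      (q j ∈ C ↔ q (j + 1) ∈ C) := fun j h h1 h2 =>
    ⟨fun h' => hW.petal_succ_mem hC h h' h2, fun h' => hW.petal_mem_of_succ_mem hC h h' h1⟩
  rcases hW.distribution hS hp with ⟨d, hd⟩ | ⟨d, e, hde, hclean, hsub, hne', hq⟩ |
    ⟨c, d, e, hde, hcS, hc, hclean, hsub, hdne, hene⟩ | ⟨hq, hsub⟩
  · exact (hW.cuts_of_single hS hC hp hpC hne hd).imp_right Or.inl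
  -- Only sector $d$ can break a link, so all petals are in $C$. Each must border $J_d$ or $J_e$,
  -- which forces the excluded four-petal configuration.
  · exfalso
    obtain ⟨j0, hj0⟩ := hne
    have hall : ∀ j, q j ∈ C := by
      intro j
      refine (iff_of_steps_of_ne (X := fun j => q j ∈ C) hW.four_le d (fun k hk => ?_) j0 j).1 hj0
      refine hstep k ?_ (hq _) (hq _)
      rcases eq_or_ne k e with rfl | hke
      · exact hsub
      · exact fun y hy => absurd (hclean k y hy.1 hy.2) (not_or.2 ⟨hk, hke⟩)
    refine hW.false_of_opposite hC hp hpC hde hclean hsub hne' (fun j => ?_) fun j _ _ => hall j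
    rcases hW.interior_meets hC hp hpC (hall j) with ⟨y, hy, hyS⟩ | ⟨y, hy, hyS⟩
    · rcases hclean _ y hy hyS with h | h
      exacts [Or.inl h, Or.inr (Or.inr (Or.inl h))]
    · rcases hclean _ y hy hyS with h | h
      exacts [Or.inr (Or.inl (by linear_combination h)),
        Or.inr (Or.inr (Or.inr (by linear_combination h)))]
  -- One petal $q_c$ and two different interiors: no link is broken, and removing $q_c$ leaves a
  -- path, so all other petals are in $C$. If $q_c$ bordered $J_d$ or $J_e$, those two sectors would
  -- touch every petal.
  · right; right
    obtain ⟨j0, hj0⟩ := hne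
    have hj0c : j0 ≠ c := by
      rintro rfl
      exact hC.notMem _ hj0 hcS
    have hall : ∀ j, j ≠ c → q j ∈ C := by
      intro j hj
      exact (iff_of_steps_off_vertex (X := fun j => q j ∈ C) hW.four_le c (fun k hk hk' =>
        hstep k (hsub k) (fun h => hk (hc _ h)) fun h => hk' (hc _ h)) hj0c hj).1 hj0
    have hlist : ∀ j, j ≠ c → j = d ∨ j = d + 1 ∨ j = e ∨ j = e + 1 := by
      intro j hj
      rcases hW.interior_meets hC hp hpC (hall j hj) with ⟨y, hy, hyS⟩ | ⟨y, hy, hyS⟩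
      · rcases hclean _ y hy hyS with h | h
        exacts [Or.inl h, Or.inr (Or.inr (Or.inl h))]
      · rcases hclean _ y hy hyS with h | h
        exacts [Or.inr (Or.inl (by linear_combination h)),
          Or.inr (Or.inr (Or.inr (by linear_combination h)))]
    have hcd : ¬ (c = d ∨ c = d + 1) := by
      intro hcd
      refine hW.false_of_opposite hC hp hpC hde hclean (hsub e) hene (fun j => ?_)
        fun j h1 h2 => hall j ?_
      · rcases eq_or_ne j c with rfl | hj
        exacts [hcd.imp_right Or.inl, hlist j hj]
      · rintro rfl
        exact hcd.elim h1 h2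
    have hce : ¬ (c = e ∨ c = e + 1) := by
      intro hce
      refine hW.false_of_opposite hC hp hpC hde.symm (fun k y hy hyS => (hclean k y hy hyS).symm)
        (hsub d) hdne (fun j => ?_) fun j h1 h2 => hall j ?_
      · rcases eq_or_ne j c with rfl | hj
        · exact hce.imp_right Or.inl
        · have := hlist j hj
          tauto
      · rintro rfl
        exact hce.elim h1 h2
    have hall' : ∀ j, q j ∉ S → q j ∈ C := fun j hj => hall j fun h => hj (h ▸ hcS)
    suffices hdirty : ∀ k, (J k ∩ S).Nonempty → q k ∉ S ∧ q (k + 1) ∉ S from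
      ⟨⟨hW.eq_neighborSet hS hC hp hpC hsub hall' ⟨c, hc⟩ hdirty, hsub, ⟨c, hc⟩, hdirty⟩,
        hall'⟩
    rintro k ⟨y, hy, hyS⟩
    rcases hclean k y hy hyS with rfl | rfl
    · exact ⟨fun h => hcd (Or.inl (hc _ h).symm), fun h => hcd (Or.inr (hc _ h).symm)⟩
    · exact ⟨fun h => hce (Or.inl (hc _ h).symm), fun h => hce (Or.inr (hc _ h).symm)⟩
  · right; right
    obtain ⟨j0, hj0⟩ := hne
    have hall : ∀ j, q j ∉ S → q j ∈ C := fun j _ =>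
      (iff_of_steps_of_ne (X := fun j => q j ∈ C) hW.four_le 0 (fun k _ =>
        hstep k (hsub k) (hq _) (hq _)) j0 j).1 hj0
    have hc : ∃ c, ∀ j, q j ∈ S → j = c := ⟨0, fun j h => absurd h (hq j)⟩
    exact ⟨⟨hW.eq_neighborSet hS hC hp hpC hsub hall hc fun k _ => ⟨hq _, hq _⟩, hsub, hc,
      fun k _ => ⟨hq _, hq _⟩⟩, hall⟩

/-- The petals cut off from the center lie in a single component. -/
theorem exists_petal_mem_both (hS : S.ncard = 3) {D : Set V} (hC : IsClosedOff G S C)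
    (hD : IsClosedOff G S D) (hp : p ∉ S) (hpC : p ∉ C) (hpD : p ∉ D) (hneC : ∃ j, q j ∈ C)
    (hneD : ∃ j, q j ∈ D) : ∃ j, q j ∈ C ∧ q j ∈ D := by
  obtain ⟨j, hj⟩ := hneC
  obtain ⟨k, hk⟩ := hneD
  have hstep : ∀ {E : Set V}, IsClosedOff G S E → ∀ j, (J j ∩ S).Subsingleton → q j ∉ S →
      q (j + 1) ∉ S → (q j ∈ E ↔ q (j + 1) ∈ E) := fun hE j h h1 h2 =>
    ⟨fun h' => hW.petal_succ_mem hE h h' h2, fun h' => hW.petal_mem_of_succ_mem hE h h' h1⟩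
  have hjS := hC.notMem _ hj
  have hkS := hD.notMem _ hk
  -- In each outcome for the union, its petals are joined by unbroken links, so $C$ spreads to the
  -- petal of $D$.
  rcases hW.cuts hS (hC.union hD) hp (fun h => h.elim hpC hpD) ⟨j, Or.inl hj⟩ with
    ⟨a, hP, -⟩ | ⟨a, hP, h⟩ | ⟨h, -⟩
  · have e1 := (hP j).1 (Or.inl hj)
    have e2 := (hP k).1 (Or.inr hk)
    exact ⟨j, hj, by rwa [e1, ← e2]⟩
  · have e1 := (hP j).1 (Or.inl hj)
    have e2 := (hP k).1 (Or.inr hk)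
    have hs := hstep hC a h.subsingleton ((hC.union hD).notMem _ ((hP a).2 (Or.inl rfl)))
      ((hC.union hD).notMem _ ((hP (a + 1)).2 (Or.inr rfl)))
    refine ⟨k, ?_, hk⟩
    rcases e1 with rfl | rfl <;> rcases e2 with rfl | rfl
    exacts [hj, hs.1 hj, hs.2 hj, hj]
  · obtain ⟨c, hc⟩ := h.exists_petal
    refine ⟨k, ?_, hk⟩
    by_cases hcS : q c ∈ S
    · exact (iff_of_steps_off_vertex (X := fun j => q j ∈ C) hW.four_le c (fun l hl hl' =>
        hstep hC l (h.subsingleton l) (fun h => hl (hc _ h)) fun h => hl' (hc _ h))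
        (fun e : j = c => hjS (e ▸ hcS)) (fun e : k = c => hkS (e ▸ hcS))).1 hj
    · have hq : ∀ j, q j ∉ S := fun j hj => hcS (hc j hj ▸ hj)
      exact (iff_of_steps_of_ne (X := fun j => q j ∈ C) hW.four_le 0 (fun l _ =>
        hstep hC l (h.subsingleton l) (hq _) (hq _)) j k).1 hj

end IsTightWheel

end CutsOffCenter

/-! ### Inner sets, three-vertex sets through the center, and counting parts -/

section CutsThroughCenter

variable {V : Type*} [Finite V] {G : SimpleGraph V} {m : ℕ} {p : V} {q : ZMod m → V}
  {J : ZMod m → Set V} {S C : Set V}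

theorem eq_of_four_eq_zero (hm : 4 ≤ m) (h : (4 : ZMod m) = 0) (k j : ZMod m) :
    j = k - 1 ∨ j = k ∨ j = k + 1 ∨ j = k + 2 := by
  have h' : ((4 : ℕ) : ZMod m) = 0 := by exact_mod_cast h
  rw [ZMod.natCast_eq_zero_iff] at h'
  obtain rfl : m = 4 := le_antisymm (Nat.le_of_dvd (by omega) h') hm
  revert k j
  decide

namespace IsWheel

variable (hW : IsWheel G m p q J)

include hW

omit [Finite V] in
/-- The petals strictly between `q i` and `q j` and the interiors between them. -/
theorem isClosedOff_arc [NeZero m] (i j : ZMod m) :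
    IsClosedOff G (petalTriple p q i j)
      {x | ∃ k, (x = q k ∧ 0 < (k - i).val ∧ (k - i).val < (j - i).val) ∨
        (x ∈ J k ∧ (k - i).val < (j - i).val)} := by
  -- The value of $k-i$ is the forward distance from $i$ to $k$, which turns membership in the arc
  -- into inequalities between naturals.
  have hjm := ZMod.val_lt (j - i)
  have hsucc : ∀ k, (k - i).val < (j - i).val → (k + 1 - i).val = (k - i).val + 1 := by
    intro k hk
    rw [show k + 1 - i = (k - i) + 1 by ring, val_add_one_of_lt (by omega)]
  have hpred : ∀ k, 0 < (k - i).val → (k - i).val = (k - 1 - i).val + 1 := by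
    intro k hk
    have hlt := ZMod.val_lt (k - 1 - i)
    rcases Nat.lt_or_ge ((k - 1 - i).val + 1) m with h | h
    · rw [← val_add_one_of_lt h]
      congr 1; ring
    · exfalso
      have h0 : k - i = 0 := by
        have : ((k - 1 - i).val : ZMod m) = k - 1 - i := ZMod.natCast_zmod_val _
        have h2 : (((k - 1 - i).val + 1 : ℕ) : ZMod m) = 0 := by
          rw [show (k - 1 - i).val + 1 = m by omega, ZMod.natCast_self]
        push_cast at h2
        rw [this] at h2
        linear_combination h2
      rw [h0, ZMod.val_zero] at hk
      exact lt_irrefl _ hk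
  have hlt : ∀ k, k ≠ j → (k - i).val ≤ (j - i).val → (k - i).val < (j - i).val :=
    fun k hk h => lt_of_le_of_ne h fun e => hk (sub_left_injective (ZMod.val_injective m e))
  have hpos : ∀ k, k ≠ i → 0 < (k - i).val := fun k hk => Nat.pos_of_ne_zero fun e =>
    hk (sub_eq_zero.1 ((ZMod.val_eq_zero _).1 e))
  refine ⟨?_, ?_⟩
  · rintro x ⟨k, ⟨rfl, h0, h1⟩ | ⟨hx, -⟩⟩
    · rw [hW.petal_mem_petalTriple]
      rintro (rfl | rfl)
      · simp at h0
      · exact lt_irrefl _ h1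
    · exact hW.interior_notMem_petalTriple hx
  · rintro x ⟨k, ⟨rfl, h0, h1⟩ | ⟨hx, h1⟩⟩ y hy hxy
    · rcases hW.adj_petal hxy with (h | h | rfl) | h | h | rfl
      · exact ⟨k, Or.inr ⟨h, h1⟩⟩
      · exact absurd (Or.inl h) hy
      · rw [hW.petal_mem_petalTriple, not_or] at hy
        have e := hsucc k h1
        exact ⟨k + 1, Or.inl ⟨rfl, by omega, hlt _ hy.2 (by omega)⟩⟩
      · have e := hpred k h0
        exact ⟨k - 1, Or.inr ⟨h, by omega⟩⟩
      · exact absurd (Or.inl h) hy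
      · rw [hW.petal_mem_petalTriple, not_or] at hy
        have e := hpred k h0
        exact ⟨k - 1, Or.inl ⟨rfl, hpos _ hy.1, by omega⟩⟩
    · rcases hW.adj_interior hx hxy with h | h | rfl | rfl
      · exact ⟨k, Or.inr ⟨h, h1⟩⟩
      · exact absurd (Or.inl h) hy
      · rw [hW.petal_mem_petalTriple, not_or] at hy
        exact ⟨k, Or.inl ⟨rfl, hpos _ hy.1, h1⟩⟩
      · rw [hW.petal_mem_petalTriple, not_or] at hy
        have e := hsucc k h1
        exact ⟨k + 1, Or.inl ⟨rfl, by omega, hlt _ hy.2 (by omega)⟩⟩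

omit [Finite V] in
theorem not_sameComponent_inner {i j : ZMod m} (h0 : i ≠ j) (h1 : j ≠ i + 1) :
    ¬ SameComponent G (petalTriple p q i j) (q (i + 1)) (q (i - 1)) := by
  have hm := hW.four_le
  have : NeZero m := ⟨by omega⟩
  have : Fact (1 < m) := ⟨by omega⟩
  intro h
  have hv1 : (i + 1 - i).val = 1 := by rw [add_sub_cancel_left, ZMod.val_one]
  have hj0 : (j - i).val ≠ 0 := fun e => h0 (sub_eq_zero.1 ((ZMod.val_eq_zero _).1 e)).symm
  have hj1 : (j - i).val ≠ 1 := fun e => h1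
    (sub_left_injective (ZMod.val_injective m (e.trans hv1.symm)))
  obtain ⟨k, ⟨e, h2, h3⟩ | ⟨e, -⟩⟩ := (hW.isClosedOff_arc i j).mem_of_sameComponent
    ⟨i + 1, Or.inl ⟨rfl, by omega, by omega⟩⟩ h
  · obtain rfl := hW.inj e
    have := ZMod.val_lt (j - i)
    have e := val_add_one_of_lt (x := i - 1 - i) (by omega)
    rw [show i - 1 - i + 1 = 0 by ring, ZMod.val_zero] at e
    omega
  · exact hW.petal_notMem _ _ e

/-- There is no third component: by triconnectivity it would contain a neighbour of $q_i$, but each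
neighbour of $q_i$ outside the triple is joined to $q_{i+1}$ or $q_{i-1}$ without meeting the
triple. -/
theorem inner_cut (hG : IsTriconnected G) {i j : ZMod m} (h0 : i ≠ j) (h1 : j ≠ i + 1)
    (h2 : i ≠ j + 1) : petalTriple p q i j ∈ threeCutsets G ∧
      (parts G {petalTriple p q i j}).ncard = 2 ∧ q (i + 1) ∉ petalTriple p q i j ∧
      q (i - 1) ∉ petalTriple p q i j := by
  obtain ⟨n1, n2, n3⟩ := small_ne_zero hW.four_le
  have hS := hW.ncard_petalTriple h0
  have m1 : q (i + 1) ∉ petalTriple p q i j := by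
    rw [hW.petal_mem_petalTriple, not_or]
    exact ⟨fun h => n1 (by linear_combination h), fun h => h1 h.symm⟩
  have m2 : q (i - 1) ∉ petalTriple p q i j := by
    rw [hW.petal_mem_petalTriple, not_or]
    exact ⟨fun h => n1 (by linear_combination -h), fun h => h2 (by linear_combination h)⟩
  have hns := hW.not_sameComponent_inner h0 h1
  refine ⟨⟨hS, isCutset_iff.2 ⟨_, m1, _, m2, hns⟩⟩,
    ncard_parts_singleton m1 m2 hns fun z hz => ?_, m1, m2⟩
  by_contra! hcon
  have hcl : IsClosedOff G (petalTriple p q i j) {y | SameComponent G (petalTriple p q i j) z y} :=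
    isClosedOff_component
  obtain ⟨x, hx, hxi⟩ := hG.exists_adj hS.le hcl ⟨z, .refl hz⟩ (fun h => hcon.1 h.symm) m1
    (Or.inr (Or.inl rfl) : q i ∈ petalTriple p q i j)
  have hxS := hcl.notMem x hx
  rcases hW.adj_petal hxi.symm with (h | h | rfl) | h | h | rfl
  · exact hcon.1 (SameComponent.symm (hx.trans (hW.sameComponent_of_mem_interior hG h
      (fun _ h => hW.interior_notMem_petalTriple h) (Or.inr (Or.inr rfl)) m1)))
  · exact hxS (Or.inl h)
  · exact hcon.1 hx.symm
  · exact hcon.2 (SameComponent.symm (hx.trans (hW.sameComponent_of_mem_interior hG h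
      (fun _ h => hW.interior_notMem_petalTriple h) (Or.inr (Or.inl rfl)) m2)))
  · exact hxS (Or.inl h)
  · exact hcon.2 hx.symm

end IsWheel

namespace IsTightWheel

variable (hW : IsTightWheel G m p q J)

include hW

/-- A three-vertex set through the center that is not inner keeps all petals together. -/
theorem sameComponent_petals (hS : S.ncard = 3) (hp : p ∈ S) (hinner : S ∉ innerTriples p q)
    {i j : ZMod m} (hi : q i ∉ S) (hj : q j ∉ S) : SameComponent G S (q i) (q j) := by
  have hstep : ∀ k, (J k ∩ S).Subsingleton → q k ∉ S → q (k + 1) ∉ S →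
      (SameComponent G S (q i) (q k) ↔ SameComponent G S (q i) (q (k + 1))) := fun k h h1 h2 =>
    ⟨fun h' => h'.trans (hW.sameComponent_petal_succ h h1 h2),
      fun h' => h'.trans (hW.sameComponent_petal_succ h h1 h2).symm⟩
  have hdiff : (S \ {p}).ncard = 2 := by
    rw [Set.ncard_sdiff_singleton_of_mem hp, hS]
  obtain ⟨s, t, hst, hSp⟩ := Set.ncard_eq_two.1 hdiff
  have hmem : ∀ x ∈ S, x = p ∨ x = s ∨ x = t := by
    intro x hx
    by_cases hxp : x = p
    · exact Or.inl hxp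
    · have : x ∈ S \ {p} := ⟨hx, hxp⟩
      rw [hSp] at this
      exact Or.inr this
  have hs : s ∈ S \ {p} := hSp ▸ Or.inl rfl
  have ht : t ∈ S \ {p} := hSp ▸ Or.inr rfl
  have one : ∀ c d s, s ∈ J d → (∀ x ∈ S, x = p ∨ x = s ∨ x = q c) → q c ∈ S →
      SameComponent G S (q i) (q j) := by
    intro c d s hs hmem hc
    have hq : ∀ k, q k ∈ S → k = c := by
      intro k hk
      rcases hmem _ hk with h | h | h
      exacts [absurd h (hW.ne_center _), absurd hs (h ▸ hW.petal_notMem _ _), hW.inj h]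
    refine (iff_of_steps_off_vertex (X := fun k => SameComponent G S (q i) (q k)) hW.four_le c
      (fun k hk hk' => hstep k ?_ (fun h => hk (hq _ h)) fun h => hk' (hq _ h))
      (fun e : i = c => hi (e ▸ hc)) (fun e : j = c => hj (e ▸ hc))).1 (.refl hi)
    have : ∀ x ∈ J k ∩ S, x = s := by
      rintro x ⟨hx, hxS⟩
      rcases hmem x hxS with rfl | h | rfl
      exacts [absurd hx (hW.center_notMem _), h, absurd hx (hW.petal_notMem _ _)]
    exact fun x hx y hy => (this x hx).trans (this y hy).symm
  -- Besides $p$, two vertices of $S$ remain. Two petals must be consecutive, as $S$ is not inner,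
  -- and the other petals form a path; a petal and an interior vertex leave a path with all links
  -- intact; two interior vertices can break at most one link of the cycle.
  rcases (hW.cover s).resolve_left hs.2 with ⟨a, rfl⟩ | ⟨d, hd⟩ <;>
    rcases (hW.cover t).resolve_left ht.2 with ⟨b, rfl⟩ | ⟨e, he⟩
  · have hab : a ≠ b := fun h => hst (h ▸ rfl)
    have pair : ∀ a b, b = a + 1 → (∀ x ∈ S, x = p ∨ x = q a ∨ x = q b) → q a ∈ S → q b ∈ S →
        SameComponent G S (q i) (q j) := by
      rintro a _ rfl hmem ha hb
      have hq : ∀ k, q k ∈ S → k = a ∨ k = a + 1 := fun k hk =>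
        (hmem _ hk).elim (fun h => absurd h (hW.ne_center _)) (Or.imp (fun h => hW.inj h)
          fun h => hW.inj h)
      refine (iff_of_steps_off_pair (X := fun k => SameComponent G S (q i) (q k)) hW.four_le a
        (fun k h1 h2 h3 => hstep k ?_ (fun h => (hq _ h).elim h1 h2) fun h => (hq _ h).elim h3
        fun h => h1 (add_right_cancel h)) (fun e : i = a => hi (e ▸ ha))
        (fun e : i = a + 1 => hi (e ▸ hb)) (fun e : j = a => hj (e ▸ ha))
        (fun e : j = a + 1 => hj (e ▸ hb))).1 (.refl hi)
      rintro x ⟨hx, hxS⟩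
      rcases hmem x hxS with rfl | rfl | rfl
      exacts [absurd hx (hW.center_notMem _), absurd hx (hW.petal_notMem _ _),
        absurd hx (hW.petal_notMem _ _)]
    by_cases h1 : b = a + 1
    · exact pair a b h1 hmem hs.1 ht.1
    · by_cases h2 : a = b + 1
      · exact pair b a h2 (fun x hx => (hmem x hx).imp_right Or.symm) ht.1 hs.1
      · exact absurd ⟨a, b, hab, h1, h2, eq_of_subset_triple hS hmem⟩ hinner
  · exact one a e t he (fun x hx => (hmem x hx).imp_right Or.symm) hs.1
  · exact one b d s hd hmem ht.1
  · have hq : ∀ k, q k ∉ S := by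
      intro k hk
      rcases hmem _ hk with h | h | h
      exacts [hW.ne_center _ h, hW.petal_notMem _ _ (h ▸ hd), hW.petal_notMem _ _ (h ▸ he)]
    refine (iff_of_steps_of_ne (X := fun k => SameComponent G S (q i) (q k)) hW.four_le d
      (fun k hk => hstep k ?_ (hq _) (hq _)) i j).1 (.refl hi)
    have : ∀ x ∈ J k ∩ S, x = t := by
      rintro x ⟨hx, hxS⟩
      rcases hmem x hxS with rfl | rfl | h
      exacts [absurd hx (hW.center_notMem _), absurd (hW.eq_of_mem hx hd) hk, h]
    exact fun x hx y hy => (this x hx).trans (this y hy).symm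

theorem mem_interior_of_forall_petal_notMem {E : Set V} (hS : S.ncard = 3)
    (hE : IsClosedOff G S E) (hq : ∀ j, q j ∉ E) (hp : p ∉ E) {x : V} (hx : x ∈ E) :
    ∃ k, x ∈ J k ∧ S ⊆ sector p q J k ∧ ∀ s ∈ S, ∃ y ∈ E ∩ J k, G.Adj y s := by
  rcases hW.cover x with rfl | ⟨j, rfl⟩ | ⟨k, hk⟩
  · exact absurd hx hp
  · exact absurd hx (hq j)
  · exact ⟨k, hk, hW.subset_sector_of_forall_petal_notMem hW.triconnected hS hE hq hp hx hk⟩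

/-- The petals outside $S$ share a component, so any other component lies in one interior. By
triconnectivity it contains a neighbour of $p$, which later identifies it through $u$. -/
theorem sameComponent_petal_or (hS : S.ncard = 3) (hp : p ∈ S) (hinner : S ∉ innerTriples p q)
    {j : ZMod m} (hj : q j ∉ S) {x : V} (hx : x ∉ S) : SameComponent G S (q j) x ∨
      ∃ k, x ∈ J k ∧ S ⊆ sector p q J k ∧ ∃ y ∈ J k, SameComponent G S x y ∧ G.Adj p y := by
  refine or_iff_not_imp_left.2 fun h => ?_
  have hcl : IsClosedOff G S {y | SameComponent G S x y} := isClosedOff_component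
  obtain ⟨k, hk, hsub, hadj⟩ := hW.mem_interior_of_forall_petal_notMem hS hcl
    (fun l hl => h ((hW.sameComponent_petals hS hp hinner hj (hcl.notMem _ hl)).trans
      (SameComponent.symm hl))) (fun h => hcl.notMem _ h hp) (SameComponent.refl hx)
  obtain ⟨y, hy, hyp⟩ := hadj p hp
  exact ⟨k, hk, hsub, y, hy.2, hy.1, hyp.symm⟩

/-- A three-vertex set that avoids the center, is contained in no sector and cuts off a petal from
the center splits the graph into two parts. -/
theorem two_parts_of_petal (hS : S.ncard = 3) (hp : p ∉ S) {j : ZMod m} (hj : q j ∉ S)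
    (hpj : ¬ SameComponent G S p (q j)) (hsec : ∀ k, ¬ S ⊆ sector p q J k) :
    S ∈ threeCutsets G ∧ (parts G {S}).ncard = 2 := by
  refine ⟨⟨hS, isCutset_iff.2 ⟨p, hp, q j, hj, hpj⟩⟩,
    ncard_parts_singleton hp hj hpj fun z hz => or_iff_not_imp_left.2 fun h => ?_⟩
  have hcl : ∀ z, IsClosedOff G S {y | SameComponent G S z y} := fun z => isClosedOff_component
  -- A component with neither petals nor $p$ would force $S$ into one sector. So it contains a
  -- petal, and thus shares one with the component of $q_j$.
  have hpet : ∃ l, q l ∈ {y | SameComponent G S z y} := by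
    by_contra! hcon
    obtain ⟨k, -, hk, -⟩ := hW.mem_interior_of_forall_petal_notMem hS (hcl z) hcon
      (fun h' => h (SameComponent.symm h')) (SameComponent.refl hz)
    exact hsec k hk
  obtain ⟨l, h1, h2⟩ := hW.exists_petal_mem_both hS (hcl z) (hcl (q j)) hp
    (fun h' => h (SameComponent.symm h')) (fun h' => hpj (SameComponent.symm h')) hpet
    ⟨j, .refl hj⟩
  exact SameComponent.trans h2 (SameComponent.symm h1)

end IsTightWheel

end CutsThroughCenter

/-! ### The neighborhood of the flower and the statements of the lemma -/

section Neighborhood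

variable {V : Type*} {G : SimpleGraph V}

namespace Flower

variable (F : Flower G)

theorem mem_nbhd {x : V} :
    x ∈ F.nbhd ↔ x = F.center ∨ (∃ i, x = F.petal i) ∨ ∃ i, x = F.u i := by
  simp only [nbhd, vertexSet, Set.mem_union, Set.mem_insert_iff, Set.mem_range, or_assoc, eq_comm]

theorem center_mem_nbhd : F.center ∈ F.nbhd := F.mem_nbhd.2 (Or.inl rfl)

theorem petal_mem_nbhd (i : ZMod F.m) : F.petal i ∈ F.nbhd :=
  F.mem_nbhd.2 (Or.inr (Or.inl ⟨i, rfl⟩))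

theorem u_mem_nbhd (i : ZMod F.m) : F.u i ∈ F.nbhd := F.mem_nbhd.2 (Or.inr (Or.inr ⟨i, rfl⟩))

variable [Finite V] {F}

/-- The point is that $u$ is never a petal: were the interior empty, its two neighbouring interiors
would be empty as well, and both petals of the sector would be neighbours of $p$. -/
theorem u_eq_center_or (hG : IsTriconnected G) (i : ZMod F.m) : F.u i = F.center ∨
    (F.u i ∈ F.inter i ∧ G.Adj F.center (F.u i) ∧
      ∀ y ∈ sector F.center F.petal F.inter i, G.Adj F.center y → y = F.u i) := by
  by_cases h : (∃! x, x ∈ F.part i ∧ G.Adj F.center x) ∧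
      ((F.IsSingular ∧ (F.inter i).Nonempty) ∨
        (¬ F.IsSingular ∧ F.inter (i - 1) = ∅ ∧ F.inter (i + 1) = ∅))
  · have hu : F.u i = h.1.choose := dif_pos h
    have hspec := h.1.choose_spec
    rw [← hu] at hspec
    obtain ⟨⟨h1, h2⟩, h3⟩ := hspec
    rw [F.part_eq_sector] at h1
    have huniq : ∀ y ∈ sector F.center F.petal F.inter i, G.Adj F.center y → y = F.u i :=
      fun y hy hpy => h3 y ⟨by rwa [F.part_eq_sector], hpy⟩
    refine Or.inr ⟨?_, h2, huniq⟩
    rcases (F.inter i).eq_empty_or_nonempty with he | hne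
    · obtain ⟨-, hl, hr⟩ := h.2.resolve_left fun h => h.2.ne_empty he
      have hW := F.isWheel
      have e1 := huniq _ (hW.petal_mem_sector.2 (Or.inl rfl)) (hW.adj_center_petal hG he hl).symm
      have e2 := huniq _ (hW.petal_mem_sector.2 (Or.inr rfl))
        (hW.adj_center_petal hG hr (by rwa [add_sub_cancel_right])).symm
      have := hW.inj (e1.trans e2.symm)
      exact absurd (by linear_combination -this) (small_ne_zero hW.four_le).1
    · obtain ⟨x, hx, hpx⟩ := F.isWheel.exists_adj_center hG hne
      rwa [← huniq x (Or.inl hx) hpx]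
  · exact Or.inl (dif_neg h)

omit [Finite V] in
theorem u_eq_of_unique {i : ZMod F.m} {s : V} (hs : s ∈ F.inter i) (hps : G.Adj F.center s)
    (huniq : ∀ y ∈ sector F.center F.petal F.inter i, G.Adj F.center y → y = s)
    (h : F.IsSingular ∨ F.inter (i - 1) = ∅ ∧ F.inter (i + 1) = ∅) : F.u i = s := by
  have hex : ∃! x, x ∈ F.part i ∧ G.Adj F.center x := by
    rw [F.part_eq_sector]
    exact ⟨s, ⟨Or.inl hs, hps⟩, fun y hy => huniq y hy.1 hy.2⟩
  have h' : (F.IsSingular ∧ (F.inter i).Nonempty) ∨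
      (¬ F.IsSingular ∧ F.inter (i - 1) = ∅ ∧ F.inter (i + 1) = ∅) := by
    by_cases hsing : F.IsSingular
    · exact Or.inl ⟨hsing, s, hs⟩
    · exact Or.inr ⟨hsing, h.resolve_left hsing⟩
  have hu : F.u i = hex.choose := dif_pos ⟨hex, h'⟩
  rw [hu]
  exact huniq _ (F.part_eq_sector i ▸ hex.choose_spec.1.1) hex.choose_spec.1.2

omit [Finite V] in
theorem contains_M'_iff {i : ZMod F.m} {T : Set V} :
    (F.M' i).Contains (VertexEdgeSet.ofVerts T) ↔ (F.center ∈ T ∨ F.u i ∈ T) ∧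
      (F.petal i ∈ T ∨ F.inter (i - 1) = ∅ ∧ F.petal (i - 1) ∈ T) ∧
      (F.petal (i + 1) ∈ T ∨ F.inter (i + 1) = ∅ ∧ F.petal (i + 2) ∈ T) := by
  have hne := F.petal_ne_center
  have hedge : ∀ a b : V, (s(a, b) ∈ (VertexEdgeSet.ofVerts T).edges ∨
      ∃ v ∈ (VertexEdgeSet.ofVerts T).verts, v ∈ s(a, b)) ↔ a ∈ T ∨ b ∈ T := by
    intro a b
    simp only [VertexEdgeSet.ofVerts, Set.mem_empty_iff_false, false_or, Sym2.mem_iff]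
    constructor
    · rintro ⟨v, hv, rfl | rfl⟩
      exacts [Or.inl hv, Or.inr hv]
    · rintro (h | h)
      exacts [⟨a, h, Or.inl rfl⟩, ⟨b, h, Or.inr rfl⟩]
  constructor
  · rintro ⟨hv, he⟩
    refine ⟨?_, ?_, ?_⟩
    · by_cases hu : F.u i = F.center
      · rw [M', if_pos hu] at hv
        exact Or.inl (hv (Or.inl rfl))
      · rw [M', if_neg hu] at he
        exact (hedge _ _).1 (he _ (Or.inl rfl))
    · by_cases h : F.inter (i - 1) = ∅
      · have hmem : s(F.petal (i - 1), F.petal i) ∈ (F.M' i).edges := by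
          rw [M']; split_ifs
          · exact Or.inl ⟨rfl, h⟩
          · exact Or.inr (Or.inl ⟨rfl, h⟩)
        rcases (hedge _ _).1 (he _ hmem) with h' | h'
        exacts [Or.inr ⟨h, h'⟩, Or.inl h']
      · refine Or.inl (hv ?_)
        rw [M']; split_ifs
        · exact Or.inr (Or.inl ⟨rfl, h⟩)
        · exact ⟨Or.inr (Or.inl ⟨rfl, h⟩), hne _⟩
    · by_cases h : F.inter (i + 1) = ∅
      · have hmem : s(F.petal (i + 1), F.petal (i + 2)) ∈ (F.M' i).edges := by
          rw [M']; split_ifs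
          · exact Or.inr ⟨rfl, h⟩
          · exact Or.inr (Or.inr ⟨rfl, h⟩)
        rcases (hedge _ _).1 (he _ hmem) with h' | h'
        exacts [Or.inl h', Or.inr ⟨h, h'⟩]
      · refine Or.inl (hv ?_)
        rw [M']; split_ifs
        · exact Or.inr (Or.inr ⟨rfl, h⟩)
        · exact ⟨Or.inr (Or.inr ⟨rfl, h⟩), hne _⟩
  · rintro ⟨h1, h2, h3⟩
    have hverts : ∀ v ∈ (F.M i).verts, v ≠ F.center → v ∈ T := by
      rintro v (rfl | ⟨rfl, h⟩ | ⟨rfl, h⟩) hv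
      exacts [absurd rfl hv, h2.resolve_right fun h' => h h'.1, h3.resolve_right fun h' => h h'.1]
    have hedges : ∀ e ∈ (F.M i).edges, e ∈ (VertexEdgeSet.ofVerts T).edges ∨
        ∃ v ∈ (VertexEdgeSet.ofVerts T).verts, v ∈ e := by
      rintro e (⟨rfl, -⟩ | ⟨rfl, -⟩)
      · exact (hedge _ _).2 (h2.symm.imp_left And.right)
      · exact (hedge _ _).2 (h3.imp_right And.right)
    by_cases hu : F.u i = F.center
    · rw [M', if_pos hu]
      refine ⟨fun v hv => ?_, hedges⟩
      by_cases hvc : v = F.center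
      · rw [hu, or_self] at h1
        exact hvc ▸ h1
      · exact hverts v hv hvc
    · rw [M', if_neg hu]
      refine ⟨fun v hv => hverts v hv.1 hv.2, ?_⟩
      rintro e (rfl | he)
      · exact (hedge _ _).2 h1
      · exact hedges e he

/-- The case distinction defining $G'_{i,i+1}$ concerns only $p$, which lies in no interior. The
boundary petals always belong to $M'_{i,i+1}$ as vertices or ends, so only $u$ is removed from the
interior. -/
theorem inter'_eq (i : ZMod F.m) : F.inter' i = F.inter i \ {F.u i} := by
  have hW := F.isWheel
  have hsub : F.part' i ⊆ sector F.center F.petal F.inter i := by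
    rw [part', F.part_eq_sector]
    split_ifs
    · exact Set.sdiff_subset
    · exact subset_rfl
  have hsup : F.inter i ⊆ F.part' i := by
    intro x hx
    have hxc : x ≠ F.center := fun h => hW.center_notMem _ (h ▸ hx)
    rw [part', F.part_eq_sector]
    split_ifs
    · exact ⟨Or.inl hx, hxc⟩
    · exact Or.inl hx
  have hMsub : (F.M i).vertexSet ⊆ F.vertexSet := by
    rintro v ((rfl | ⟨rfl, -⟩ | ⟨rfl, -⟩) | ⟨e, ⟨rfl, -⟩ | ⟨rfl, -⟩, hv⟩)
    · exact Or.inl rfl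
    · exact Or.inr ⟨_, rfl⟩
    · exact Or.inr ⟨_, rfl⟩
    · rcases Sym2.mem_iff.1 hv with rfl | rfl
      exacts [Or.inr ⟨_, rfl⟩, Or.inr ⟨_, rfl⟩]
    · rcases Sym2.mem_iff.1 hv with rfl | rfl
      exacts [Or.inr ⟨_, rfl⟩, Or.inr ⟨_, rfl⟩]
  have hl : F.petal i ∈ (F.M i).vertexSet := by
    by_cases h : F.inter (i - 1) = ∅
    · exact Or.inr ⟨_, Or.inl ⟨rfl, h⟩, Sym2.mem_mk_right _ _⟩
    · exact Or.inl (Or.inr (Or.inl ⟨rfl, h⟩))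
  have hr : F.petal (i + 1) ∈ (F.M i).vertexSet := by
    by_cases h : F.inter (i + 1) = ∅
    · exact Or.inr ⟨_, Or.inr ⟨rfl, h⟩, Sym2.mem_mk_left _ _⟩
    · exact Or.inl (Or.inr (Or.inr ⟨rfl, h⟩))
  have hM' : ∀ v, v ∈ (F.M' i).vertexSet ↔ v ∈ (F.M i).vertexSet ∨ v = F.u i := by
    intro v
    have hc : F.center ∈ (F.M i).vertexSet := Or.inl (Or.inl rfl)
    by_cases hu : F.u i = F.center
    · rw [M', if_pos hu, hu]
      exact ⟨Or.inl, fun h => h.elim id fun h => h ▸ hc⟩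
    · rw [M', if_neg hu]
      constructor
      · rintro (h | ⟨e, rfl | he, hv⟩)
        · exact Or.inl (Or.inl h.1)
        · rcases Sym2.mem_iff.1 hv with rfl | rfl
          exacts [Or.inl hc, Or.inr rfl]
        · exact Or.inl (Or.inr ⟨e, he, hv⟩)
      · rintro ((h | ⟨e, he, hv⟩) | rfl)
        · by_cases hvc : v = F.center
          · exact Or.inr ⟨_, Or.inl rfl, hvc ▸ Sym2.mem_mk_left _ _⟩
          · exact Or.inl ⟨h, hvc⟩
        · exact Or.inr ⟨e, Or.inr he, hv⟩
        · exact Or.inr ⟨_, Or.inl rfl, Sym2.mem_mk_right _ _⟩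
  ext x
  constructor
  · rintro ⟨hx, hxM⟩
    rw [hM', not_or] at hxM
    refine ⟨?_, hxM.2⟩
    rcases mem_sector.1 (hsub hx) with h | rfl | rfl | rfl
    exacts [h, absurd (Or.inl (Or.inl rfl)) hxM.1, absurd hl hxM.1, absurd hr hxM.1]
  · rintro ⟨hx, hxu⟩
    refine ⟨hsup hx, ?_⟩
    rw [hM', not_or]
    refine ⟨fun h => ?_, hxu⟩
    rcases hMsub h with rfl | ⟨j, rfl⟩
    exacts [hW.center_notMem _ hx, hW.petal_notMem _ _ hx]

/-- A vertex of the neighbourhood lying in an interior is the vertex `u` of that sector. -/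
theorem eq_u_of_mem_nbhd (hG : IsTriconnected G) {x : V} (hx : x ∈ F.nbhd) {k : ZMod F.m}
    (hk : x ∈ F.inter k) : x = F.u k := by
  have hW := F.isWheel
  rcases F.mem_nbhd.1 hx with rfl | ⟨j, rfl⟩ | ⟨j, rfl⟩
  · exact absurd hk (hW.center_notMem _)
  · exact absurd hk (hW.petal_notMem _ _)
  · rcases u_eq_center_or hG j with h | ⟨h, -⟩
    · exact absurd (h ▸ hk) (hW.center_notMem _)
    · rw [hW.eq_of_mem h hk]

theorem mem_nbhd_cases (hG : IsTriconnected G) {x : V} (hx : x ∈ F.nbhd) :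
    x = F.center ∨ (∃ i, x = F.petal i) ∨ ∃ i, x = F.u i ∧ x ∈ F.inter i ∧ G.Adj F.center x := by
  rcases F.mem_nbhd.1 hx with h | h | ⟨i, rfl⟩
  · exact Or.inl h
  · exact Or.inr (Or.inl h)
  · rcases u_eq_center_or hG i with h | ⟨h1, h2, -⟩
    · exact Or.inl h
    · exact Or.inr (Or.inr ⟨i, rfl, h1, h2⟩)

/-- Each vertex $u\ne p$ is adjacent to $p$, so a set avoiding $p$ can separate only petals of
$\mathrm{Nb}(F)$ from it. -/
theorem sameComponent_or_petal (hG : IsTriconnected G) {S : Set V} (hp : F.center ∉ S) {x : V}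
    (hx : x ∈ F.nbhd) (hxS : x ∉ S) : SameComponent G S F.center x ∨ ∃ j, x = F.petal j := by
  rcases mem_nbhd_cases hG hx with rfl | h | ⟨i, -, -, h⟩
  exacts [Or.inl (.refl hp), Or.inr h, Or.inl (.of_adj hp hxS h)]

omit [Finite V] in
/-- A cutset leaves some vertex outside the component of the center. -/
theorem exists_not_sameComponent_center {S : Set V} (h : IsCutset G S) :
    ∃ x, x ∉ S ∧ ¬ SameComponent G S F.center x := by
  obtain ⟨x, hx, y, hy, hxy⟩ := isCutset_iff.1 h
  by_contra! hcon
  exact hxy ((hcon x hx).symm.trans (hcon y hy))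

theorem petalTriple_succ_notMem_innerSets (i : ZMod F.m) :
    petalTriple F.center F.petal i (i + 1) ∉ innerTriples F.center F.petal := by
  have hW := F.isWheel
  rintro ⟨a, b, h0, h1, h2, h⟩
  have ha : F.petal a ∈ petalTriple F.center F.petal i (i + 1) := h ▸ Or.inr (Or.inl rfl)
  have hb : F.petal b ∈ petalTriple F.center F.petal i (i + 1) := h ▸ Or.inr (Or.inr rfl)
  rw [hW.petal_mem_petalTriple] at ha hb
  rcases ha with rfl | rfl <;> rcases hb with rfl | rfl
  exacts [h0 rfl, h1 rfl, h2 rfl, h0 rfl]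

omit [Finite V] in
theorem Q'_eq_of_u_eq {i : ZMod F.m} (h : F.u i = F.center) :
    F.Q' i = petalTriple F.center F.petal i (i + 1) := by
  rw [Q', h, petalTriple, Set.insert_comm]

omit [Finite V] in
theorem isSingular_of_cutsAll {S : Set V} (hS : S.ncard = 3)
    (h : IsTightWheel.CutsAll G F.center F.petal F.inter S) : F.IsSingular ∧ S = F.centerNbhd :=
  ⟨by rw [IsSingular, centerNbhd, ← h.eq_neighborSet, hS], h.eq_neighborSet⟩

/-- The `3`-cutsets inside the neighbourhood. -/
theorem listed_of_subset_nbhd (hG : IsTriconnected G) (hmax : F.IsMaximal)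
    (hnd : F.IsNondegenerate) {T : Set V} (hT : T ∈ threeCutsets G) (hsub : T ⊆ F.nbhd) :
    T ∈ F.innerSets ∨ (∃ i, (F.M' i).Contains (VertexEdgeSet.ofVerts T)) ∨
      (F.IsSingular ∧ T = F.centerNbhd) := by
  have hW := F.isTightWheel hG hmax hnd
  obtain ⟨hT3, hcut⟩ := hT
  by_cases hp : F.center ∈ T
  · refine or_iff_not_imp_left.2 fun hinner => Or.inl ?_
    obtain ⟨j, hj⟩ := hW.exists_petal_notMem hT3.le
    have hex : ∃ x, x ∉ T ∧ ¬ SameComponent G T (F.petal j) x := by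
      obtain ⟨x, hx, y, hy, hxy⟩ := isCutset_iff.1 hcut
      by_contra! hcon
      exact hxy ((hcon x hx).symm.trans (hcon y hy))
    obtain ⟨x, hx, hjx⟩ := hex
    obtain ⟨k, hk, hTk, y, hy, hxy, hpy⟩ :=
      (hW.sameComponent_petal_or hT3 hp hinner hj hx).resolve_left hjx
    -- An interior vertex of $T$ would be $u_{k,k+1}$, the only neighbour of $p$ in the sector. But
    -- $y\notin T$ is such a neighbour.
    have hTeq : T = {F.center, F.petal k, F.petal (k + 1)} := by
      refine eq_of_subset_triple hT3 fun s hs => ?_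
      rcases mem_sector.1 (hTk hs) with h | h
      · have hsu := eq_u_of_mem_nbhd hG (hsub hs) h
        rcases u_eq_center_or hG k with h' | ⟨-, -, h'⟩
        · exact Or.inl (hsu.trans h')
        · rw [hsu, ← h' y (Or.inl hy) hpy] at hs
          exact absurd hs hxy.notMem_right
      · exact h
    exact ⟨k, contains_M'_iff.2 ⟨Or.inl hp, Or.inl (by rw [hTeq]; simp),
      Or.inl (by rw [hTeq]; simp)⟩⟩
  · right
    obtain ⟨x, hx, hpx⟩ := exists_not_sameComponent_center (F := F) hcut
    have hcl : IsClosedOff G T {y | SameComponent G T x y} := isClosedOff_component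
    have hpC : F.center ∉ {y | SameComponent G T x y} := fun h => hpx (SameComponent.symm h)
    have huT : ∀ k, (F.inter k ∩ T).Nonempty → F.u k ∈ T := by
      rintro k ⟨y, hy, hyT⟩
      rwa [← eq_u_of_mem_nbhd hG (hsub hyT) hy]
    -- Within $\mathrm{Nb}(F)$ each interior has at most one vertex, which rules out the option in
    -- `CutsOne` of two vertices in one interior.
    have hss : ∀ k, (F.inter k ∩ T).Subsingleton := fun k y hy z hz =>
      (eq_u_of_mem_nbhd hG (hsub hy.2) hy.1).trans (eq_u_of_mem_nbhd hG (hsub hz.2) hz.1).symm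
    by_cases hq : ∃ j, F.petal j ∈ {y | SameComponent G T x y}
    · rcases hW.cuts hT3 hcl hp hpC hq with ⟨a, -, h | h⟩ | ⟨a, -, h⟩ | ⟨h, -⟩
      · obtain ⟨h1, h2, h3, h4⟩ := h
        exact Or.inl ⟨a, contains_M'_iff.2 ⟨Or.inr (huT a h3), Or.inr ⟨h1, h2⟩,
          Or.inl (h4.resolve_right fun h => h (hss a))⟩⟩
      · obtain ⟨h1, h2, h3, h4⟩ := h
        refine Or.inl ⟨a - 1, contains_M'_iff.2 ⟨Or.inr (huT _ h3),
          Or.inl (h4.resolve_right fun h => h (hss _)), Or.inr ⟨?_, ?_⟩⟩⟩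
        · rwa [sub_add_cancel]
        · rwa [show a - 1 + 2 = a + 1 by ring]
      · obtain ⟨s, hs, hsT, hps, huniq⟩ := h.exists_unique_neighbor
        exact Or.inl ⟨a, contains_M'_iff.2 ⟨Or.inr (huT a ⟨s, hs, hsT⟩),
          Or.inr ⟨h.left_empty, h.left_mem⟩, Or.inr ⟨h.right_empty, h.right_mem⟩⟩⟩
      · exact Or.inr (isSingular_of_cutsAll hT3 h)
    · push Not at hq
      obtain ⟨k, -, hTk, -⟩ :=
        hW.mem_interior_of_forall_petal_notMem hT3 hcl hq hpC (SameComponent.refl hx)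
      have hTeq : T = {F.u k, F.petal k, F.petal (k + 1)} := by
        refine eq_of_subset_triple hT3 fun s hs => ?_
        rcases mem_sector.1 (hTk hs) with h | rfl | h
        exacts [Or.inl (eq_u_of_mem_nbhd hG (hsub hs) h), absurd hs hp, Or.inr h]
      exact Or.inl ⟨k, contains_M'_iff.2 ⟨Or.inr (by rw [hTeq]; simp),
        Or.inl (by rw [hTeq]; simp), Or.inl (by rw [hTeq]; simp)⟩⟩

theorem cut_of_petalTriple_succ (hG : IsTriconnected G) (hmax : F.IsMaximal)
    (hnd : F.IsNondegenerate) {i : ZMod F.m} (hu : F.u i ≠ F.center) :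
    petalTriple F.center F.petal i (i + 1) ∈ threeCutsets G ∧
      (parts G {petalTriple F.center F.petal i (i + 1)}).ncard = 2 ∧
      Splits G (petalTriple F.center F.petal i (i + 1)) F.nbhd := by
  have hW := F.isTightWheel hG hmax hnd
  obtain ⟨n1, n2, n3⟩ := small_ne_zero hW.four_le
  obtain ⟨hui, hpu, huniq⟩ := (u_eq_center_or hG i).resolve_left hu
  set S := petalTriple F.center F.petal i (i + 1) with hSdef
  have hS : S.ncard = 3 := hW.ncard_petalTriple fun h => n1 (by linear_combination -h)
  have hp : F.center ∈ S := Or.inl rfl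
  have hinner : S ∉ innerTriples F.center F.petal := petalTriple_succ_notMem_innerSets i
  obtain ⟨j, hj⟩ := hW.exists_petal_notMem hS.le
  have huS : F.u i ∉ S := hW.interior_notMem_petalTriple hui
  have hne : ¬ SameComponent G S (F.u i) (F.petal j) := by
    intro h
    refine hW.petal_notMem i j (h.mem_of_closed hui fun a ha b hb hab => ?_)
    exact (hW.adj_interior ha hab).resolve_right hb
  refine ⟨⟨hS, isCutset_iff.2 ⟨_, huS, _, hj, hne⟩⟩, ncard_parts_singleton huS hj hne ?_,
    F.u i, ⟨F.u_mem_nbhd i, huS⟩, F.petal j, ⟨F.petal_mem_nbhd j, hj⟩, hne⟩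
  intro z hz
  -- A component away from the petals contains a neighbour of $p$ in this sector, necessarily
  -- $u_{i,i+1}$, so there is only one such component.
  rcases hW.sameComponent_petal_or hS hp hinner hj hz with h | ⟨k, hk, hSk, y, hy, hzy, hpy⟩
  · exact Or.inr h
  · left
    have e1 := hW.petal_mem_sector.1 (hSk (Or.inr (Or.inl rfl)))
    have e2 := hW.petal_mem_sector.1 (hSk (Or.inr (Or.inr rfl)))
    have hik : i = k := by
      rcases e1 with e1 | e1
      · exact e1
      · rcases e2 with e2 | e2
        · exact absurd (by linear_combination e2 - e1) n2
        · exact add_right_cancel e2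
    subst hik
    rw [← huniq y (Or.inl hy) hpy]
    exact hzy.symm

/-- The listed sets are `3`-cutsets splitting the neighbourhood. -/
theorem cut_of_isListed (hG : IsTriconnected G) (hmax : F.IsMaximal)
    (hnd : F.IsNondegenerate) {T : Set V} (hT : F.IsListed T) (hQ : ∀ i, T ≠ F.Q' i) :
    T ∈ threeCutsets G ∧ (parts G {T}).ncard = 2 ∧ Splits G T F.nbhd := by
  have hW := F.isTightWheel hG hmax hnd
  obtain ⟨n1, n2, n3⟩ := small_ne_zero hW.four_le
  have inner : ∀ i j, i ≠ j → j ≠ i + 1 → i ≠ j + 1 → T = petalTriple F.center F.petal i j →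
      T ∈ threeCutsets G ∧ (parts G {T}).ncard = 2 ∧ Splits G T F.nbhd := by
    rintro i j h0 h1 h2 rfl
    obtain ⟨e1, e2, e3, e4⟩ := hW.inner_cut hG h0 h1 h2
    exact ⟨e1, e2, _, ⟨F.petal_mem_nbhd _, e3⟩, _, ⟨F.petal_mem_nbhd _, e4⟩,
      hW.not_sameComponent_inner h0 h1⟩
  have petal : T.ncard = 3 → F.center ∉ T → ∀ j, F.petal j ∉ T →
      ¬ SameComponent G T F.center (F.petal j) →
      (∀ k, ¬ T ⊆ sector F.center F.petal F.inter k) →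
      T ∈ threeCutsets G ∧ (parts G {T}).ncard = 2 ∧ Splits G T F.nbhd := by
    intro hT3 hp j hj hpj hsec
    obtain ⟨e1, e2⟩ := hW.two_parts_of_petal hT3 hp hj hpj hsec
    exact ⟨e1, e2, _, ⟨F.center_mem_nbhd, hp⟩, _, ⟨F.petal_mem_nbhd j, hj⟩, hpj⟩
  rcases hT with ⟨i, j, h0, h1, h2, h⟩ | ⟨i, hT3, hc⟩ | ⟨hsing, rfl⟩
  · exact inner i j h0 h1 h2 h
  · rw [contains_M'_iff] at hc
    obtain ⟨hc1, hc2, hc3⟩ := hc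
    by_cases hp : F.center ∈ T
    · have hTeq : ∀ a b, a ≠ b → F.petal a ∈ T → F.petal b ∈ T →
          T = petalTriple F.center F.petal a b := by
        intro a b hab ha hb
        refine (Set.eq_of_subset_of_ncard_le ?_ ?_).symm
        · rintro _ (rfl | rfl | rfl)
          exacts [hp, ha, hb]
        · rw [hT3, hW.ncard_petalTriple hab]
      rcases hc2 with h2 | ⟨e2, h2⟩ <;> rcases hc3 with h3 | ⟨e3, h3⟩
      · have e := hTeq _ _ (fun h => n1 (by linear_combination -h)) h2 h3
        have hu : F.u i ≠ F.center := fun hu => hQ i (by rw [e, Q'_eq_of_u_eq hu])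
        rw [e]
        exact cut_of_petalTriple_succ hG hmax hnd hu
      · exact inner _ _ (fun h => n2 (by linear_combination -h))
          (fun h => n1 (by linear_combination h)) (fun h => n3 (by linear_combination -h))
          (hTeq _ _ (fun h => n2 (by linear_combination -h)) h2 h3)
      · exact inner _ _ (fun h => n2 (by linear_combination -h))
          (fun h => n1 (by linear_combination h)) (fun h => n3 (by linear_combination -h))
          (hTeq _ _ (fun h => n2 (by linear_combination -h)) h2 h3)
      · have e := hTeq _ _ (fun h => n3 (by linear_combination -h)) h2 h3
        -- $Q_{i-1,i+2}$ is inner unless $m=4$. In that case it is $Q_{i+2,i+3}$, and either equals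
        -- $Q'_{i+2,i+3}$ or contradicts nondegeneracy, both adjacent interiors being empty.
        by_cases h4 : (4 : ZMod F.m) = 0
        · have h4' : i - 1 = i + 2 + 1 := by linear_combination -h4
          rcases u_eq_center_or hG (i + 2) with hu | ⟨hui, hpu, huniq⟩
          · refine absurd ?_ (hQ (i + 2))
            rw [Q'_eq_of_u_eq hu, e, ← h4', petalTriple, petalTriple, Set.pair_comm]
          · refine (hW.false_of_unique_neighbor (k := i + 2)
              (fun j => eq_of_four_eq_zero hW.four_le h4 _ j) ?_ ?_ hui hpu huniq).elim
            · rwa [show i + 2 - 1 = i + 1 by ring]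
            · rwa [← h4']
        · exact inner _ _ (fun h => n3 (by linear_combination -h))
            (fun h => n2 (by linear_combination h)) (fun h => h4 (by linear_combination -h)) e
    · have huT := hc1.resolve_left hp
      obtain ⟨hui, hpu, huniq⟩ := (u_eq_center_or hG i).resolve_left fun h => hp (h ▸ huT)
      have hnot : ¬ (F.petal i ∈ T ∧ F.petal (i + 1) ∈ T) := by
        rintro ⟨h1, h2⟩
        refine hQ i (Set.eq_of_subset_of_ncard_le ?_ ?_).symm
        · rintro _ (rfl | rfl | rfl)
          exacts [h1, huT, h2]
        · rw [hT3]
          refine (Set.ncard_eq_three.2 ⟨_, _, _, ?_, ?_, ?_, rfl⟩).ge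
          · exact fun h => hW.petal_notMem i i (h ▸ hui)
          · exact hW.inj.ne fun h => n1 (by linear_combination -h)
          · exact fun h => hW.petal_notMem i (i + 1) (h ▸ hui)
      -- Inside the sector $p$ is reached only from $u_{i,i+1}\in T$. Past a petal not in $T$, the
      -- next interior is empty and the next petal is in $T$.
      have hcl : IsClosedOff G T
          ((F.inter i ∪ {F.petal i, F.petal (i + 1)}) \ T) := by
        refine ⟨fun x hx => hx.2, ?_⟩
        have hcen : ∀ x, x ∈ sector F.center F.petal F.inter i → x ∉ T → ¬ G.Adj x F.center :=
          fun x hx hxT h => hxT (by rwa [huniq x hx h.symm])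
        rintro x ⟨hx | rfl | rfl, hxT⟩ y hyT hxy <;> refine ⟨?_, hyT⟩
        · rcases hW.adj_interior hx hxy with h | rfl | h
          exacts [Or.inl h, absurd hxy (hcen _ (Or.inl hx) hxT), Or.inr h]
        · obtain ⟨e, hT'⟩ := hc2.resolve_left hxT
          have hno := hcen _ (hW.petal_mem_sector.2 (Or.inl rfl)) hxT
          rcases hW.adj_petal hxy with (h | rfl | h) | h | rfl | rfl
          · exact Or.inl h
          · exact absurd hxy hno
          · exact Or.inr (Or.inr h)
          · rw [e] at h
            exact absurd h (Set.notMem_empty _)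
          · exact absurd hxy hno
          · exact absurd hT' hyT
        · obtain ⟨e, hT'⟩ := hc3.resolve_left hxT
          have hno := hcen _ (hW.petal_mem_sector.2 (Or.inr rfl)) hxT
          rcases hW.adj_petal hxy with (h | rfl | rfl) | h | rfl | h
          · rw [e] at h
            exact absurd h (Set.notMem_empty _)
          · exact absurd hxy hno
          · rw [add_assoc, one_add_one_eq_two] at hyT
            exact absurd hT' hyT
          · rw [add_sub_cancel_right] at h
            exact Or.inl h
          · exact absurd hxy hno
          · rw [add_sub_cancel_right] at h
            exact Or.inr (Or.inl h)
      have hpW : F.center ∉ (F.inter i ∪ {F.petal i, F.petal (i + 1)}) \ T := by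
        rintro ⟨h | h | h, -⟩
        exacts [hW.center_notMem _ h, hW.ne_center _ h.symm, hW.ne_center _ h.symm]
      have hsec : ∀ k, ¬ T ⊆ sector F.center F.petal F.inter k := by
        intro k hk
        obtain rfl := hW.eq_of_mem_sector hui (hk huT)
        by_cases h1 : F.petal i ∈ T
        · obtain ⟨-, h2⟩ := hc3.resolve_left fun h => hnot ⟨h1, h⟩
          rcases hW.petal_mem_sector.1 (hk h2) with h | h
          · exact n2 (by linear_combination h)
          · exact n1 (by linear_combination h)
        · obtain ⟨-, h2⟩ := hc2.resolve_left h1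
          rcases hW.petal_mem_sector.1 (hk h2) with h | h
          · exact n1 (by linear_combination -h)
          · exact n2 (by linear_combination -h)
      by_cases h1 : F.petal i ∈ T
      · have h2 : F.petal (i + 1) ∉ T := fun h => hnot ⟨h1, h⟩
        exact petal hT3 hp _ h2 (fun h => hpW (hcl.mem_of_sameComponent
          ⟨Or.inr (Or.inr rfl), h2⟩ h.symm)) hsec
      · exact petal hT3 hp _ h1 (fun h => hpW (hcl.mem_of_sameComponent
          ⟨Or.inr (Or.inl rfl), h1⟩ h.symm)) hsec
  · have hT3 : (F.centerNbhd).ncard = 3 := hsing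
    have hp : F.center ∉ F.centerNbhd := fun h => G.loopless.irrefl _ h
    obtain ⟨j, hj⟩ := hW.exists_petal_notMem hT3.le
    refine petal hT3 hp j hj (fun h => ?_) fun k hk => ?_
    · have : F.petal j ∈ ({F.center} : Set V) := h.mem_of_closed rfl (by
        rintro _ rfl b hb hab
        exact absurd hab hb)
      exact hW.ne_center _ this
    -- If all neighbours of $p$ lay in sector $k$, the other interiors would be empty, making
    -- $q_{k+2}$ a neighbour of $p$ outside that sector.
    · have hempty : ∀ l, l ≠ k → F.inter l = ∅ := by
        intro l hl
        by_contra hne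
        obtain ⟨x, hx, hpx⟩ := hW.exists_adj_center hG (Set.nonempty_iff_ne_empty.2 hne)
        exact hl (hW.eq_of_mem_sector hx (hk hpx))
      have hadj := hW.adj_center_petal hG (k := k + 2)
        (hempty _ fun h => n2 (by linear_combination h))
        (hempty _ fun h => n1 (by linear_combination h))
      rcases hW.petal_mem_sector.1 (hk hadj.symm) with h | h
      · exact n2 (by linear_combination h)
      · exact n1 (by linear_combination h)

/-- The set has a single interior vertex and the two petals beside it. Cutting off one or two petals
would require $q_{i-1}$ or $q_{i+2}$ in the set, and cutting off all would allow it only one petal.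
-/
theorem petal_sameComponent_of_Q' (hG : IsTriconnected G) (hmax : F.IsMaximal)
    (hnd : F.IsNondegenerate) {i : ZMod F.m} (hui : F.u i ∈ F.inter i) {j : ZMod F.m}
    (hj : F.petal j ∉ F.Q' i) : (F.Q' i).ncard = 3 ∧ F.center ∉ F.Q' i ∧
      SameComponent G (F.Q' i) F.center (F.petal j) := by
  have hW := F.isTightWheel hG hmax hnd
  obtain ⟨n1, n2, n3⟩ := small_ne_zero hW.four_le
  have hS : (F.Q' i).ncard = 3 := by
    refine Set.ncard_eq_three.2 ⟨_, _, _, ?_, ?_, ?_, rfl⟩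
    · exact fun h => hW.petal_notMem i i (h ▸ hui)
    · exact hW.inj.ne fun h => n1 (by linear_combination -h)
    · exact fun h => hW.petal_notMem i (i + 1) (h ▸ hui)
  have hp : F.center ∉ F.Q' i := by
    rintro (h | h | h)
    exacts [hW.ne_center _ h.symm, hW.center_notMem _ (h ▸ hui), hW.ne_center _ h.symm]
  have hq : ∀ {k}, F.petal k ∈ F.Q' i → k = i ∨ k = i + 1 := by
    rintro k (h | h | h)
    exacts [Or.inl (hW.inj h), absurd (h ▸ hui) (hW.petal_notMem _ _), Or.inr (hW.inj h)]
  have hint : ∀ {k}, (F.inter k ∩ F.Q' i).Nonempty → k = i := by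
    rintro k ⟨y, hy, rfl | rfl | rfl⟩
    exacts [absurd hy (hW.petal_notMem _ _), hW.eq_of_mem hy hui,
      absurd hy (hW.petal_notMem _ _)]
  refine ⟨hS, hp, ?_⟩
  by_contra hcon
  have hleft : F.petal (i - 1) ∉ F.Q' i := fun h => (hq h).elim
    (fun h => n1 (by linear_combination -h)) fun h => n2 (by linear_combination -h)
  have hright : F.petal (i + 2) ∉ F.Q' i := fun h => (hq h).elim
    (fun h => n2 (by linear_combination h)) fun h => n1 (by linear_combination h)
  rcases hW.cuts hS (isClosedOff_component (x := F.petal j)) hp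
    (fun h => hcon (SameComponent.symm h)) ⟨j, SameComponent.refl hj⟩ with
    ⟨a, -, h | h⟩ | ⟨a, -, h⟩ | ⟨h, -⟩
  · obtain rfl := hint h.2.2.1
    exact hleft h.2.1
  · have e := hint h.2.2.1
    refine hright ?_
    rw [show i + 2 = a + 1 by linear_combination -e]
    exact h.2.1
  · obtain ⟨s, hs, hsS, -⟩ := h.exists_unique_neighbor
    obtain rfl := hint ⟨s, hs, hsS⟩
    exact hleft h.left_mem
  · obtain ⟨c, hc⟩ := h.exists_petal
    have e1 := hc i (Or.inl rfl)
    have e2 := hc (i + 1) (Or.inr (Or.inr rfl))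
    exact n1 (by linear_combination e2 - e1)

theorem eq_of_petalTriple_subset_sector {i k : ZMod F.m}
    (h : petalTriple F.center F.petal i (i + 1) ⊆ sector F.center F.petal F.inter k) : i = k :=
  have hW := F.isWheel
  have e1 := hW.petal_mem_sector.1 (h (Or.inr (Or.inl rfl)))
  have e2 := hW.petal_mem_sector.1 (h (Or.inr (Or.inr rfl)))
  e1.elim id fun e1 => e2.elim
    (fun e2 => absurd (by linear_combination e2 - e1) (small_ne_zero hW.four_le).2.1)
    add_right_cancel

/-- The sets `Q'` do not split the neighbourhood; they are cutsets iff they bound something. -/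
theorem Q'_spec (hG : IsTriconnected G) (hmax : F.IsMaximal) (hnd : F.IsNondegenerate)
    (i : ZMod F.m) :
    ¬ Splits G (F.Q' i) F.nbhd ∧ (IsCutset G (F.Q' i) ↔ (F.inter' i).Nonempty) := by
  have hW := F.isTightWheel hG hmax hnd
  obtain ⟨n1, n2, n3⟩ := small_ne_zero hW.four_le
  rw [inter'_eq]
  rcases u_eq_center_or hG i with hu | ⟨hui, hpu, huniq⟩
  · rw [Q'_eq_of_u_eq hu]
    set S := petalTriple F.center F.petal i (i + 1) with hSdef
    have hS : S.ncard = 3 := hW.ncard_petalTriple fun h => n1 (by linear_combination -h)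
    have hinner : S ∉ innerTriples F.center F.petal := petalTriple_succ_notMem_innerSets i
    obtain ⟨j, hj⟩ := hW.exists_petal_notMem hS.le
    have key : ∀ {x}, x ∉ S → SameComponent G S (F.petal j) x ∨ x ∈ F.inter i := by
      intro x hx
      refine (hW.sameComponent_petal_or hS (Or.inl rfl) hinner hj hx).imp_right ?_
      rintro ⟨k, hk, hSk, -⟩
      rwa [eq_of_petalTriple_subset_sector hSk]
    refine ⟨?_, ?_, ?_⟩
    · have : ∀ x ∈ F.nbhd, x ∉ S → SameComponent G S (F.petal j) x := by
        intro x hx hxS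
        refine (key hxS).resolve_right fun h => hxS ?_
        rw [eq_u_of_mem_nbhd hG hx h, hu]
        exact Or.inl rfl
      rw [not_splits_iff]
      exact fun x hx hxS y hy hyS => (this x hx hxS).symm.trans (this y hy hyS)
    · intro hcut
      obtain ⟨x, hx, y, hy, hxy⟩ := isCutset_iff.1 hcut
      have hex : ∃ z, z ∉ S ∧ z ∈ F.inter i := by
        by_contra! hcon
        exact hxy (((key hx).resolve_right (hcon x hx)).symm.trans
          ((key hy).resolve_right (hcon y hy)))
      obtain ⟨z, -, hz⟩ := hex
      exact ⟨z, hz, fun h => hW.center_notMem i (by rw [← hu, ← show z = F.u i from h]; exact hz)⟩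
    · rintro ⟨x, hx, -⟩
      refine isCutset_iff.2 ⟨x, hW.interior_notMem_petalTriple hx, F.petal j, hj, fun h => ?_⟩
      exact hW.petal_notMem i j (h.mem_of_closed hx fun a ha b hb hab =>
        (hW.adj_interior ha hab).resolve_right hb)
  · obtain ⟨j, hj⟩ := hW.exists_petal_notMem (S := F.Q' i) (ncard_triple_le _ _ _)
    obtain ⟨hS, hp, -⟩ := petal_sameComponent_of_Q' hG hmax hnd hui hj
    refine ⟨?_, ?_, ?_⟩
    · have : ∀ x ∈ F.nbhd, x ∉ F.Q' i → SameComponent G (F.Q' i) F.center x := by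
        intro x hx hxS
        rcases sameComponent_or_petal hG hp hx hxS with h | ⟨k, rfl⟩
        · exact h
        · exact (petal_sameComponent_of_Q' hG hmax hnd hui hxS).2.2
      rw [not_splits_iff]
      exact fun x hx hxS y hy hyS => (this x hx hxS).symm.trans (this y hy hyS)
    · intro hcut
      obtain ⟨x, hx, hpx⟩ := exists_not_sameComponent_center (F := F) hcut
      have hcl : IsClosedOff G (F.Q' i) {y | SameComponent G (F.Q' i) x y} :=
        isClosedOff_component
      obtain ⟨k, hk, hSk, -⟩ := hW.mem_interior_of_forall_petal_notMem hS hcl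
        (fun l hl => hpx ((petal_sameComponent_of_Q' hG hmax hnd hui
          (hcl.notMem _ hl)).2.2.trans (SameComponent.symm hl)))
        (fun h => hpx (SameComponent.symm h)) (SameComponent.refl hx)
      obtain rfl := hW.eq_of_mem_sector hui (hSk (Or.inr (Or.inl rfl)))
      exact ⟨x, hk, fun h => hx (Or.inr (Or.inl h))⟩
    · rintro ⟨x, hx, hxu⟩
      have hxS : x ∉ F.Q' i := by
        rintro (rfl | h | rfl)
        exacts [hW.petal_notMem _ _ hx, hxu h, hW.petal_notMem _ _ hx]
      refine isCutset_iff.2 ⟨x, hxS, F.center, hp, fun h => ?_⟩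
      -- The interior without $u_{i,i+1}$ is closed off, since $u_{i,i+1}$ is its only access to
      -- $p$.
      have hmem : F.center ∈ F.inter i \ {F.u i} := h.mem_of_closed ⟨hx, hxu⟩ (by
        rintro a ⟨ha, hau⟩ b hb hab
        rcases hW.adj_interior ha hab with h | rfl | rfl | rfl
        · exact ⟨h, fun h' => hb (Or.inr (Or.inl h'))⟩
        · exact absurd (huniq a (Or.inl ha) hab.symm) hau
        · exact absurd (Or.inl rfl) hb
        · exact absurd (Or.inr (Or.inr rfl)) hb)
      exact hW.center_notMem _ hmem.1

theorem exists_petal_ne {S : Set V} (hS : S.ncard = 3) {s : V} (hs : s ∈ S) (x : V) :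
    ∃ j, F.petal j ∉ S \ {s} ∧ F.petal j ≠ x := by
  have hcard : (insert x (S \ {s})).ncard ≤ 3 := by
    refine (Set.ncard_insert_le _ _).trans ?_
    rw [Set.ncard_sdiff_singleton_of_mem hs, hS]
  obtain ⟨j, hj⟩ := F.isWheel.exists_petal_notMem hcard
  exact ⟨j, fun h => hj (Or.inr h), fun h => hj (Or.inl h)⟩

/-- A `3`-cutset through the center, not inside the neighbourhood but splitting it, cuts off one of
the vertices `u`. -/
theorem separates_of_center_mem (hG : IsTriconnected G) (hmax : F.IsMaximal)
    (hnd : F.IsNondegenerate) {S : Set V} (hS : S.ncard = 3) (hp : F.center ∈ S)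
    (hsplit : Splits G S F.nbhd) (hsub : ¬ S ⊆ F.nbhd) : (parts G {S}).ncard = 2 ∧
      ∃ x, x ≠ F.center ∧ x ∈ F.nbhd ∧ Separates G S {x} (F.nbhd \ {x}) ∧
        ∀ y ∈ F.nbhd, Separates G S {y} (F.nbhd \ {y}) → y = x := by
  have hW := F.isTightWheel hG hmax hnd
  have hinner : S ∉ innerTriples F.center F.petal := by
    rintro ⟨i, j, -, -, -, rfl⟩
    apply hsub
    rintro _ (rfl | rfl | rfl)
    exacts [F.center_mem_nbhd, F.petal_mem_nbhd _, F.petal_mem_nbhd _]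
  obtain ⟨j, hj⟩ := hW.exists_petal_notMem hS.le
  have hor := fun {x : V} => hW.sameComponent_petal_or hS hp hinner hj (x := x)
  have hex : ∃ x ∈ F.nbhd, x ∉ S ∧ ¬ SameComponent G S (F.petal j) x := by
    obtain ⟨x, hx, y, hy, hxy⟩ := hsplit
    by_contra! hcon
    exact hxy ((hcon x hx.1 hx.2).symm.trans (hcon y hy.1 hy.2))
  obtain ⟨x, hx, hxS, hjx⟩ := hex
  obtain ⟨k, hxk, hSk, -⟩ := (hor hxS).resolve_left hjx
  have hxu := eq_u_of_mem_nbhd hG hx hxk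
  have hxc : x ≠ F.center := fun h => hxS (h ▸ hp)
  obtain ⟨-, -, huniq⟩ := (u_eq_center_or hG k).resolve_left (hxu ▸ hxc)
  rw [← hxu] at huniq
  obtain ⟨s, hs, hsN⟩ := Set.not_subset.1 hsub
  -- A vertex of $S$ outside $\mathrm{Nb}(F)$ must be interior, so only one sector can contain $S$.
  -- All components away from the petals lie there, and all contain $u_{k,k+1}$.
  have hsk : ∀ l, S ⊆ sector F.center F.petal F.inter l → s ∈ F.inter l := by
    intro l hl
    rcases mem_sector.1 (hl hs) with h | rfl | rfl | rfl
    exacts [h, absurd F.center_mem_nbhd hsN, absurd (F.petal_mem_nbhd _) hsN,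
      absurd (F.petal_mem_nbhd _) hsN]
  have key : ∀ z, z ∉ S → SameComponent G S (F.petal j) z ∨
      (SameComponent G S x z ∧ z ∈ F.inter k) := by
    intro z hz
    refine (hor hz).imp_right ?_
    rintro ⟨l, hzl, hSl, y, hy, hzy, hpy⟩
    obtain rfl := hW.eq_of_mem (hsk l hSl) (hsk k hSk)
    rw [huniq y (Or.inl hy) hpy] at hzy
    exact ⟨hzy.symm, hzl⟩
  have hnb : ∀ w ∈ F.nbhd, w ≠ x → w ∉ S → SameComponent G S (F.petal j) w := by
    intro w hw hwx hwS
    exact (key w hwS).resolve_right fun h =>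
      hwx ((eq_u_of_mem_nbhd hG hw h.2).trans hxu.symm)
  have hjne : F.petal j ≠ x := fun h => hW.petal_notMem k j (h ▸ hxk)
  refine ⟨ncard_parts_singleton hj hxS hjx fun z hz => (key z hz).imp_right And.left,
    x, hxc, hx, ⟨fun h => hxS (h rfl), fun h => hj (h ⟨F.petal_mem_nbhd j, hjne⟩), ?_⟩, ?_⟩
  · rintro _ ⟨rfl, -⟩ w ⟨⟨hw, hwx⟩, hwS⟩ h
    exact hjx ((hnb w hw hwx hwS).trans h.symm)
  · rintro y hy ⟨h1, -, h3⟩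
    by_contra hyx
    have hyS : y ∉ S := fun h => h1 (Set.singleton_subset_iff.2 h)
    obtain ⟨l, hl, hly⟩ := exists_petal_ne (F := F) hS hp y
    have hlS : F.petal l ∉ S := fun h => hl ⟨h, hW.ne_center _⟩
    have hlx : F.petal l ≠ x := fun h => hW.petal_notMem k l (h ▸ hxk)
    exact h3 y ⟨rfl, hyS⟩ _ ⟨⟨F.petal_mem_nbhd l, hly⟩, hlS⟩
      ((hnb y hy hyx hyS).symm.trans (hnb _ (F.petal_mem_nbhd l) hlx hlS))

/-- A `3`-cutset avoiding the center, not inside the neighbourhood but splitting it, cuts off one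
of the petals. -/
theorem separates_of_center_notMem (hG : IsTriconnected G) (hmax : F.IsMaximal)
    (hnd : F.IsNondegenerate) {S : Set V} (hS : S.ncard = 3) (hp : F.center ∉ S)
    (hsplit : Splits G S F.nbhd) (hsub : ¬ S ⊆ F.nbhd) : (parts G {S}).ncard = 2 ∧
      ∃ x, x ≠ F.center ∧ x ∈ F.nbhd ∧ Separates G S {x} (F.nbhd \ {x}) ∧
        ∀ y ∈ F.nbhd, Separates G S {y} (F.nbhd \ {y}) → y = x := by
  have hW := F.isTightWheel hG hmax hnd
  obtain ⟨n1, n2, n3⟩ := small_ne_zero hW.four_le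
  have hex : ∃ x ∈ F.nbhd, x ∉ S ∧ ¬ SameComponent G S F.center x := by
    obtain ⟨x, hx, y, hy, hxy⟩ := hsplit
    by_contra! hcon
    exact hxy ((hcon x hx.1 hx.2).symm.trans (hcon y hy.1 hy.2))
  obtain ⟨_, hx, hjS, hpj⟩ := hex
  obtain ⟨j, rfl⟩ := (sameComponent_or_petal hG hp hx hjS).resolve_left hpj
  have hcl : ∀ z, IsClosedOff G S {y | SameComponent G S z y} := fun z => isClosedOff_component
  have hpC : F.center ∉ {y | SameComponent G S (F.petal j) y} :=
    fun h => hpj (SameComponent.symm h)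
  -- When two petals or all of them are cut off, the interior vertices of $S$ are vertices $u$, so
  -- $S\subset\mathrm{Nb}(F)$. Only the case of one petal survives.
  have hone : (∀ l, F.petal l ∈ {y | SameComponent G S (F.petal j) y} → l = j) ∧
      IsTightWheel.CutsOne F.inter F.petal S j := by
    rcases hW.cuts hS (hcl _) hp hpC ⟨j, SameComponent.refl hjS⟩ with
      ⟨a, hP, h⟩ | ⟨a, -, h⟩ | ⟨h, -⟩
    · obtain rfl := (hP j).1 (SameComponent.refl hjS)
      exact ⟨fun l hl => (hP l).1 hl, h⟩
    · exfalso
      obtain ⟨s, hs, hsS, hps, huniq⟩ := h.exists_unique_neighbor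
      have hu := u_eq_of_unique hs hps huniq (Or.inr ⟨h.left_empty, h.right_empty⟩)
      have e : ({s, F.petal (a - 1), F.petal (a + 2)} : Set V) = S := by
        refine Set.eq_of_subset_of_ncard_le ?_ ?_
        · rintro _ (rfl | rfl | rfl)
          exacts [hsS, h.left_mem, h.right_mem]
        · rw [hS]
          refine (Set.ncard_eq_three.2 ⟨_, _, _, ?_, ?_, ?_, rfl⟩).ge
          · exact fun h => hW.petal_notMem _ _ (h ▸ hs)
          · exact fun h => hW.petal_notMem _ _ (h ▸ hs)
          · exact hW.inj.ne fun h => n3 (by linear_combination -h)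
      apply hsub
      rw [← e]
      rintro _ (rfl | rfl | rfl)
      exacts [hu ▸ F.u_mem_nbhd a, F.petal_mem_nbhd _, F.petal_mem_nbhd _]
    · exfalso
      apply hsub
      intro y hy
      rcases hW.cover y with rfl | ⟨l, rfl⟩ | ⟨k, hk⟩
      · exact F.center_mem_nbhd
      · exact F.petal_mem_nbhd _
      · obtain ⟨e1, e2⟩ := h.petals_notMem k ⟨y, hk, hy⟩
        have hmemS : ∀ z, G.Adj F.center z → z ∈ S := fun z hz => by
          rw [h.eq_neighborSet]; exact hz
        have hpy : G.Adj F.center y := by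
          have := hy
          rwa [h.eq_neighborSet] at this
        have hu := u_eq_of_unique hk hpy (fun z hz hpz => ?_)
          (Or.inl (isSingular_of_cutsAll hS h).1)
        · exact hu ▸ F.u_mem_nbhd k
        · have hzS := hmemS z hpz
          rcases mem_sector.1 hz with hz | rfl | rfl | rfl
          exacts [h.subsingleton k ⟨hz, hzS⟩ ⟨hk, hy⟩, absurd hzS hp, absurd hzS e1,
            absurd hzS e2]
  obtain ⟨hP, hcuts⟩ := hone
  have hsec : ∀ k, ¬ S ⊆ sector F.center F.petal F.inter k := by
    intro k hk
    rcases hcuts with ⟨-, h2, ⟨s, hs, hsS⟩, -⟩ | ⟨-, h2, ⟨s, hs, hsS⟩, -⟩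
    · obtain rfl := hW.eq_of_mem_sector hs (hk hsS)
      rcases hW.petal_mem_sector.1 (hk h2) with h | h
      · exact n1 (by linear_combination -h)
      · exact n2 (by linear_combination -h)
    · obtain rfl := hW.eq_of_mem_sector hs (hk hsS)
      rcases hW.petal_mem_sector.1 (hk h2) with h | h
      · exact n2 (by linear_combination h)
      · exact n1 (by linear_combination h)
  have hnb : ∀ w ∈ F.nbhd, w ≠ F.petal j → w ∉ S → SameComponent G S F.center w := by
    intro w hw hwj hwS
    rcases sameComponent_or_petal hG hp hw hwS with h | ⟨l, rfl⟩
    · exact h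
    · by_contra hpl
      obtain ⟨a, h1, h2⟩ := hW.exists_petal_mem_both hS (hcl (F.petal j)) (hcl (F.petal l)) hp hpC
        (fun h => hpl (SameComponent.symm h)) ⟨j, .refl hjS⟩ ⟨l, .refl hwS⟩
      exact hwj (congrArg _ (hP l (SameComponent.trans h1 (SameComponent.symm h2))))
  refine ⟨(hW.two_parts_of_petal hS hp hjS hpj hsec).2, F.petal j, hW.ne_center j, hx,
    ⟨fun h => hjS (h rfl), fun h => hp (h ⟨F.center_mem_nbhd, (hW.ne_center j).symm⟩), ?_⟩, ?_⟩
  · rintro _ ⟨rfl, -⟩ w ⟨⟨hw, hwx⟩, hwS⟩ h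
    exact hpj ((hnb w hw hwx hwS).trans h.symm)
  · rintro y hy ⟨h1, -, h3⟩
    by_contra hyj
    have hyS : y ∉ S := fun h => h1 (Set.singleton_subset_iff.2 h)
    have hpy := hnb y hy hyj hyS
    -- The center is not isolated in $\mathrm{Nb}(F)$: $S$ has an interior vertex, hence at most two
    -- petals, so one of the at least four petals is neither in $S$ nor $q_j$ and stays with $p$.
    by_cases hyc : y = F.center
    · have hint : ∃ k, ∃ s ∈ F.inter k, s ∈ S := by
        rcases hcuts with ⟨-, -, ⟨s, hs, hsS⟩, -⟩ | ⟨-, -, ⟨s, hs, hsS⟩, -⟩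
        exacts [⟨_, s, hs, hsS⟩, ⟨_, s, hs, hsS⟩]
      obtain ⟨k, s, hs, hsS⟩ := hint
      obtain ⟨l, hl, hlj⟩ := exists_petal_ne (F := F) hS hsS (F.petal j)
      have hlS : F.petal l ∉ S := fun h => hl ⟨h, fun e =>
        hW.petal_notMem k l (by rw [show F.petal l = s from e]; exact hs)⟩
      exact h3 y ⟨rfl, hyS⟩ _ ⟨⟨F.petal_mem_nbhd l, hyc ▸ hW.ne_center l⟩, hlS⟩
        (hpy.symm.trans (hnb _ (F.petal_mem_nbhd l) hlj hlS))
    · exact h3 y ⟨rfl, hyS⟩ _ ⟨⟨F.center_mem_nbhd, fun h => hyc h.symm⟩, hp⟩ hpy.symm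

end Flower

end Neighborhood

end ThreeCut

theorem mainTheorem5 {V : Type*} [Finite V] (G : SimpleGraph V)
    (hG : IsTriconnected G) (hcard : 6 < Nat.card V)
    (F : Flower G) (hmax : F.IsMaximal) (hnd : F.IsNondegenerate) :
    -- the `3`-cutsets inside the neighbourhood
    (∀ T ∈ threeCutsets G, T ⊆ F.nbhd →
      T ∈ F.innerSets ∨
      (∃ i, (F.M' i).Contains (VertexEdgeSet.ofVerts T)) ∨
      (F.IsSingular ∧ T = F.centerNbhd)) ∧
    (∀ T : Set V, F.IsListed T → (∀ i, T ≠ F.Q' i) →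
      T ∈ threeCutsets G ∧ (parts G {T}).ncard = 2 ∧ Splits G T F.nbhd) ∧
    (∀ i, ¬ Splits G (F.Q' i) F.nbhd ∧ (IsCutset G (F.Q' i) ↔ (F.inter' i).Nonempty)) ∧
    -- the other `3`-cutsets that split the neighbourhood
    (∀ S ∈ threeCutsets G, Splits G S F.nbhd → ¬ S ⊆ F.nbhd →
      (parts G {S}).ncard = 2 ∧
      (∃! x, x ∈ F.nbhd ∧ Separates G S {x} (F.nbhd \ {x})) ∧
      ∀ x ∈ F.nbhd, Separates G S {x} (F.nbhd \ {x}) → x ≠ F.center) := by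
  refine ⟨fun T hT hsub => Flower.listed_of_subset_nbhd hG hmax hnd hT hsub,
    fun T hT hQ => Flower.cut_of_isListed hG hmax hnd hT hQ,
    fun i => Flower.Q'_spec hG hmax hnd i, fun S hS hsplit hsub => ?_⟩
  have key : (parts G {S}).ncard = 2 ∧
      ∃ x, x ≠ F.center ∧ x ∈ F.nbhd ∧ Separates G S {x} (F.nbhd \ {x}) ∧
        ∀ y ∈ F.nbhd, Separates G S {y} (F.nbhd \ {y}) → y = x := by
    by_cases hp : F.center ∈ S
    · exact Flower.separates_of_center_mem hG hmax hnd hS.1 hp hsplit hsub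
    · exact Flower.separates_of_center_notMem hG hmax hnd hS.1 hp hsplit hsub
  obtain ⟨h1, x, hxc, hx, hsep, huniq⟩ := key
  exact ⟨h1, ⟨x, ⟨hx, hsep⟩, fun y hy => huniq y hy.1 hy.2⟩,
    fun y hy h => huniq y hy h ▸ hxc⟩
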